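/- \textbf{Theorem (Maximal clique localization).} Let $\tau\in(2,3)$, $\mu>0$ and let $k\ge 3$ be a fixed integer. For each $n$ let $G^{(n)}$ be the inhomogeneous random graph (IRG) on $n$ vertices: the vertices have i.i.d. weights $w_1,\dots,w_n$ with $\mathbb{P}(w_i>x)=x^{1-\tau}$ for $x\ge 1$, and, given the weights, every pair of distinct vertices $u,v$ is joined by an edge, independently of the other pairs, with probability $\min\left(\frac{w_uw_v}{\mu n},1\right)$. A clique is maximal if it is not contained in a larger clique. Let $N(K_k)$ be the number of maximal cliques of $G^{(n)}$ with exactly $k$ vertices. For $\varepsilon>0$ let $M_n(\varepsilon)$ be the family of $k$-element vertex sets $\{v_1,\dots,v_k\}$ that can be labelled such that $$w_{v_i}\in[\varepsilon,1/\varepsilon]\,(\mu n)^{\frac{\tau-2}{\tau-1}}\ \text{ for } i=1,2,\qquad w_{v_i}\in[\varepsilon,1/\varepsilon]\,(\mu n)^{\frac{1}{\tau-1}}\ \text{ for } 3\le i\le k,$$ and let $N(K_k,M_n(\varepsilon))$ be the number of maximal cliques with exactly $k$ vertices whose vertex set belongs to $M_n(\varepsilon)$. Then: (i) For every sequence $\varepsilon_n>0$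 with $\lim_{n\to\infty}\varepsilon_n=0$, $$\frac{N\big(K_k,M_n(\varepsilon_n)\big)}{N(K_k)}\longrightarrow 1\quad\text{in probability as } n\to\infty$$ (with the convention $0/0=0$; the choice of convention does not affect the claim). (ii) For every fixed $0<\varepsilon<1$, $$\mathbb{E}\big[N(K_k,M_n(\varepsilon))\big]=\Theta\Big(n^{(3-\tau)(2\tau-3)/(\tau-1)}\Big)\quad\text{as } n\to\infty .$$ -/

import Mathlib

open Set Filter Topology MeasureTheory Asymptotics

namespace IRG

/-- The law of a vertex weight: the Pareto law with `ℙ(W > w) = w ^ (1 - τ)` for `w ≥ 1`. -/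
noncomputable def weightLaw (τ : ℝ) : Measure ℝ :=
  ProbabilityTheory.paretoMeasure 1 (τ - 1)

/-- Connection probability of two vertices of weights `x` and `y` in a graph on `n` vertices. -/
noncomputable def connProb (μ : ℝ) (n : ℕ) (x y : ℝ) : ℝ :=
  min (x * y / (μ * n)) 1

theorem connProb_comm (μ : ℝ) (n : ℕ) (x y : ℝ) : connProb μ n x y = connProb μ n y x := by
  rw [connProb, connProb, mul_comm x y]

/-- Sample space of the inhomogeneous random graph on the vertex set `Fin n`: a weight for every
vertex, and a number in `[0, 1]` for every unordered pair of vertices (the numbers attached to the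
degenerate pairs `s(u, u)` are never used). -/
abbrev Sample (n : ℕ) : Type :=
  (Fin n → ℝ) × (Sym2 (Fin n) → unitInterval)

/-- The probability measure on the sample space: the weights are i.i.d. with law `weightLaw τ`, the
numbers attached to the pairs are i.i.d. uniform on `[0, 1]`, and the two families are
independent. -/
noncomputable def sampleLaw (τ : ℝ) (n : ℕ) : Measure (Sample n) :=
  (Measure.pi fun _ : Fin n => weightLaw τ).prod
    (Measure.pi fun _ : Sym2 (Fin n) => (volume : Measure unitInterval))

/-- The inhomogeneous random graph: `u ≠ v` are adjacent if the uniform number of the pair is at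
most `connProb μ n (w u) (w v)`. So, given the weights, the edges are independent, and `{u, v}` is
present with probability `connProb μ n (w u) (w v)`. -/
def graph (μ : ℝ) {n : ℕ} (ω : Sample n) : SimpleGraph (Fin n) where
  Adj u v := u ≠ v ∧ (ω.2 s(u, v) : ℝ) ≤ connProb μ n (ω.1 u) (ω.1 v)
  symm := ⟨fun u v h => ⟨h.1.symm, by rw [Sym2.eq_swap, connProb_comm]; exact h.2⟩⟩
  loopless := ⟨fun _ h => h.1 rfl⟩

/-- `s` is (the vertex set of) a maximal clique of `G`: a clique contained in no larger clique. -/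
def IsMaximalClique {V : Type*} (G : SimpleGraph V) (s : Finset V) : Prop :=
  Maximal (fun t : Finset V => G.IsClique (t : Set V)) s

/-- The window `[ε m, m / ε]`. -/
def window (ε m : ℝ) : Set ℝ :=
  Icc (ε * m) (1 / ε * m)

/-- The family `M_n(ε)` of vertex sets: two vertices of `s` have weight in
`[ε, 1 / ε] (μ n) ^ ((τ - 2) / (τ - 1))`, and all the other vertices of `s` have weight in
`[ε, 1 / ε] (μ n) ^ (1 / (τ - 1))`. -/
def IsTypical (τ μ ε : ℝ) {n : ℕ} (w : Fin n → ℝ) (s : Finset (Fin n)) : Prop :=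
  ∃ u ∈ s, ∃ v ∈ s, u ≠ v ∧
    w u ∈ window ε ((μ * n) ^ ((τ - 2) / (τ - 1))) ∧
    w v ∈ window ε ((μ * n) ^ ((τ - 2) / (τ - 1))) ∧
    ∀ x ∈ s, x ≠ u → x ≠ v → w x ∈ window ε ((μ * n) ^ (1 / (τ - 1)))

open Classical in
/-- The number `N(K_k)` of maximal cliques with exactly `k` vertices. -/
noncomputable def numMaxCliques (μ : ℝ) (k : ℕ) {n : ℕ} (ω : Sample n) : ℕ :=
  (Finset.univ.filter fun s : Finset (Fin n) =>
    s.card = k ∧ IsMaximalClique (graph μ ω) s).card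

open Classical in
/-- The number `N(K_k, M_n(ε))` of maximal cliques with exactly `k` vertices whose vertex set
belongs to `M_n(ε)`. -/
noncomputable def numTypicalMaxCliques (τ μ ε : ℝ) (k : ℕ) {n : ℕ} (ω : Sample n) : ℕ :=
  (Finset.univ.filter fun s : Finset (Fin n) =>
    s.card = k ∧ IsMaximalClique (graph μ ω) s ∧ IsTypical τ μ ε ω.1 s).card

end IRG

/-!
Write `N = μ n`, `k = j + 2`, and let `L = N ^ ((τ - 2) / (τ - 1))` and `H = N ^ (1 / (τ - 1))` be
the low and the high scale, so that `L * H = N`. Let `E = (3 - τ) (2 τ - 3) / (τ - 1)`.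

*Upper bound.* Let `x₀ ≤ x₁` be the two lowest weights of a clique, and suppose `x₁ ≤ N`, which
holds with high probability for all vertices. A vertex of weight at least `N / x₁` is adjacent to
all the vertices of the clique but the lowest one, and to that one with probability at least
`x₀ / x₁`. So each further vertex extends the clique with probability at least
`x₀ / x₁ * (N / x₁) ^ (1 - τ)`. Given the weights of the clique, the other vertices do so
independently, so the probability that none does is at most the exponential of `-(n / 2)` times this
number, if `n ≥ 2 k` (`avoidProb_le`). Further, only the edges at the two lowest vertices enter.
The Pareto density is a restriction of the homogeneous density `(τ - 1) x ^ (-τ)`, so rescaling two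
weights by `L` and the others by `H` turns the bound into a multiple of `n ^ E` times the integral
of a function `cliqueDensity` that does not depend on `n` (`edges_mul_avoidProb_le`,
`scales_mul_eq`). For `τ ∈ (2, 3)` and `j ≥ 1` this function is integrable
(`lintegral_cliqueDensity_lt_top`). Hence the expected number of typical maximal cliques is
`O(n ^ E)`; and by dominated convergence the expected number of those maximal cliques with a
rescaled weight outside `[ε n, 1 / ε n]` is `o(n ^ E)` as soon as `ε n → 0`
(`tendsto_setLIntegral_cliqueDensity`).

*Lower bound in expectation.* For weights within constant factors of the scales, the lowest pair is
an edge with probability of order `L ^ 2 / N`, and all the other pairs are edges with probability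
bounded below. A further vertex is adjacent to both of the lowest vertices with probability
`O(1 / n)`, so with probability bounded below none of them extends the clique
(`exists_le_lintegral_numTypicalMaxCliques`).

*Lower bound in probability.* Given the weights, fix `j` vertices of weight at least `δ H`, which
form a clique, and count the pairs of vertices with weights in `[ε L, 2 ε L)` that are adjacent to
each other and to all of these. With the edges thinned to constant probabilities, Chebyshev's
inequality shows that this count is, up to a constant, at least `n ^ E`. Two vertices of a pair
have `O(ε ^ 2)` further common neighbours in expectation, so for small `ε`, by Markov's inequality,
only a small part of the pairs fails to give a maximal clique (`labelLaw_numMaxCliques_lt_le`). The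
weights are as needed with high probability, so the number of maximal cliques is at least of order
`n ^ E` with probability arbitrarily close to `1`
(`exists_eventually_sampleLaw_numMaxCliques_lt_le`). By Markov's inequality the atypical maximal
cliques are negligible compared with this.
-/

namespace IRG

open scoped ENNReal

/-! ### Product measures -/

theorem pi_mono_of_le {ι : Type*} [Fintype ι] {α : ι → Type*} [∀ i, MeasurableSpace (α i)]
    {m₁ m₂ : ∀ i, Measure (α i)} [∀ i, SigmaFinite (m₁ i)] (h : ∀ i, m₁ i ≤ m₂ i) :
    Measure.pi m₁ ≤ Measure.pi m₂ := by
  refine Measure.le_iff.2 fun s hs => ?_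
  have key : (Measure.pi m₁).toOuterMeasure ≤
      OuterMeasure.pi fun i => (m₂ i).toOuterMeasure := by
    refine OuterMeasure.le_pi.2 fun t _ => ?_
    change Measure.pi m₁ (Set.pi univ t) ≤ _
    rw [Measure.pi_pi]
    exact Finset.prod_le_prod' fun i _ => h i (t i)
  have := key s
  conv_rhs => rw [Measure.pi, toMeasure_apply _ _ hs]
  exact this

theorem pi_smul_measure {ι : Type*} [Fintype ι] {α : ι → Type*} [∀ i, MeasurableSpace (α i)]
    {m : ∀ i, Measure (α i)} [∀ i, SigmaFinite (m i)] (c : ι → ℝ≥0∞) (hc : ∀ i, c i ≠ ∞) :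
    Measure.pi (fun i => c i • m i) = (∏ i, c i) • Measure.pi m := by
  lift c to ι → NNReal using hc
  have : ∀ i, SigmaFinite ((c i : ℝ≥0∞) • m i) := fun i =>
    inferInstanceAs (SigmaFinite (c i • m i))
  refine Measure.pi_eq fun s _ => ?_
  simp [Finset.prod_mul_distrib]

theorem lintegral_fin_prod {n : ℕ} {f : Fin n → ℝ → ℝ≥0∞} (hf : ∀ i, Measurable (f i))
    (m : Measure ℝ) [SigmaFinite m] :
    ∫⁻ x, ∏ i, f i (x i) ∂(Measure.pi fun _ : Fin n => m) = ∏ i, ∫⁻ x, f i x ∂m := by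
  induction n with
  | zero => simp
  | succ n ih =>
    rw [← (measurePreserving_piFinSuccAbove (fun _ : Fin (n + 1) => m) 0).symm.lintegral_comp_emb
      (MeasurableEquiv.measurableEmbedding _)]
    simp only [Fin.prod_univ_succ, MeasurableEquiv.piFinSuccAbove_symm_apply, Fin.insertNthEquiv,
      Fin.insertNth_zero, Equiv.coe_fn_mk, Fin.cons_zero, Fin.cons_succ, Fin.zero_succAbove]
    rw [← ih fun i => hf i.succ]
    exact lintegral_prod_mul (μ := m) (ν := Measure.pi fun _ : Fin n => m) (f := f 0)
      (g := fun x : Fin n → ℝ => ∏ i, f i.succ (x i))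
      (hf 0).aemeasurable
      (Finset.measurable_prod _ fun i _ => (hf i.succ).comp (measurable_pi_apply i)).aemeasurable

theorem lintegral_fintype_prod {ι : Type*} [Fintype ι] {f : ι → ℝ → ℝ≥0∞}
    (hf : ∀ i, Measurable (f i)) (m : Measure ℝ) [SigmaFinite m] :
    ∫⁻ x, ∏ i, f i (x i) ∂(Measure.pi fun _ : ι => m) = ∏ i, ∫⁻ x, f i x ∂m := by
  let e := (Fintype.equivFin ι).symm
  rw [← (measurePreserving_piCongrLeft (fun _ => m) e).lintegral_comp_emb
    (MeasurableEquiv.measurableEmbedding _)]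
  simp_rw [← e.prod_comp, MeasurableEquiv.coe_piCongrLeft, Equiv.piCongrLeft_apply_apply]
  exact lintegral_fin_prod (fun i => hf (e i)) m

/-! ### The scale-invariant limit of the weight law -/

/-- The measure with density `(τ - 1) x ^ (-τ)` on `(0, ∞)`. It is infinite, and the weight law is
its restriction to `[1, ∞)`. -/
noncomputable def scaleMeasure (τ : ℝ) : Measure ℝ :=
  (volume.restrict (Ioi 0)).withDensity fun x => ENNReal.ofReal ((τ - 1) * x ^ (-τ))

instance (τ : ℝ) : SigmaFinite (scaleMeasure τ) := by
  unfold scaleMeasure; infer_instance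

theorem measurable_scaleDensity (τ : ℝ) :
    Measurable fun x : ℝ => ENNReal.ofReal ((τ - 1) * x ^ (-τ)) := by fun_prop

theorem lintegral_scaleMeasure (τ : ℝ) {f : ℝ → ℝ≥0∞} (hf : Measurable f) :
    ∫⁻ x, f x ∂(scaleMeasure τ) =
      ∫⁻ x in Ioi 0, ENNReal.ofReal ((τ - 1) * x ^ (-τ)) * f x := by
  rw [scaleMeasure, lintegral_withDensity_eq_lintegral_mul _ (measurable_scaleDensity τ) hf]
  rfl

theorem ae_pos_scaleMeasure (τ : ℝ) : ∀ᵐ x ∂(scaleMeasure τ), 0 < x :=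
  (withDensity_absolutelyContinuous _ _).ae_le (ae_restrict_mem measurableSet_Ioi)

theorem weightLaw_eq_restrict (τ : ℝ) : weightLaw τ = (scaleMeasure τ).restrict (Ici 1) := by
  rw [weightLaw, ProbabilityTheory.paretoMeasure, scaleMeasure,
    restrict_withDensity measurableSet_Ici, Measure.restrict_restrict measurableSet_Ici,
    inter_eq_left.2 (Ici_subset_Ioi.2 one_pos),
    ← withDensity_indicator measurableSet_Ici]
  congr 1
  ext x
  by_cases h : 1 ≤ x
  · simp [ProbabilityTheory.paretoPDF_of_le h, h]
  · simp [ProbabilityTheory.paretoPDF_of_lt (not_le.1 h), h]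

theorem weightLaw_le (τ : ℝ) : weightLaw τ ≤ scaleMeasure τ := by
  rw [weightLaw_eq_restrict]; exact Measure.restrict_le_self

theorem isProbabilityMeasure_weightLaw {τ : ℝ} (hτ : 2 < τ) :
    IsProbabilityMeasure (weightLaw τ) :=
  ProbabilityTheory.isProbabilityMeasure_paretoMeasure one_pos (by linarith)

theorem ae_one_le_weightLaw (τ : ℝ) : ∀ᵐ x ∂(weightLaw τ), 1 ≤ x := by
  rw [weightLaw_eq_restrict]; exact ae_restrict_mem measurableSet_Ici

/-- The homogeneity of `scaleMeasure`. -/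
theorem map_mul_scaleMeasure {τ c : ℝ} (hc : 0 < c) :
    (scaleMeasure τ).map (c * ·) = ENNReal.ofReal (c ^ (τ - 1)) • scaleMeasure τ := by
  refine Measure.ext_of_lintegral _ fun f hf => ?_
  rw [lintegral_map hf (measurable_const_mul c), lintegral_scaleMeasure τ (by fun_prop),
    lintegral_smul_measure, lintegral_scaleMeasure τ hf, smul_eq_mul,
    ← lintegral_const_mul _ (by fun_prop), ← lintegral_indicator measurableSet_Ioi,
    ← lintegral_indicator measurableSet_Ioi]
  have hg : Measurable fun y : ℝ => (Ioi (0 : ℝ)).indicator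
      (fun y => ENNReal.ofReal ((τ - 1) * (c⁻¹ * y) ^ (-τ)) * f y) y :=
    Measurable.indicator (by fun_prop) measurableSet_Ioi
  have h1 := lintegral_map (μ := volume) hg (measurable_const_mul c)
  rw [Real.map_volume_mul_left hc.ne', lintegral_smul_measure, smul_eq_mul,
    ← lintegral_const_mul _ hg] at h1
  refine Eq.trans (lintegral_congr fun x => ?_) (h1.symm.trans (lintegral_congr fun x => ?_))
  · by_cases hx : 0 < x
    · simp [hx, hc, inv_mul_cancel_left₀ hc.ne']
    · simp [hx, hc]
  · by_cases hx : 0 < x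
    · simp only [mem_Ioi, hx, indicator_of_mem]
      rw [← mul_assoc, ← mul_assoc, ← ENNReal.ofReal_mul (abs_nonneg _),
        ← ENNReal.ofReal_mul (by positivity), Real.mul_rpow (by positivity) hx.le,
        abs_of_pos (inv_pos.2 hc), Real.inv_rpow hc.le, Real.rpow_neg hc.le, inv_inv,
        Real.rpow_sub_one hc.ne']
      congr 2
      field_simp
    · simp [hx]

theorem lintegral_comp_mul_scaleMeasure {τ c : ℝ} (hc : 0 < c) {f : ℝ → ℝ≥0∞}
    (hf : Measurable f) :
    ∫⁻ x, f (c * x) ∂(scaleMeasure τ) =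
      ENNReal.ofReal (c ^ (τ - 1)) * ∫⁻ x, f x ∂(scaleMeasure τ) := by
  rw [← lintegral_map hf (measurable_const_mul c), map_mul_scaleMeasure hc,
    lintegral_smul_measure, smul_eq_mul]

theorem setLIntegral_Ioi_rpow_scaleMeasure_lt_top {τ s : ℝ} (hs : s < τ - 1) :
    ∫⁻ x in Ioi 1, ENNReal.ofReal (x ^ s) ∂(scaleMeasure τ) < ∞ := by
  rw [← lintegral_indicator measurableSet_Ioi,
    lintegral_scaleMeasure τ (Measurable.indicator (by fun_prop) measurableSet_Ioi)]
  have h1 : IntegrableOn (fun x : ℝ => (τ - 1) * x ^ (s - τ)) (Ioi 1) :=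
    (integrableOn_Ioi_rpow_of_lt (by linarith) one_pos).const_mul _
  refine lt_of_le_of_lt ?_ h1.lintegral_lt_top
  rw [← lintegral_indicator measurableSet_Ioi, ← lintegral_indicator measurableSet_Ioi]
  refine lintegral_mono fun x => ?_
  by_cases hx : 1 < x
  · have hx0 : 0 < x := by linarith
    simp only [mem_Ioi, hx0, hx, indicator_of_mem]
    rw [← ENNReal.ofReal_mul' (by positivity), mul_assoc, ← Real.rpow_add hx0]
    exact ENNReal.ofReal_le_ofReal (by rw [neg_add_eq_sub])
  · by_cases hx0 : 0 < x <;> simp [hx, hx0]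

theorem setLIntegral_Ioc_rpow_scaleMeasure_lt_top {τ s : ℝ} (hs : τ - 1 < s) :
    ∫⁻ x in Ioc 0 1, ENNReal.ofReal (x ^ s) ∂(scaleMeasure τ) < ∞ := by
  rw [← lintegral_indicator measurableSet_Ioc,
    lintegral_scaleMeasure τ (Measurable.indicator (by fun_prop) measurableSet_Ioc)]
  have h1 : IntegrableOn (fun x : ℝ => (τ - 1) * x ^ (s - τ)) (Ioc 0 1) :=
    ((intervalIntegrable_iff_integrableOn_Ioc_of_le zero_le_one).1
      (intervalIntegral.intervalIntegrable_rpow' (by linarith))).const_mul _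
  refine lt_of_le_of_lt ?_ h1.lintegral_lt_top
  rw [← lintegral_indicator measurableSet_Ioi, ← lintegral_indicator measurableSet_Ioc]
  refine lintegral_mono fun x => ?_
  by_cases hx : x ∈ Ioc (0 : ℝ) 1
  · have hx0 : 0 < x := hx.1
    simp only [mem_Ioi, hx0, hx, indicator_of_mem]
    rw [← ENNReal.ofReal_mul' (by positivity), mul_assoc, ← Real.rpow_add hx0]
    exact ENNReal.ofReal_le_ofReal (by rw [neg_add_eq_sub])
  · by_cases hx0 : 0 < x <;> simp [hx, hx0]

theorem scaleMeasure_Ici {τ t : ℝ} (hτ : 1 < τ) (ht : 0 < t) :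
    scaleMeasure τ (Ici t) = ENNReal.ofReal (t ^ (1 - τ)) := by
  have h1 : scaleMeasure τ (Ici 1) = 1 := by
    have h := (ProbabilityTheory.isProbabilityMeasure_paretoMeasure one_pos
      (show (0 : ℝ) < τ - 1 by linarith)).measure_univ
    rw [← weightLaw, weightLaw_eq_restrict] at h
    simpa using h
  have h2 := congrArg (fun m : Measure ℝ => m (Ici 1))
    (map_mul_scaleMeasure (τ := τ) (inv_pos.2 ht))
  simp only [Measure.map_apply (measurable_const_mul _) measurableSet_Ici, Measure.smul_apply,
    h1, smul_eq_mul, mul_one] at h2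
  rw [show (1 : ℝ) - τ = -(τ - 1) by ring, Real.rpow_neg ht.le, ← Real.inv_rpow ht.le, ← h2]
  congr 1
  ext x
  rw [mem_preimage, mem_Ici, mem_Ici, ← div_eq_inv_mul, le_div_iff₀ ht, one_mul]

theorem weightLaw_Ici_le {τ t : ℝ} (hτ : 1 < τ) (ht : 0 < t) :
    weightLaw τ (Ici t) ≤ ENNReal.ofReal (t ^ (1 - τ)) :=
  (weightLaw_le τ _).trans (scaleMeasure_Ici hτ ht).le

theorem weightLaw_Ici {τ t : ℝ} (hτ : 1 < τ) (ht : 1 ≤ t) :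
    weightLaw τ (Ici t) = ENNReal.ofReal (t ^ (1 - τ)) := by
  rw [weightLaw_eq_restrict, Measure.restrict_apply measurableSet_Ici,
    inter_eq_left.2 (Ici_subset_Ici.2 ht), scaleMeasure_Ici hτ (by linarith)]

theorem weightLaw_Ico {τ s t : ℝ} (hτ : 1 < τ) (hs : 1 ≤ s) (hst : s ≤ t) :
    weightLaw τ (Ico s t) = ENNReal.ofReal (s ^ (1 - τ) - t ^ (1 - τ)) := by
  rw [← Ici_sdiff_Ici, measure_sdiff (Ici_subset_Ici.2 hst) measurableSet_Ici.nullMeasurableSet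
    (by rw [weightLaw_Ici hτ (hs.trans hst)]; exact ENNReal.ofReal_ne_top),
    weightLaw_Ici hτ hs, weightLaw_Ici hτ (hs.trans hst),
    ENNReal.ofReal_sub _ (Real.rpow_nonneg (by linarith) _)]

/-! ### Truncated moments and the limit integral -/

/-- The constant `∫ x min(x, 1) dν` of the measure `ν = scaleMeasure τ`. -/
noncomputable def truncMoment (τ : ℝ) : ℝ≥0∞ :=
  ∫⁻ x, ENNReal.ofReal (x * min x 1) ∂(scaleMeasure τ)

theorem truncMoment_lt_top {τ : ℝ} (h2 : 2 < τ) (h3 : τ < 3) : truncMoment τ < ∞ := by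
  have hle : truncMoment τ ≤ (∫⁻ x in Ioc 0 1, ENNReal.ofReal (x ^ (2 : ℝ)) ∂(scaleMeasure τ)) +
      ∫⁻ x in Ioi 1, ENNReal.ofReal (x ^ (1 : ℝ)) ∂(scaleMeasure τ) := by
    rw [truncMoment, ← lintegral_indicator measurableSet_Ioc,
      ← lintegral_indicator measurableSet_Ioi,
      ← lintegral_add_left (Measurable.indicator (by fun_prop) measurableSet_Ioc)]
    refine lintegral_mono_ae ?_
    filter_upwards [ae_pos_scaleMeasure τ] with x hx
    by_cases h : x ≤ 1
    · simp [hx, h, not_lt.2 h, pow_two]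
    · simp [h, not_le.1 h, (not_le.1 h).le]
  exact hle.trans_lt (ENNReal.add_lt_top.2
    ⟨setLIntegral_Ioc_rpow_scaleMeasure_lt_top (by linarith),
      setLIntegral_Ioi_rpow_scaleMeasure_lt_top (by linarith)⟩)

theorem lintegral_mul_min {τ A : ℝ} (hA : 0 < A) :
    ∫⁻ x, ENNReal.ofReal (x * min (A * x) 1) ∂(scaleMeasure τ) =
      ENNReal.ofReal (A ^ (τ - 2)) * truncMoment τ := by
  have h := lintegral_comp_mul_scaleMeasure (τ := τ) hA
    (f := fun x => ENNReal.ofReal (x * min x 1)) (by fun_prop)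
  have h' : ∀ x : ℝ, ENNReal.ofReal (x * min (A * x) 1) =
      ENNReal.ofReal A⁻¹ * ENNReal.ofReal (A * x * min (A * x) 1) := fun x => by
    rw [← ENNReal.ofReal_mul (by positivity)]
    congr 1
    field_simp
  simp_rw [h']
  rw [lintegral_const_mul _ (by fun_prop), h, ← mul_assoc, ← ENNReal.ofReal_mul (by positivity),
    truncMoment]
  congr 2
  rw [show τ - 2 = τ - 1 - 1 by ring, Real.rpow_sub_one hA.ne' (τ - 1)]
  field_simp

theorem setLIntegral_Iic_sq_le {τ B : ℝ} (hB : 0 < B) :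
    ∫⁻ x in Iic B, ENNReal.ofReal (x ^ 2) ∂(scaleMeasure τ) ≤
      ENNReal.ofReal (B ^ (3 - τ)) * truncMoment τ := by
  have h := lintegral_mul_min (τ := τ) (inv_pos.2 hB)
  calc ∫⁻ x in Iic B, ENNReal.ofReal (x ^ 2) ∂(scaleMeasure τ)
      ≤ ∫⁻ x, ENNReal.ofReal B * ENNReal.ofReal (x * min (B⁻¹ * x) 1) ∂(scaleMeasure τ) := by
        rw [← lintegral_indicator measurableSet_Iic]
        refine lintegral_mono_ae ?_
        filter_upwards [ae_pos_scaleMeasure τ] with x hx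
        by_cases h : x ≤ B
        · have : B⁻¹ * x ≤ 1 := by rw [← div_eq_inv_mul, div_le_one hB]; exact h
          simp only [mem_Iic, h, indicator_of_mem, min_eq_left this]
          rw [← ENNReal.ofReal_mul hB.le]
          apply le_of_eq
          congr 1
          field_simp
        · simp [h]
    _ = _ := by
        rw [lintegral_const_mul _ (by fun_prop), h, ← mul_assoc, ← ENNReal.ofReal_mul hB.le,
          Real.inv_rpow hB.le, ← Real.rpow_neg hB.le]
        congr 2
        nth_rewrite 1 [← Real.rpow_one B]
        rw [← Real.rpow_add hB]
        congr 1
        ring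

/-- Rescaled expected number of common neighbours of two vertices of rescaled weights `x`, `y`. -/
noncomputable def commonMass (τ x y : ℝ) : ℝ≥0∞ :=
  ∫⁻ z, ENNReal.ofReal (min (x * z) 1 * min (y * z) 1) ∂(scaleMeasure τ)

theorem commonMass_le {τ x y : ℝ} (hx : 0 < x) (hy : 0 < y) :
    commonMass τ x y ≤ ENNReal.ofReal (x * y ^ (τ - 2)) * truncMoment τ := by
  calc commonMass τ x y
      ≤ ∫⁻ z, ENNReal.ofReal x * ENNReal.ofReal (z * min (y * z) 1) ∂(scaleMeasure τ) := by
        refine lintegral_mono_ae ?_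
        filter_upwards [ae_pos_scaleMeasure τ] with z hz
        rw [← ENNReal.ofReal_mul hx.le, ← mul_assoc]
        exact ENNReal.ofReal_le_ofReal
          (mul_le_mul_of_nonneg_right (min_le_left _ _) (by positivity))
    _ = _ := by
        rw [lintegral_const_mul _ (by fun_prop), lintegral_mul_min hy, ← mul_assoc,
          ← ENNReal.ofReal_mul hx.le]

/-- Elements of the index type of a `(j + 2)`-clique: `inl 0` and `inl 1` stand for the two
vertices of lowest weight, `inr l` for the other `j` vertices. -/
abbrev CliqueIndex (j : ℕ) : Type := Fin 2 ⊕ Fin j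

theorem exists_pow_mul_exp_neg_le {c : ℝ} (hc : 0 < c) {j : ℕ} (hj : 1 ≤ j) :
    ∃ C : ℝ, 0 < C ∧ ∀ t : ℝ, 0 ≤ t → t ^ j * Real.exp (-(c * t)) ≤ C * min t 1 := by
  have key : ∀ i : ℕ, ∀ t : ℝ, 0 ≤ t → t ^ i * Real.exp (-(c * t)) ≤ i.factorial / c ^ i := by
    intro i t ht
    have h := Real.pow_div_factorial_le_exp (c * t) (by positivity) i
    rw [div_le_iff₀ (by positivity), mul_pow] at h
    rw [Real.exp_neg, ← div_eq_mul_inv, div_le_div_iff₀ (Real.exp_pos _) (by positivity)]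
    linarith
  obtain ⟨i, rfl⟩ := Nat.exists_eq_add_of_le' hj
  refine ⟨i.factorial / c ^ i + (i + 1).factorial / c ^ (i + 1), by positivity, fun t ht => ?_⟩
  have h0 : (0 : ℝ) ≤ i.factorial / c ^ i := by positivity
  have h0' : (0 : ℝ) ≤ (i + 1).factorial / c ^ (i + 1) := by positivity
  rcases le_total t 1 with h | h
  · rw [min_eq_left h, pow_succ]
    nlinarith [key i t ht]
  · rw [min_eq_right h]
    linarith [key (i + 1) t ht]

/-- The rescaled density of the weights of the two lowest vertices of a maximal clique, up to a
constant factor. -/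
noncomputable def pairDensity (τ c : ℝ) (x y : ℝ) : ℝ≥0∞ :=
  if x ≤ y then ENNReal.ofReal (x * y * Real.exp (-(c * (x * y ^ (τ - 2))))) else 0

theorem measurable_pairDensity (τ c : ℝ) :
    Measurable fun p : ℝ × ℝ => pairDensity τ c p.1 p.2 :=
  Measurable.ite (measurableSet_le measurable_fst measurable_snd) (by fun_prop) measurable_const

theorem measurable_commonMass (τ : ℝ) : Measurable fun p : ℝ × ℝ => commonMass τ p.1 p.2 := by
  unfold commonMass
  exact Measurable.lintegral_prod_right'
    (f := fun q : (ℝ × ℝ) × ℝ => ENNReal.ofReal (min (q.1.1 * q.2) 1 * min (q.1.2 * q.2) 1))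
    (by fun_prop)

/-- The integral over the lower of the two weights, with the exponential factor replaced by the
truncation `min _ 1`. For `y ≤ 1` the constraint `x ≤ y` is what makes it small; for `y > 1` the
truncation does. -/
theorem lintegral_ordered_le {τ y : ℝ} (h2 : 2 < τ) (hy : 0 < y) :
    ∫⁻ x, (if x ≤ y then ENNReal.ofReal (x * y * min (x * y ^ (τ - 2)) 1) else 0)
        ∂(scaleMeasure τ) ≤
      truncMoment τ * ((Ioc 0 1).indicator (fun y => ENNReal.ofReal (y ^ (2 : ℝ))) y +
        (Ioi 1).indicator (fun y => ENNReal.ofReal (y ^ (1 + (τ - 2) * (τ - 2)))) y) := by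
  rcases le_or_gt y 1 with h | h
  · rw [indicator_of_mem (show y ∈ Ioc (0 : ℝ) 1 from ⟨hy, h⟩),
      indicator_of_notMem (show y ∉ Ioi (1 : ℝ) from not_lt.2 h), add_zero]
    calc _ ≤ ∫⁻ x, ENNReal.ofReal (y ^ (τ - 1)) *
          (Iic y).indicator (fun x => ENNReal.ofReal (x ^ 2)) x ∂(scaleMeasure τ) := by
          refine lintegral_mono_ae ?_
          filter_upwards [ae_pos_scaleMeasure τ] with x hx
          by_cases hxy : x ≤ y
          · simp only [hxy, if_true, mem_Iic, indicator_of_mem]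
            rw [← ENNReal.ofReal_mul (by positivity)]
            refine ENNReal.ofReal_le_ofReal ?_
            have : y ^ (τ - 1) = y * y ^ (τ - 2) := by
              rw [← Real.rpow_one_add' hy.le (by linarith)]; congr 1; ring
            rw [this]
            calc _ ≤ x * y * (x * y ^ (τ - 2)) :=
                  mul_le_mul_of_nonneg_left (min_le_left _ _) (by positivity)
              _ = _ := by ring
          · simp [hxy]
      _ ≤ ENNReal.ofReal (y ^ (τ - 1)) * (ENNReal.ofReal (y ^ (3 - τ)) * truncMoment τ) := by
          rw [lintegral_const_mul _ (Measurable.indicator (by fun_prop) measurableSet_Iic),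
            lintegral_indicator measurableSet_Iic]
          gcongr
          exact setLIntegral_Iic_sq_le hy
      _ = _ := by
          rw [← mul_assoc, ← ENNReal.ofReal_mul (by positivity), ← Real.rpow_add hy, mul_comm]
          congr 3
          ring
  · rw [indicator_of_notMem (show y ∉ Ioc (0 : ℝ) 1 from fun h' => not_lt.2 h'.2 h),
      indicator_of_mem (show y ∈ Ioi (1 : ℝ) from h), zero_add]
    calc _ ≤ ∫⁻ x, ENNReal.ofReal y * ENNReal.ofReal (x * min (y ^ (τ - 2) * x) 1)
          ∂(scaleMeasure τ) := by
          refine lintegral_mono_ae ?_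
          filter_upwards [ae_pos_scaleMeasure τ] with x hx
          split_ifs
          · rw [← ENNReal.ofReal_mul hy.le]
            apply le_of_eq
            congr 1
            rw [mul_comm (y ^ (τ - 2)) x]
            ring
          · exact zero_le
      _ = _ := by
          rw [lintegral_const_mul _ (by fun_prop), lintegral_mul_min (by positivity), ← mul_assoc,
            ← ENNReal.ofReal_mul hy.le, mul_comm, ← Real.rpow_mul hy.le,
            Real.rpow_one_add' hy.le (by nlinarith)]

/-- The exponential in `pairDensity` absorbs the power of `commonMass`. For `j ≥ 1` a truncated
factor `min (x * y ^ (τ - 2)) 1` is left, without which the integral over the low weights would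
diverge. -/
theorem lintegral_pairDensity_mul_lt_top {τ c : ℝ} (h2 : 2 < τ) (h3 : τ < 3) (hc : 0 < c) {j : ℕ}
    (hj : 1 ≤ j) :
    ∫⁻ y, ∫⁻ x, pairDensity τ c x y * commonMass τ x y ^ j ∂(scaleMeasure τ)
      ∂(scaleMeasure τ) < ∞ := by
  obtain ⟨C, hC, hb⟩ := exists_pow_mul_exp_neg_le hc hj
  have hJ := truncMoment_lt_top h2 h3
  have h1 : ∀ x y : ℝ, 0 < x → 0 < y → pairDensity τ c x y * commonMass τ x y ^ j ≤
      truncMoment τ ^ j * ENNReal.ofReal C *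
        (if x ≤ y then ENNReal.ofReal (x * y * min (x * y ^ (τ - 2)) 1) else 0) := by
    intro x y hx hy
    unfold pairDensity
    split_ifs with hxy
    · calc _ ≤ ENNReal.ofReal (x * y * Real.exp (-(c * (x * y ^ (τ - 2))))) *
            (ENNReal.ofReal (x * y ^ (τ - 2)) * truncMoment τ) ^ j := by
            gcongr; exact commonMass_le hx hy
        _ = truncMoment τ ^ j * ENNReal.ofReal (x * y *
              ((x * y ^ (τ - 2)) ^ j * Real.exp (-(c * (x * y ^ (τ - 2)))))) := by
            rw [mul_pow, ← ENNReal.ofReal_pow (by positivity), ← mul_assoc,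
              ← ENNReal.ofReal_mul (by positivity), mul_comm]
            congr 2
            ring
        _ ≤ truncMoment τ ^ j * ENNReal.ofReal (x * y * (C * min (x * y ^ (τ - 2)) 1)) := by
            exact mul_le_mul' le_rfl (ENNReal.ofReal_le_ofReal
              (mul_le_mul_of_nonneg_left (hb _ (by positivity)) (by positivity)))
        _ = _ := by
            rw [mul_assoc (truncMoment τ ^ j), ← ENNReal.ofReal_mul hC.le]
            congr 2
            ring
    · simp
  calc _ ≤ ∫⁻ y, truncMoment τ ^ j * ENNReal.ofReal C * (truncMoment τ *
        ((Ioc 0 1).indicator (fun y => ENNReal.ofReal (y ^ (2 : ℝ))) y +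
        (Ioi 1).indicator (fun y => ENNReal.ofReal (y ^ (1 + (τ - 2) * (τ - 2)))) y))
          ∂(scaleMeasure τ) := by
        refine lintegral_mono_ae ?_
        filter_upwards [ae_pos_scaleMeasure τ] with y hy
        calc _ ≤ ∫⁻ x, truncMoment τ ^ j * ENNReal.ofReal C *
              (if x ≤ y then ENNReal.ofReal (x * y * min (x * y ^ (τ - 2)) 1) else 0)
                ∂(scaleMeasure τ) := by
              refine lintegral_mono_ae ?_
              filter_upwards [ae_pos_scaleMeasure τ] with x hx
              exact h1 x y hx hy
          _ ≤ _ := by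
              rw [lintegral_const_mul _
                (Measurable.ite measurableSet_Iic (by fun_prop) measurable_const)]
              gcongr
              exact lintegral_ordered_le h2 hy
    _ < ∞ := by
        have m1 : Measurable ((Ioc (0 : ℝ) 1).indicator fun y => ENNReal.ofReal (y ^ (2 : ℝ))) :=
          Measurable.indicator (by fun_prop) measurableSet_Ioc
        have m2 : Measurable ((Ioi (1 : ℝ)).indicator
            fun y => ENNReal.ofReal (y ^ (1 + (τ - 2) * (τ - 2)))) :=
          Measurable.indicator (by fun_prop) measurableSet_Ioi
        have m3 : Measurable fun y =>
            (Ioc (0 : ℝ) 1).indicator (fun y => ENNReal.ofReal (y ^ (2 : ℝ))) y +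
            (Ioi (1 : ℝ)).indicator (fun y => ENNReal.ofReal (y ^ (1 + (τ - 2) * (τ - 2)))) y :=
          m1.add m2
        rw [lintegral_const_mul _ (m3.const_mul _), lintegral_const_mul _ m3,
          lintegral_add_left m1, lintegral_indicator measurableSet_Ioc,
          lintegral_indicator measurableSet_Ioi]
        refine ENNReal.mul_lt_top (ENNReal.mul_lt_top (ENNReal.pow_lt_top hJ) ENNReal.ofReal_lt_top)
          (ENNReal.mul_lt_top hJ (ENNReal.add_lt_top.2 ⟨?_, ?_⟩))
        · exact setLIntegral_Ioc_rpow_scaleMeasure_lt_top (by linarith)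
        · exact setLIntegral_Ioi_rpow_scaleMeasure_lt_top (by nlinarith)

/-- The rescaled density of the weights of the vertices of a maximal clique, up to a constant
factor. -/
noncomputable def cliqueDensity (τ c : ℝ) {j : ℕ} (ξ : CliqueIndex j → ℝ) : ℝ≥0∞ :=
  pairDensity τ c (ξ (.inl 0)) (ξ (.inl 1)) *
    ∏ l : Fin j, ENNReal.ofReal
      (min (ξ (.inl 0) * ξ (.inr l)) 1 * min (ξ (.inl 1) * ξ (.inr l)) 1)

theorem measurable_cliqueDensity (τ c : ℝ) (j : ℕ) :
    Measurable (cliqueDensity τ c : (CliqueIndex j → ℝ) → ℝ≥0∞) := by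
  unfold cliqueDensity
  have h : Measurable fun ξ : CliqueIndex j → ℝ => (ξ (.inl 0), ξ (.inl 1)) := by fun_prop
  have h' : Measurable fun ξ : CliqueIndex j → ℝ => pairDensity τ c (ξ (.inl 0)) (ξ (.inl 1)) :=
    (measurable_pairDensity τ c).comp h
  exact h'.mul (by fun_prop)

/-- The limit integral is finite: this is where `2 < τ < 3` and the presence of a third vertex
enter. -/
theorem lintegral_cliqueDensity_lt_top {τ c : ℝ} (h2 : 2 < τ) (h3 : τ < 3) (hc : 0 < c) {j : ℕ}
    (hj : 1 ≤ j) :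
    ∫⁻ ξ, cliqueDensity τ c ξ ∂(Measure.pi fun _ : CliqueIndex j => scaleMeasure τ) < ∞ := by
  have hm : Measurable fun p : ℝ × ℝ => pairDensity τ c p.1 p.2 * commonMass τ p.1 p.2 ^ j :=
    (measurable_pairDensity τ c).mul ((measurable_commonMass τ).pow_const j)
  have h := lintegral_pairDensity_mul_lt_top h2 h3 hc hj
  rw [← lintegral_prod_symm' (μ := scaleMeasure τ) (ν := scaleMeasure τ) _ hm,
    ← (measurePreserving_finTwoArrow (scaleMeasure τ)).lintegral_comp hm] at h
  have hm' : Measurable fun p : (Fin 2 → ℝ) × (Fin j → ℝ) => cliqueDensity τ c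
      ((MeasurableEquiv.sumPiEquivProdPi fun _ : CliqueIndex j => ℝ).symm p) :=
    (measurable_cliqueDensity τ c j).comp (MeasurableEquiv.measurable _)
  rw [← (measurePreserving_sumPiEquivProdPi_symm
    (fun _ : CliqueIndex j => scaleMeasure τ)).lintegral_comp (measurable_cliqueDensity τ c j),
    lintegral_prod _ hm'.aemeasurable]
  refine lt_of_le_of_lt (le_of_eq (lintegral_congr fun x => ?_)) h
  have : ∀ y : Fin j → ℝ, cliqueDensity τ c
      ((MeasurableEquiv.sumPiEquivProdPi fun _ : CliqueIndex j => ℝ).symm (x, y)) =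
      pairDensity τ c (x 0) (x 1) *
        ∏ l : Fin j, ENNReal.ofReal (min (x 0 * y l) 1 * min (x 1 * y l) 1) := fun y => rfl
  simp_rw [this]
  rw [lintegral_const_mul _ (by fun_prop),
    lintegral_fintype_prod (f := fun _ z => ENNReal.ofReal (min (x 0 * z) 1 * min (x 1 * z) 1))
      (fun _ => by fun_prop), Finset.prod_const, Finset.card_univ, Fintype.card_fin]
  rfl

theorem measurableSet_outside_Icc {ι : Type*} [Fintype ι] (a b : ℝ) :
    MeasurableSet {ξ : ι → ℝ | ∃ i, ξ i ∉ Icc a b} := by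
  have : {ξ : ι → ℝ | ∃ i, ξ i ∉ Icc a b} = ⋃ i, {ξ | ξ i ∉ Icc a b} := by ext; simp
  rw [this]
  exact MeasurableSet.iUnion fun i => (measurableSet_Icc.compl).preimage (measurable_pi_apply i)

/-- The limit density puts little mass outside large boxes. -/
theorem tendsto_setLIntegral_cliqueDensity {τ c : ℝ} (h2 : 2 < τ) (h3 : τ < 3) (hc : 0 < c)
    {j : ℕ} (hj : 1 ≤ j) {ε : ℕ → ℝ} (hε : ∀ n, 0 < ε n) (hε0 : Tendsto ε atTop (𝓝 0)) :
    Tendsto (fun n => ∫⁻ ξ in {ξ | ∃ i, ξ i ∉ Icc (ε n) (1 / ε n)}, cliqueDensity τ c ξ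
      ∂(Measure.pi fun _ : CliqueIndex j => scaleMeasure τ)) atTop (𝓝 0) := by
  simp_rw [← lintegral_indicator (measurableSet_outside_Icc _ _)]
  rw [← lintegral_zero (μ := Measure.pi fun _ : CliqueIndex j => scaleMeasure τ)]
  refine tendsto_lintegral_of_dominated_convergence (cliqueDensity τ c)
    (fun n => (measurable_cliqueDensity τ c j).indicator (measurableSet_outside_Icc _ _))
    (fun n => Eventually.of_forall fun ξ => indicator_le_self _ _ _)
    (lintegral_cliqueDensity_lt_top h2 h3 hc hj).ne ?_
  have hpos : ∀ᵐ ξ ∂(Measure.pi fun _ : CliqueIndex j => scaleMeasure τ), ∀ i, 0 < ξ i :=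
    eventually_all.2 fun i => Measure.tendsto_eval_ae_ae.eventually (ae_pos_scaleMeasure τ)
  filter_upwards [hpos] with ξ hξ
  refine tendsto_const_nhds.congr' ?_
  have hinv : Tendsto (fun n => 1 / ε n) atTop atTop := by
    simp_rw [one_div]
    exact tendsto_inv_nhdsGT_zero.comp (tendsto_nhdsWithin_iff.2
      ⟨hε0, Eventually.of_forall hε⟩)
  have : ∀ᶠ n in atTop, ∀ i, ε n ≤ ξ i ∧ ξ i ≤ 1 / ε n :=
    eventually_all.2 fun i => (hε0.eventually_le_const (hξ i)).and (hinv.eventually_ge_atTop _)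
  filter_upwards [this] with n hn
  exact (indicator_of_notMem (fun h => h.elim fun i hi => hi (hn i)) _).symm

/-! ### Independent uniform labels -/

/-- The law of i.i.d. uniform labels indexed by `E`. -/
noncomputable abbrev labelLaw (E : Type*) [Fintype E] : Measure (E → unitInterval) :=
  Measure.pi fun _ : E => (volume : Measure unitInterval)

theorem measurableSet_labels_le {E : Type*} [Fintype E] (F : Finset E) (t : E → ℝ) :
    MeasurableSet {U : E → unitInterval | ∀ e ∈ F, (U e : ℝ) ≤ t e} := by
  have : {U : E → unitInterval | ∀ e ∈ F, (U e : ℝ) ≤ t e} =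
      ⋂ e ∈ F, {U : E → unitInterval | (U e : ℝ) ≤ t e} := by ext; simp
  rw [this]
  exact Finset.measurableSet_biInter _ fun e _ => measurableSet_le (by fun_prop) measurable_const

theorem labelLaw_real_le {E : Type*} [Fintype E] (F : Finset E) {t : E → ℝ}
    (ht : ∀ e, t e ∈ Icc (0 : ℝ) 1) :
    (labelLaw E).real {U | ∀ e ∈ F, (U e : ℝ) ≤ t e} = ∏ e ∈ F, t e := by
  have : {U : E → unitInterval | ∀ e ∈ F, (U e : ℝ) ≤ t e} =
      Set.pi (F : Set E) fun e => Iic (⟨t e, ht e⟩ : unitInterval) := by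
    ext U
    simp only [Set.mem_pi, SetLike.mem_coe, mem_Iic]
    rfl
  rw [this, Measure.real, Measure.pi_pi_finset, ENNReal.toReal_prod]
  exact Finset.prod_congr rfl fun e _ => by
    simp [unitInterval.volume_Iic, ENNReal.toReal_ofReal (ht e).1]

theorem measurableSet_labels_not_le {E κ : Type*} [Fintype E] (Z : Finset κ)
    (star : κ → Finset E) (t : E → ℝ) :
    MeasurableSet {U : E → unitInterval | ∀ z ∈ Z, ¬ ∀ e ∈ star z, (U e : ℝ) ≤ t e} := by
  have : {U : E → unitInterval | ∀ z ∈ Z, ¬ ∀ e ∈ star z, (U e : ℝ) ≤ t e} =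
      ⋂ z ∈ Z, {U : E → unitInterval | ∀ e ∈ star z, (U e : ℝ) ≤ t e}ᶜ := by ext; simp
  rw [this]
  exact Finset.measurableSet_biInter _ fun z _ => (measurableSet_labels_le (star z) t).compl

/-- The labels of `F` are all small, and none of the disjoint families `star z` consists of small
labels only: the probability factorizes. -/
theorem labelLaw_real_le_and_not {E κ : Type*} [Fintype E] [DecidableEq E] [DecidableEq κ]
    (Z : Finset κ) (star : κ → Finset E) {t : E → ℝ} (ht : ∀ e, t e ∈ Icc (0 : ℝ) 1)
    (hstar : ∀ z ∈ Z, ∀ z' ∈ Z, z ≠ z' → Disjoint (star z) (star z')) (F : Finset E)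
    (hF : ∀ z ∈ Z, Disjoint F (star z)) :
    (labelLaw E).real ({U | ∀ e ∈ F, (U e : ℝ) ≤ t e} ∩
        {U | ∀ z ∈ Z, ¬ ∀ e ∈ star z, (U e : ℝ) ≤ t e}) =
      (∏ e ∈ F, t e) * ∏ z ∈ Z, (1 - ∏ e ∈ star z, t e) := by
  induction Z using Finset.induction_on generalizing F with
  | empty => simpa using labelLaw_real_le F ht
  | insert z Z hz ih =>
    have hstar' : ∀ z ∈ Z, ∀ z' ∈ Z, z ≠ z' → Disjoint (star z) (star z') := fun a ha b hb =>
      hstar a (Finset.mem_insert_of_mem ha) b (Finset.mem_insert_of_mem hb)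
    have hF' : ∀ z ∈ Z, Disjoint F (star z) := fun a ha => hF a (Finset.mem_insert_of_mem ha)
    have hFz : ∀ y ∈ Z, Disjoint (F ∪ star z) (star y) := fun y hy =>
      Finset.disjoint_union_left.2 ⟨hF' y hy, hstar z (Finset.mem_insert_self _ _) y
        (Finset.mem_insert_of_mem hy) fun h => hz (h ▸ hy)⟩
    have hset : ({U : E → unitInterval | ∀ e ∈ F, (U e : ℝ) ≤ t e} ∩
        {U | ∀ y ∈ insert z Z, ¬ ∀ e ∈ star y, (U e : ℝ) ≤ t e}) =
        ({U | ∀ e ∈ F, (U e : ℝ) ≤ t e} ∩ {U | ∀ y ∈ Z, ¬ ∀ e ∈ star y, (U e : ℝ) ≤ t e}) \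
        ({U | ∀ e ∈ F ∪ star z, (U e : ℝ) ≤ t e} ∩
          {U | ∀ y ∈ Z, ¬ ∀ e ∈ star y, (U e : ℝ) ≤ t e}) := by
      ext U
      rw [Set.mem_sdiff]
      simp only [mem_inter_iff, mem_ofPred_eq, Finset.forall_mem_insert, Finset.forall_mem_union]
      tauto
    have hsub : ({U : E → unitInterval | ∀ e ∈ F ∪ star z, (U e : ℝ) ≤ t e} ∩
          {U | ∀ y ∈ Z, ¬ ∀ e ∈ star y, (U e : ℝ) ≤ t e}) ⊆
        ({U | ∀ e ∈ F, (U e : ℝ) ≤ t e} ∩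
          {U | ∀ y ∈ Z, ¬ ∀ e ∈ star y, (U e : ℝ) ≤ t e}) :=
      inter_subset_inter_left _ fun U hU e he => hU e (Finset.mem_union_left _ he)
    rw [hset, measureReal_sdiff hsub ((measurableSet_labels_le _ _).inter
      (measurableSet_labels_not_le _ _ _)), ih hstar' F hF', ih hstar' _ hFz,
      Finset.prod_union (hF z (Finset.mem_insert_self _ _)), Finset.prod_insert hz]
    ring

/-! ### The probability that given vertices form a maximal clique -/

/-- The connection probability as a function of unordered pairs of indices. -/
noncomputable def edgeProb (μ : ℝ) (n : ℕ) {V : Type*} (x : V → ℝ) : Sym2 V → ℝ :=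
  Sym2.lift ⟨fun u v => connProb μ n (x u) (x v), fun _ _ => connProb_comm _ _ _ _⟩

@[simp]
theorem edgeProb_mk (μ : ℝ) (n : ℕ) {V : Type*} (x : V → ℝ) (u v : V) :
    edgeProb μ n x s(u, v) = connProb μ n (x u) (x v) := rfl

theorem edgeProb_map (μ : ℝ) (n : ℕ) {V V' : Type*} (x : V → ℝ) (f : V' → V) (e : Sym2 V') :
    edgeProb μ n x (e.map f) = edgeProb μ n (x ∘ f) e := by
  induction e with | _ u v => rfl

@[fun_prop]
theorem measurable_connProb {α : Type*} [MeasurableSpace α] (μ : ℝ) (n : ℕ) {g h : α → ℝ}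
    (hg : Measurable g) (hh : Measurable h) : Measurable fun a => connProb μ n (g a) (h a) := by
  unfold connProb; fun_prop

theorem measurable_edgeProb (μ : ℝ) (n : ℕ) {V : Type*} (e : Sym2 V) :
    Measurable fun x : V → ℝ => edgeProb μ n x e := by
  induction e with
  | _ u v =>
    exact measurable_connProb μ n (measurable_pi_apply u) (measurable_pi_apply v)

theorem connProb_mem_Icc {μ : ℝ} (hμ : 0 < μ) (n : ℕ) {x y : ℝ} (hx : 0 ≤ x) (hy : 0 ≤ y) :
    connProb μ n x y ∈ Icc (0 : ℝ) 1 :=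
  ⟨le_min (by positivity) zero_le_one, min_le_right _ _⟩

theorem edgeProb_mem_Icc {μ : ℝ} (hμ : 0 < μ) (n : ℕ) {V : Type*} {x : V → ℝ}
    (hx : ∀ v, 0 ≤ x v) (e : Sym2 V) : edgeProb μ n x e ∈ Icc (0 : ℝ) 1 := by
  induction e with | _ u v => exact connProb_mem_Icc hμ n (hx u) (hx v)

/-- The pairs of `F` are edges between the vertices `f i`, and no further vertex is adjacent to all
the `f i`. -/
def unextendable (μ : ℝ) {n : ℕ} {ι : Type*} (f : ι → Fin n) (F : Finset (Sym2 ι)) :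
    Set (Sample n) :=
  {ω | (∀ e ∈ F, (ω.2 (e.map f) : ℝ) ≤ edgeProb μ n ω.1 (e.map f)) ∧
    ∀ z, z ∉ range f → ¬ ∀ i, (ω.2 s(f i, z) : ℝ) ≤ connProb μ n (ω.1 (f i)) (ω.1 z)}

theorem measurableSet_label_le_edgeProb (μ : ℝ) {n : ℕ} (e : Sym2 (Fin n)) :
    MeasurableSet {ω : Sample n | (ω.2 e : ℝ) ≤ edgeProb μ n ω.1 e} :=
  measurableSet_le (by fun_prop) ((measurable_edgeProb μ n e).comp measurable_fst)

theorem measurableSet_unextendable (μ : ℝ) {n : ℕ} {ι : Type*} [Finite ι] (f : ι → Fin n)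
    (F : Finset (Sym2 ι)) : MeasurableSet (unextendable μ f F) := by
  have : unextendable μ f F =
      (⋂ e ∈ F, {ω : Sample n | (ω.2 (e.map f) : ℝ) ≤ edgeProb μ n ω.1 (e.map f)}) ∩
      ⋂ z ∈ (range f)ᶜ, (⋂ i, {ω : Sample n | (ω.2 s(f i, z) : ℝ) ≤
        edgeProb μ n ω.1 s(f i, z)})ᶜ := by
    ext ω; simp [unextendable]
  rw [this]
  exact (Finset.measurableSet_biInter _ fun e _ => measurableSet_label_le_edgeProb μ _).inter
    (MeasurableSet.biInter (Set.toFinite _).countable fun z _ =>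
      (MeasurableSet.iInter fun i => measurableSet_label_le_edgeProb μ _).compl)

/-- The probability that a further vertex is not adjacent to all of a set of vertices of weights
`x i`. -/
noncomputable def avoidProb (τ μ : ℝ) (n : ℕ) {ι : Type*} [Fintype ι] (x : ι → ℝ) : ℝ≥0∞ :=
  ∫⁻ y, ENNReal.ofReal (1 - ∏ i, connProb μ n (x i) y) ∂(weightLaw τ)

/-- Given the weights, the probability of `unextendable`. -/
theorem labelLaw_unextendable {μ : ℝ} (hμ : 0 < μ) {n : ℕ} {ι : Type*} [Fintype ι]
    {f : ι → Fin n} (hf : Function.Injective f) (F : Finset (Sym2 ι)) {w : Fin n → ℝ}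
    (hw : ∀ v, 0 ≤ w v) :
    labelLaw (Sym2 (Fin n)) (Prod.mk w ⁻¹' unextendable μ f F) =
      ENNReal.ofReal (∏ e ∈ F, edgeProb μ n (w ∘ f) e) *
        ∏ z : ((range f)ᶜ : Set (Fin n)),
          ENNReal.ofReal (1 - ∏ i, connProb μ n (w (f i)) (w z)) := by
  classical
  have ht := fun e => edgeProb_mem_Icc hμ n hw e
  have hinj : ∀ z : Fin n, Function.Injective fun i => s(f i, z) := fun z i i' h => by
    rcases Sym2.eq_iff.1 h with h | h
    · exact hf h.1
    · exact hf (h.1.trans h.2)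
  have key := labelLaw_real_le_and_not (E := Sym2 (Fin n)) ((range f)ᶜ : Set (Fin n)).toFinset
    (fun z => Finset.univ.image fun i => s(f i, z)) ht ?_ (F.image (Sym2.map f)) ?_
  · rw [← ENNReal.ofReal_toReal (measure_ne_top (labelLaw (Sym2 (Fin n))) _), ← Measure.real]
    have hset : Prod.mk w ⁻¹' unextendable μ f F =
        {U | ∀ e ∈ F.image (Sym2.map f), (U e : ℝ) ≤ edgeProb μ n w e} ∩
        {U | ∀ z ∈ ((range f)ᶜ : Set (Fin n)).toFinset,
          ¬ ∀ e ∈ Finset.univ.image fun i => s(f i, z), (U e : ℝ) ≤ edgeProb μ n w e} := by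
      ext U; simp [unextendable]
    have h01 : ∀ z, 0 ≤ 1 - ∏ i, connProb μ n (w (f i)) (w z) := fun z =>
      sub_nonneg.2 (Finset.prod_le_one (fun i _ => (connProb_mem_Icc hμ n (hw _) (hw _)).1)
        fun i _ => (connProb_mem_Icc hμ n (hw _) (hw _)).2)
    rw [hset, key, Finset.prod_image (Sym2.map.injective hf).injOn,
      ENNReal.ofReal_mul (Finset.prod_nonneg fun e _ => (ht _).1)]
    congr 1
    · simp_rw [edgeProb_map]
    · rw [← ENNReal.ofReal_prod_of_nonneg fun (z : ((range f)ᶜ : Set (Fin n))) _ => h01 z]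
      congr 1
      rw [← Finset.prod_subtype ((range f)ᶜ : Set (Fin n)).toFinset (fun z => by simp)
        (f := fun z => 1 - ∏ i, connProb μ n (w (f i)) (w z))]
      refine Finset.prod_congr rfl fun z _ => ?_
      rw [Finset.prod_image (hinj z).injOn]
      rfl
  · intro z hz z' hz' hne
    simp only [mem_toFinset, mem_compl_iff, mem_range, not_exists] at hz hz'
    simp only [Finset.disjoint_left, Finset.mem_image, Finset.mem_univ, true_and, not_exists,
      forall_exists_index]
    rintro _ i rfl i' h
    rcases Sym2.eq_iff.1 h with h | h
    · exact hne h.2.symm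
    · exact hz i' h.1
  · intro z hz
    simp only [mem_toFinset, mem_compl_iff, mem_range, not_exists] at hz
    simp only [Finset.disjoint_left, Finset.mem_image, Finset.mem_univ, true_and, not_exists]
    rintro _ ⟨e, -, rfl⟩ i h
    have : z ∈ e.map f := h ▸ Sym2.mem_mk_right _ _
    obtain ⟨i', -, h'⟩ := Sym2.mem_map.1 this
    exact hz i' h'

/-- Separating the coordinates in the range of an injective map from the others. -/
theorem lintegral_pi_split {n : ℕ} {ι : Type*} [Fintype ι] {f : ι → Fin n}
    (hf : Function.Injective f) (m : Measure ℝ) [SigmaFinite m]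
    (H : (ι → ℝ) → (((range f)ᶜ : Set (Fin n)) → ℝ) → ℝ≥0∞) :
    ∫⁻ w, H (w ∘ f) (fun z => w z) ∂(Measure.pi fun _ : Fin n => m) =
      ∫⁻ p, H p.1 p.2 ∂((Measure.pi fun _ : ι => m).prod
        (Measure.pi fun _ : ((range f)ᶜ : Set (Fin n)) => m)) := by
  classical
  let e : ι ⊕ ((range f)ᶜ : Set (Fin n)) ≃ Fin n :=
    ((Equiv.ofInjective f hf).sumCongr (Equiv.refl _)).trans (Equiv.Set.sumCompl (range f))
  have he1 : ∀ i, e (.inl i) = f i := fun i => rfl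
  have he2 : ∀ z, e (.inr z) = z := fun z => rfl
  rw [← (measurePreserving_piCongrLeft (fun _ : Fin n => m) e).lintegral_comp_emb
    (MeasurableEquiv.measurableEmbedding _),
    ← (measurePreserving_sumPiEquivProdPi_symm
      (fun _ : ι ⊕ ((range f)ᶜ : Set (Fin n)) => m)).lintegral_comp_emb
      (MeasurableEquiv.measurableEmbedding _)]
  have h2 : ∀ p : (ι → ℝ) × (((range f)ᶜ : Set (Fin n)) → ℝ),
      H (MeasurableEquiv.piCongrLeft (fun _ : Fin n => ℝ) e
          ((MeasurableEquiv.sumPiEquivProdPi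
            fun _ : ι ⊕ ((range f)ᶜ : Set (Fin n)) => ℝ).symm p) ∘ f)
        (fun z => MeasurableEquiv.piCongrLeft (fun _ : Fin n => ℝ) e
          ((MeasurableEquiv.sumPiEquivProdPi
            fun _ : ι ⊕ ((range f)ᶜ : Set (Fin n)) => ℝ).symm p) z) = H p.1 p.2 := by
    intro p
    congr 1
    · ext i
      rw [Function.comp_apply, ← he1, MeasurableEquiv.coe_piCongrLeft,
        Equiv.piCongrLeft_apply_apply]
      rfl
    · ext z
      rw [← he2, MeasurableEquiv.coe_piCongrLeft, Equiv.piCongrLeft_apply_apply]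
      rfl
  simp_rw [h2]

/-- Integrating out the coordinates outside the range of an injective map, for an integrand that is
a product over these coordinates. -/
theorem lintegral_pi_prod_compl_range {n : ℕ} {ι : Type*} [Fintype ι] {f : ι → Fin n}
    (hf : Function.Injective f) (m : Measure ℝ) [SigmaFinite m] {g : (ι → ℝ) → ℝ≥0∞}
    (hg : Measurable g)
    {h : (ι → ℝ) → ℝ → ℝ≥0∞} (hh : Measurable fun p : (ι → ℝ) × ℝ => h p.1 p.2) :
    ∫⁻ w, g (w ∘ f) * ∏ z : ((range f)ᶜ : Set (Fin n)), h (w ∘ f) (w z)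
        ∂(Measure.pi fun _ : Fin n => m) =
      ∫⁻ x, g x * (∫⁻ y, h x y ∂m) ^ (n - Fintype.card ι) ∂(Measure.pi fun _ : ι => m) := by
  have hh' : ∀ z : ((range f)ᶜ : Set (Fin n)),
      Measurable fun p : (ι → ℝ) × (((range f)ᶜ : Set (Fin n)) → ℝ) => h p.1 (p.2 z) := fun z => by
    have : Measurable fun p : (ι → ℝ) × (((range f)ᶜ : Set (Fin n)) → ℝ) => (p.1, p.2 z) := by
      fun_prop
    exact hh.comp this
  have hm : Measurable fun p : (ι → ℝ) × (((range f)ᶜ : Set (Fin n)) → ℝ) =>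
      g p.1 * ∏ z, h p.1 (p.2 z) :=
    (hg.comp measurable_fst).mul (Finset.measurable_prod _ fun z _ => hh' z)
  rw [lintegral_pi_split hf m fun x y => g x * ∏ z, h x (y z), lintegral_prod _ hm.aemeasurable]
  refine lintegral_congr fun x => ?_
  dsimp only
  have hx : Measurable (h x) := hh.comp measurable_prodMk_left
  have hx' : ∀ z : ((range f)ᶜ : Set (Fin n)),
      Measurable fun y : ((range f)ᶜ : Set (Fin n)) → ℝ => h x (y z) := fun z =>
    hx.comp (measurable_pi_apply z)
  rw [lintegral_const_mul _ (Finset.measurable_prod _ fun z _ => hx' z),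
    lintegral_fintype_prod (f := fun _ y => h x y) (fun _ => hx), Finset.prod_const,
    Finset.card_univ, Fintype.card_compl_set, Fintype.card_fin, ← Set.toFinset_card (range f),
    Set.toFinset_range, Finset.card_image_of_injective _ hf, Finset.card_univ]

/-- Integrating over the weights of the vertices outside `range f` first gives a formula for the
probability that given vertices form a maximal clique. -/
theorem sampleLaw_unextendable {τ μ : ℝ} (hτ : 2 < τ) (hμ : 0 < μ) {n : ℕ} {ι : Type*}
    [Fintype ι] {f : ι → Fin n} (hf : Function.Injective f) (F : Finset (Sym2 ι))
    {D : Set (ι → ℝ)} (hD : MeasurableSet D) :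
    sampleLaw τ n ({ω | ω.1 ∘ f ∈ D} ∩ unextendable μ f F) =
      ∫⁻ x in D, ENNReal.ofReal (∏ e ∈ F, edgeProb μ n x e) *
        avoidProb τ μ n x ^ (n - Fintype.card ι) ∂(Measure.pi fun _ : ι => weightLaw τ) := by
  have := isProbabilityMeasure_weightLaw hτ
  have hfm : Measurable fun ω : Sample n => ω.1 ∘ f := by
    rw [measurable_pi_iff]
    exact fun i => (measurable_pi_apply (f i)).comp measurable_fst
  have hFm : Measurable fun x : ι → ℝ => ENNReal.ofReal (∏ e ∈ F, edgeProb μ n x e) :=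
    (Finset.measurable_prod _ fun e _ => measurable_edgeProb μ n e).ennreal_ofReal
  have hzm : Measurable fun p : (ι → ℝ) × ℝ =>
      ENNReal.ofReal (1 - ∏ i, connProb μ n (p.1 i) p.2) := by fun_prop
  have hmeas : MeasurableSet ({ω : Sample n | ω.1 ∘ f ∈ D} ∩ unextendable μ f F) :=
    (hfm hD).inter (measurableSet_unextendable μ f F)
  have h1 : sampleLaw τ n ({ω | ω.1 ∘ f ∈ D} ∩ unextendable μ f F) =
      ∫⁻ w, D.indicator (fun x => ENNReal.ofReal (∏ e ∈ F, edgeProb μ n x e)) (w ∘ f) *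
        ∏ z : ((range f)ᶜ : Set (Fin n)),
          ENNReal.ofReal (1 - ∏ i, connProb μ n ((w ∘ f) i) (w z))
        ∂(Measure.pi fun _ : Fin n => weightLaw τ) := by
    rw [sampleLaw, Measure.prod_apply hmeas]
    have hae : ∀ᵐ w ∂(Measure.pi fun _ : Fin n => weightLaw τ), ∀ v, 1 ≤ w v :=
      eventually_all.2 fun i => Measure.tendsto_eval_ae_ae.eventually (ae_one_le_weightLaw τ)
    refine lintegral_congr_ae ?_
    filter_upwards [hae] with w hw
    by_cases hwD : w ∘ f ∈ D
    · have : Prod.mk w ⁻¹' ({ω | ω.1 ∘ f ∈ D} ∩ unextendable μ f F) =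
          Prod.mk w ⁻¹' unextendable μ f F := by
        ext U; simp [hwD]
      rw [this, labelLaw_unextendable hμ hf F fun v => zero_le_one.trans (hw v),
        indicator_of_mem hwD]
      rfl
    · have : Prod.mk w ⁻¹' ({ω | ω.1 ∘ f ∈ D} ∩ unextendable μ f F) = ∅ := by
        ext U; simp [hwD]
      rw [this, indicator_of_notMem hwD, zero_mul, measure_empty]
  rw [h1, lintegral_pi_prod_compl_range hf (weightLaw τ) (hFm.indicator hD)
      (h := fun x y => ENNReal.ofReal (1 - ∏ i, connProb μ n (x i) y)) hzm,
    ← lintegral_indicator hD]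
  refine lintegral_congr fun x => ?_
  by_cases hx : x ∈ D <;> simp [hx, avoidProb]

/-! ### The two weight scales -/

/-- The order of magnitude of the weights of the two lowest vertices of a typical clique. -/
noncomputable def lowScale (τ μ : ℝ) (n : ℕ) : ℝ := (μ * n) ^ ((τ - 2) / (τ - 1))

/-- The order of magnitude of the weights of the other vertices of a typical clique; also that of
the largest weight of the graph. -/
noncomputable def highScale (τ μ : ℝ) (n : ℕ) : ℝ := (μ * n) ^ (1 / (τ - 1))

/-- The scales of the weights of a typical clique. -/
noncomputable def cliqueScale (τ μ : ℝ) (n j : ℕ) : CliqueIndex j → ℝ :=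
  Sum.elim (fun _ => lowScale τ μ n) (fun _ => highScale τ μ n)

section Scales

variable {τ μ : ℝ} {n : ℕ}

theorem lowScale_pos (hN : 0 < μ * n) : 0 < lowScale τ μ n := Real.rpow_pos_of_pos hN _

theorem highScale_pos (hN : 0 < μ * n) : 0 < highScale τ μ n := Real.rpow_pos_of_pos hN _

theorem cliqueScale_pos (hN : 0 < μ * n) {j : ℕ} (i : CliqueIndex j) :
    0 < cliqueScale τ μ n j i := by
  rcases i with i | l
  · exact lowScale_pos hN
  · exact highScale_pos hN

theorem lowScale_mul_highScale (hτ : 2 < τ) (hN : 0 < μ * n) :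
    lowScale τ μ n * highScale τ μ n = μ * n := by
  have : τ - 1 ≠ 0 := by linarith
  rw [lowScale, highScale, ← Real.rpow_add hN]
  nth_rewrite 2 [← Real.rpow_one (μ * n)]
  congr 1
  field_simp
  ring

theorem highScale_rpow (hτ : 2 < τ) (hN : 0 < μ * n) :
    highScale τ μ n ^ (1 - τ) = (μ * n)⁻¹ := by
  have : τ - 1 ≠ 0 := by linarith
  rw [highScale, ← Real.rpow_mul hN.le, ← Real.rpow_neg_one]
  congr 1
  field_simp
  ring

theorem lowScale_rpow (hτ : 2 < τ) (hN : 0 < μ * n) :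
    lowScale τ μ n ^ (1 - τ) = (μ * n) ^ (2 - τ) := by
  have : τ - 1 ≠ 0 := by linarith
  rw [lowScale, ← Real.rpow_mul hN.le]
  congr 1
  field_simp
  ring

theorem lowScale_rpow' (hτ : 2 < τ) (hN : 0 < μ * n) :
    lowScale τ μ n ^ (τ - 1) = (μ * n) ^ (τ - 2) := by
  have : τ - 1 ≠ 0 := by linarith
  rw [lowScale, ← Real.rpow_mul hN.le]
  congr 1
  field_simp

/-- The exponent of the number of typical cliques, from the number of `j + 2` tuples, the
probabilities of the weights, and the probability of the edge between the two lowest vertices. -/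
theorem scales_mul_eq (hτ : 2 < τ) (hμ : 0 < μ) (hn : 0 < n) (j : ℕ) :
    (n : ℝ) ^ (j + 2) * ((lowScale τ μ n ^ (1 - τ)) ^ 2 * (highScale τ μ n ^ (1 - τ)) ^ j *
      (lowScale τ μ n ^ 2 / (μ * n))) =
    μ ^ ((3 - τ) * (2 * τ - 3) / (τ - 1) - (j + 2 : ℝ)) *
      (n : ℝ) ^ ((3 - τ) * (2 * τ - 3) / (τ - 1)) := by
  have hn' : (0 : ℝ) < n := Nat.cast_pos.2 hn
  have hN : 0 < μ * n := by positivity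
  have hτ1 : τ - 1 ≠ 0 := by linarith
  have h2 : lowScale τ μ n ^ 2 = (μ * n) ^ (2 * ((τ - 2) / (τ - 1))) := by
    rw [lowScale, ← Real.rpow_natCast, ← Real.rpow_mul hN.le, mul_comm (2 : ℝ)]; rfl
  have h3 : ((μ * n) ^ (2 - τ)) ^ 2 = (μ * n) ^ (2 * (2 - τ)) := by
    rw [← Real.rpow_natCast, ← Real.rpow_mul hN.le, mul_comm (2 : ℝ)]; rfl
  have hE : (3 - τ) * (2 * τ - 3) / (τ - 1) = 2 * (2 - τ) + 2 * ((τ - 2) / (τ - 1)) + 1 := by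
    field_simp; ring
  rw [highScale_rpow hτ hN, lowScale_rpow hτ hN, h2, h3, Real.rpow_sub hμ, div_mul_eq_mul_div,
    ← Real.mul_rpow hμ.le hn'.le, hE, Real.rpow_add hN, Real.rpow_add hN, Real.rpow_one,
    show (j : ℝ) + 2 = ((j + 2 : ℕ) : ℝ) by push_cast; ring, Real.rpow_natCast]
  rw [inv_pow, mul_pow, pow_add, pow_add]
  field_simp

end Scales

/-- Passing from the weights to the rescaled weights. -/
theorem lintegral_pi_weightLaw_rescale {τ : ℝ} (hτ : 2 < τ) {ι : Type*} [Fintype ι] {s : ι → ℝ}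
    (hs : ∀ i, 0 < s i) {G : (ι → ℝ) → ℝ≥0∞} (hG : Measurable G) :
    ∫⁻ x, G (fun i => x i / s i) ∂(Measure.pi fun _ : ι => weightLaw τ) ≤
      (∏ i, ENNReal.ofReal (s i ^ (1 - τ))) *
        ∫⁻ ξ, G ξ ∂(Measure.pi fun _ : ι => scaleMeasure τ) := by
  have := isProbabilityMeasure_weightLaw hτ
  have hmap : ∀ i, (scaleMeasure τ).map (fun x => x / s i) =
      ENNReal.ofReal (s i ^ (1 - τ)) • scaleMeasure τ := fun i => by
    have h := map_mul_scaleMeasure (τ := τ) (inv_pos.2 (hs i))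
    rw [Real.inv_rpow (hs i).le, ← Real.rpow_neg (hs i).le, neg_sub] at h
    rw [← h]
    congr 1
    ext x
    rw [div_eq_inv_mul]
  have hσ : ∀ i, SigmaFinite ((scaleMeasure τ).map (fun x => x / s i)) := fun i => by
    rw [hmap]
    exact inferInstanceAs (SigmaFinite ((s i ^ (1 - τ)).toNNReal • scaleMeasure τ))
  have hfm : Measurable fun (x : ι → ℝ) i => x i / s i := by fun_prop
  calc _ ≤ ∫⁻ x, G (fun i => x i / s i) ∂(Measure.pi fun _ : ι => scaleMeasure τ) :=
        lintegral_mono' (pi_mono_of_le fun _ => weightLaw_le τ) le_rfl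
    _ = ∫⁻ ξ, G ξ ∂((Measure.pi fun _ : ι => scaleMeasure τ).map fun x i => x i / s i) :=
        (lintegral_map hG hfm).symm
    _ = _ := by
        rw [Measure.pi_map_pi (f := fun i x => x / s i) (fun i => by fun_prop)]
        simp_rw [hmap]
        rw [pi_smul_measure _ fun _ => ENNReal.ofReal_ne_top, lintegral_smul_measure, smul_eq_mul]

/-! ### The first moment of the number of atypical maximal cliques -/

/-- The pairs of clique vertices of which at least one is one of the two lowest vertices. -/
def lowPairs (j : ℕ) : Finset (Sym2 (CliqueIndex j)) :=
  insert s(.inl 0, .inl 1)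
    ((Finset.univ : Finset (Fin 2 × Fin j)).image fun p => s(.inl p.1, .inr p.2))

theorem not_isDiag_of_mem_lowPairs {j : ℕ} {e : Sym2 (CliqueIndex j)} (he : e ∈ lowPairs j) :
    ¬ e.IsDiag := by
  simp only [lowPairs, Finset.mem_insert, Finset.mem_image, Finset.mem_univ, true_and] at he
  rcases he with rfl | ⟨p, rfl⟩ <;> simp

theorem prod_lowPairs {j : ℕ} (g : Sym2 (CliqueIndex j) → ℝ) :
    ∏ e ∈ lowPairs j, g e = g s(.inl 0, .inl 1) *
      ∏ l : Fin j, g s(.inl 0, .inr l) * g s(.inl 1, .inr l) := by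
  rw [lowPairs, Finset.prod_insert, Finset.prod_image]
  · rw [← Finset.univ_product_univ, Finset.prod_product_right]
    simp
  · rintro ⟨i, l⟩ - ⟨i', l'⟩ - h
    simpa using h
  · simp

/-- If the vertices are ordered with the two lowest first, the others are at least as heavy as the
second one, and a vertex `y ≥ μ n / x 1` is certainly adjacent to all of them but the first. -/
theorem avoidProb_le {τ μ : ℝ} (hτ : 2 < τ) {n : ℕ} (hN : 0 < μ * n) {j : ℕ}
    {x : CliqueIndex j → ℝ} (h0 : 0 < x (.inl 0)) (h01 : x (.inl 0) ≤ x (.inl 1))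
    (h1 : ∀ l, x (.inl 1) ≤ x (.inr l)) (hx1 : x (.inl 1) ≤ μ * n) :
    avoidProb τ μ n x ≤ ENNReal.ofReal
      (Real.exp (-(x (.inl 0) / x (.inl 1) * (μ * n / x (.inl 1)) ^ (1 - τ)))) := by
  have := isProbabilityMeasure_weightLaw hτ
  have hx10 : 0 < x (.inl 1) := h0.trans_le h01
  set t := μ * n / x (.inl 1) with ht
  set q := x (.inl 0) / x (.inl 1) with hq
  have ht1 : 1 ≤ t := by rw [ht, le_div_iff₀ hx10]; linarith
  have hq0 : 0 ≤ q := by positivity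
  have hq1 : q ≤ 1 := by rw [hq, div_le_one hx10]; exact h01
  have hT0 : 0 ≤ t ^ (1 - τ) := by positivity
  have hT1 : t ^ (1 - τ) ≤ 1 := Real.rpow_le_one_of_one_le_of_nonpos ht1 (by linarith)
  have hpt : ∀ y, 1 ≤ y → ENNReal.ofReal (1 - ∏ i, connProb μ n (x i) y) ≤
      (Iio t).indicator (fun _ => 1) y + (Ici t).indicator (fun _ => ENNReal.ofReal (1 - q)) y := by
    intro y hy1
    have hxpos : ∀ i, 0 < x i := by
      rintro (i | l)
      · fin_cases i
        · exact h0
        · exact hx10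
      · exact hx10.trans_le (h1 l)
    have hc0 : ∀ i, 0 ≤ connProb μ n (x i) y := fun i => by
      have := hxpos i
      exact le_min (by positivity) zero_le_one
    rcases lt_or_ge y t with hy | hy
    · rw [indicator_of_mem (show y ∈ Iio t from hy),
        indicator_of_notMem (show y ∉ Ici t from not_le.2 hy), add_zero]
      exact ENNReal.ofReal_le_one.2 (by
        have := Finset.prod_nonneg fun i (_ : i ∈ Finset.univ) => hc0 i
        linarith)
    · rw [indicator_of_notMem (show y ∉ Iio t from not_lt.2 hy),
        indicator_of_mem (show y ∈ Ici t from hy), zero_add]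
      refine ENNReal.ofReal_le_ofReal (sub_le_sub_left ?_ 1)
      have hge : ∀ i, x (.inl 1) ≤ x i → connProb μ n (x i) y = 1 := fun i hi => by
        refine min_eq_right ?_
        rw [le_div_iff₀ hN, one_mul]
        rw [ht, div_le_iff₀ hx10] at hy
        nlinarith
      have hprod : ∏ i, connProb μ n (x i) y = connProb μ n (x (.inl 0)) y := by
        rw [Fintype.prod_sum_type, Fin.prod_univ_two, hge (.inl 1) le_rfl,
          Finset.prod_eq_one fun l _ => hge (.inr l) (h1 l)]
        ring
      rw [hprod]
      refine le_min ?_ hq1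
      rw [ht, div_le_iff₀ hx10] at hy
      rw [hq, div_le_div_iff₀ hx10 hN]
      nlinarith
  calc avoidProb τ μ n x
      ≤ ∫⁻ y, (Iio t).indicator (fun _ => 1) y +
          (Ici t).indicator (fun _ => ENNReal.ofReal (1 - q)) y ∂(weightLaw τ) := by
        refine lintegral_mono_ae ?_
        filter_upwards [ae_one_le_weightLaw τ] with y hy using hpt y hy
    _ = weightLaw τ (Iio t) + ENNReal.ofReal (1 - q) * weightLaw τ (Ici t) := by
        rw [lintegral_add_left (measurable_const.indicator measurableSet_Iio),
          lintegral_indicator measurableSet_Iio, lintegral_indicator measurableSet_Ici]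
        simp
    _ = ENNReal.ofReal (1 - q * t ^ (1 - τ)) := by
        rw [← compl_Ici, prob_compl_eq_one_sub measurableSet_Ici,
          weightLaw_Ici (by linarith) ht1, ← ENNReal.ofReal_one, ← ENNReal.ofReal_sub _ hT0,
          ← ENNReal.ofReal_mul (by linarith), ← ENNReal.ofReal_add (by linarith)
            (mul_nonneg (by linarith) hT0)]
        congr 1
        ring
    _ ≤ _ := ENNReal.ofReal_le_ofReal (by
        have := Real.add_one_le_exp (-(q * t ^ (1 - τ)))
        linarith)

/-- The weight vectors of cliques, ordered with the two lowest vertices first, whose weights are not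
all within a factor `ε` of the typical scales. The condition that the second weight is at most
`μ n` fails with vanishing probability for the graph. -/
def orderedOutside (τ μ : ℝ) (n : ℕ) (ε : ℝ) (j : ℕ) : Set (CliqueIndex j → ℝ) :=
  {x | x (.inl 0) ≤ x (.inl 1) ∧ (∀ l, x (.inl 1) ≤ x (.inr l)) ∧ x (.inl 1) ≤ μ * n ∧
    ∃ i, x i / cliqueScale τ μ n j i ∉ Icc ε (1 / ε)}

theorem measurableSet_orderedOutside (τ μ : ℝ) (n : ℕ) (ε : ℝ) (j : ℕ) :
    MeasurableSet (orderedOutside τ μ n ε j) := by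
  have : orderedOutside τ μ n ε j = {x | x (.inl 0) ≤ x (.inl 1)} ∩
      ((⋂ l, {x | x (.inl 1) ≤ x (.inr l)}) ∩ ({x | x (.inl 1) ≤ μ * n} ∩
      (fun x i => x i / cliqueScale τ μ n j i) ⁻¹' {ξ | ∃ i, ξ i ∉ Icc ε (1 / ε)})) := by
    ext x; simp [orderedOutside]
  rw [this]
  refine (measurableSet_le (by fun_prop) (by fun_prop)).inter
    ((MeasurableSet.iInter fun l => measurableSet_le (by fun_prop) (by fun_prop)).inter
    ((measurableSet_le (by fun_prop) measurable_const).inter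
      (measurableSet_outside_Icc ε (1 / ε) |>.preimage (by fun_prop))))

/-- On ordered weight vectors, the probability of a maximal clique is bounded by the limit density
of the rescaled weights. -/
theorem edges_mul_avoidProb_le {τ μ : ℝ} (hτ : 2 < τ) (hμ : 0 < μ) {n j : ℕ}
    (hn : 2 * (j + 2) ≤ n) {x : CliqueIndex j → ℝ} (h0 : 0 < x (.inl 0))
    (h01 : x (.inl 0) ≤ x (.inl 1)) (h1 : ∀ l, x (.inl 1) ≤ x (.inr l))
    (hx1 : x (.inl 1) ≤ μ * n) :
    ENNReal.ofReal (∏ e ∈ lowPairs j, edgeProb μ n x e) *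
        avoidProb τ μ n x ^ (n - Fintype.card (CliqueIndex j)) ≤
      ENNReal.ofReal (lowScale τ μ n ^ 2 / (μ * n)) *
        cliqueDensity τ (1 / (2 * μ)) fun i => x i / cliqueScale τ μ n j i := by
  have hn0 : (0 : ℝ) < n := by
    have : 0 < n := by omega
    exact_mod_cast this
  have hN : 0 < μ * n := by positivity
  have hL := lowScale_pos (τ := τ) hN
  have hH := highScale_pos (τ := τ) hN
  have hLH := lowScale_mul_highScale hτ hN
  have hx10 : 0 < x (.inl 1) := h0.trans_le h01
  set L := lowScale τ μ n with hLdef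
  set H := highScale τ μ n with hHdef
  set ξ : CliqueIndex j → ℝ := fun i => x i / cliqueScale τ μ n j i with hξ
  have e0 : x (.inl 0) = L * ξ (.inl 0) := (mul_div_cancel₀ _ hL.ne').symm
  have e1 : x (.inl 1) = L * ξ (.inl 1) := (mul_div_cancel₀ _ hL.ne').symm
  have el : ∀ l, x (.inr l) = H * ξ (.inr l) := fun l => (mul_div_cancel₀ _ hH.ne').symm
  have hξ0 : 0 < ξ (.inl 0) := div_pos h0 hL
  have hξ1 : 0 < ξ (.inl 1) := div_pos hx10 hL
  have hξ01 : ξ (.inl 0) ≤ ξ (.inl 1) := div_le_div_of_nonneg_right h01 hL.le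
  have hlow : ∀ i : Fin 2, ∀ l, connProb μ n (x (.inl i)) (x (.inr l)) =
      min (ξ (.inl i) * ξ (.inr l)) 1 := fun i l => by
    have ei : x (.inl i) = L * ξ (.inl i) := (mul_div_cancel₀ _ hL.ne').symm
    rw [connProb, ei, el l, ← hLH]
    congr 1
    field_simp
  -- the exponent of the avoidance probability after rescaling
  have hexp : x (.inl 0) / x (.inl 1) * (μ * n / x (.inl 1)) ^ (1 - τ) =
      ξ (.inl 0) * ξ (.inl 1) ^ (τ - 2) / (μ * n) := by
    have hL1 : L ^ (τ - 1) = (μ * n) ^ (τ - 2) := lowScale_rpow' hτ hN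
    rw [Real.div_rpow hN.le hx10.le, e0, e1, Real.mul_rpow hL.le hξ1.le,
      show (1 : ℝ) - τ = -(τ - 1) by ring, Real.rpow_neg hL.le, Real.rpow_neg hξ1.le, hL1,
      show -(τ - 1) = -(τ - 2) - 1 by ring, Real.rpow_sub_one hN.ne', Real.rpow_neg hN.le,
      show τ - 1 = τ - 2 + 1 by ring, Real.rpow_add_one hξ1.ne']
    have : (μ * n) ^ (τ - 2) ≠ 0 := (Real.rpow_pos_of_pos hN _).ne'
    field_simp
  set lam := ξ (.inl 0) * ξ (.inl 1) ^ (τ - 2) with hlam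
  have hlam0 : 0 ≤ lam := by positivity
  have hav : avoidProb τ μ n x ^ (n - Fintype.card (CliqueIndex j)) ≤
      ENNReal.ofReal (Real.exp (-(1 / (2 * μ) * lam))) := by
    calc _ ≤ ENNReal.ofReal (Real.exp (-(lam / (μ * n)))) ^
          (n - Fintype.card (CliqueIndex j)) := by
          gcongr
          rw [← hexp]
          exact avoidProb_le hτ hN h0 h01 h1 hx1
      _ ≤ _ := by
          rw [← ENNReal.ofReal_pow (Real.exp_pos _).le, ← Real.exp_nat_mul]
          refine ENNReal.ofReal_le_ofReal (Real.exp_le_exp.2 ?_)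
          have hcard : (n : ℝ) / 2 ≤ ((n - Fintype.card (CliqueIndex j) : ℕ) : ℝ) := by
            have hc : Fintype.card (CliqueIndex j) = j + 2 := by simp [add_comm]
            rw [hc, Nat.cast_sub (by omega)]
            have : ((2 * (j + 2) : ℕ) : ℝ) ≤ n := by exact_mod_cast hn
            push_cast at this ⊢
            linarith
          rw [mul_neg, neg_le_neg_iff]
          calc 1 / (2 * μ) * lam = n / 2 * (lam / (μ * n)) := by field_simp
            _ ≤ _ := mul_le_mul_of_nonneg_right hcard (by positivity)
  have hedge : ∏ e ∈ lowPairs j, edgeProb μ n x e ≤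
      (L ^ 2 / (μ * n)) * (ξ (.inl 0) * ξ (.inl 1)) *
      ∏ l : Fin j, min (ξ (.inl 0) * ξ (.inr l)) 1 * min (ξ (.inl 1) * ξ (.inr l)) 1 := by
    rw [prod_lowPairs]
    simp only [edgeProb_mk, hlow]
    refine mul_le_mul_of_nonneg_right ?_ (Finset.prod_nonneg fun l _ => ?_)
    · refine (min_le_left _ _).trans (le_of_eq ?_)
      rw [e0, e1]
      ring
    · have : 0 < ξ (.inr l) := div_pos (hx10.trans_le (h1 l)) hH
      exact mul_nonneg (le_min (by positivity) zero_le_one) (le_min (by positivity) zero_le_one)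
  have hprod0 : ∀ l ∈ (Finset.univ : Finset (Fin j)),
      0 ≤ min (ξ (.inl 0) * ξ (.inr l)) 1 * min (ξ (.inl 1) * ξ (.inr l)) 1 := fun l _ => by
    have : 0 < ξ (.inr l) := div_pos (hx10.trans_le (h1 l)) hH
    exact mul_nonneg (le_min (by positivity) zero_le_one) (le_min (by positivity) zero_le_one)
  rw [cliqueDensity, pairDensity, if_pos hξ01, ← ENNReal.ofReal_prod_of_nonneg hprod0,
    ← ENNReal.ofReal_mul (by positivity), ← ENNReal.ofReal_mul (by positivity)]
  refine (mul_le_mul' (ENNReal.ofReal_le_ofReal hedge) hav).trans (le_of_eq ?_)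
  rw [← ENNReal.ofReal_mul (mul_nonneg (by positivity) (Finset.prod_nonneg hprod0))]
  congr 1
  ring

/-- The probability that given vertices form an atypical maximal clique. -/
theorem sampleLaw_orderedOutside_le {τ μ : ℝ} (hτ : 2 < τ) (hμ : 0 < μ) {n j : ℕ}
    (hn : 2 * (j + 2) ≤ n) (ε : ℝ) {f : CliqueIndex j → Fin n} (hf : Function.Injective f) :
    sampleLaw τ n ({ω | ω.1 ∘ f ∈ orderedOutside τ μ n ε j} ∩ unextendable μ f (lowPairs j)) ≤
      ENNReal.ofReal ((lowScale τ μ n ^ (1 - τ)) ^ 2 * (highScale τ μ n ^ (1 - τ)) ^ j *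
        (lowScale τ μ n ^ 2 / (μ * n))) *
      ∫⁻ ξ in {ξ | ∃ i, ξ i ∉ Icc ε (1 / ε)}, cliqueDensity τ (1 / (2 * μ)) ξ
        ∂(Measure.pi fun _ : CliqueIndex j => scaleMeasure τ) := by
  have := isProbabilityMeasure_weightLaw hτ
  have hn0 : (0 : ℝ) < n := by
    have : 0 < n := by omega
    exact_mod_cast this
  have hN : 0 < μ * n := by positivity
  have hL := lowScale_pos (τ := τ) hN
  have hH := highScale_pos (τ := τ) hN
  set B : Set (CliqueIndex j → ℝ) := {ξ | ∃ i, ξ i ∉ Icc ε (1 / ε)} with hB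
  have hBm : MeasurableSet B := measurableSet_outside_Icc _ _
  have hae : ∀ᵐ x ∂(Measure.pi fun _ : CliqueIndex j => weightLaw τ), ∀ i, 1 ≤ x i :=
    eventually_all.2 fun i => Measure.tendsto_eval_ae_ae.eventually (ae_one_le_weightLaw τ)
  rw [sampleLaw_unextendable hτ hμ hf _ (measurableSet_orderedOutside τ μ n ε j),
    ← lintegral_indicator (measurableSet_orderedOutside τ μ n ε j)]
  calc _ ≤ ∫⁻ x, (fun ξ => ENNReal.ofReal (lowScale τ μ n ^ 2 / (μ * n)) *
          B.indicator (cliqueDensity τ (1 / (2 * μ))) ξ) (fun i => x i / cliqueScale τ μ n j i)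
          ∂(Measure.pi fun _ : CliqueIndex j => weightLaw τ) := by
        refine lintegral_mono_ae ?_
        filter_upwards [hae] with x hx
        by_cases hxD : x ∈ orderedOutside τ μ n ε j
        · rw [indicator_of_mem hxD]
          obtain ⟨h01, h1, hx1, hout⟩ := hxD
          rw [indicator_of_mem (show (fun i => x i / cliqueScale τ μ n j i) ∈ B from hout)]
          exact edges_mul_avoidProb_le hτ hμ hn (zero_lt_one.trans_le (hx _)) h01 h1 hx1
        · rw [indicator_of_notMem hxD]
          exact zero_le
    _ ≤ _ := lintegral_pi_weightLaw_rescale hτ (fun i => cliqueScale_pos hN i)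
        (((measurable_cliqueDensity τ _ j).indicator hBm).const_mul _)
    _ = _ := by
        rw [lintegral_const_mul _ ((measurable_cliqueDensity τ _ j).indicator hBm),
          lintegral_indicator hBm, ← mul_assoc]
        congr 1
        rw [← ENNReal.ofReal_prod_of_nonneg fun i _ =>
          Real.rpow_nonneg (cliqueScale_pos hN i).le _, ← ENNReal.ofReal_mul
            (Finset.prod_nonneg fun i _ => Real.rpow_nonneg (cliqueScale_pos hN i).le _)]
        congr 1
        rw [Fintype.prod_sum_type]
        simp [cliqueScale]

/-! ### Maximal cliques as tuples of vertices -/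

theorem isMaximalClique_iff {V : Type*} [DecidableEq V] {G : SimpleGraph V} {s : Finset V} :
    IsMaximalClique G s ↔
      G.IsClique (s : Set V) ∧ ∀ z, z ∉ s → ¬ ∀ i ∈ s, G.Adj i z := by
  constructor
  · rintro ⟨h1, h2⟩
    refine ⟨h1, fun z hz hadj => hz ?_⟩
    have hcl : G.IsClique (insert z s : Finset V) := by
      rw [Finset.coe_insert]
      exact h1.insert fun b hb _ => (hadj b hb).symm
    exact h2 hcl (Finset.subset_insert z s) (Finset.mem_insert_self z s)
  · rintro ⟨h1, h2⟩
    refine ⟨h1, fun t ht hst z hz => ?_⟩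
    by_contra hzs
    exact h2 z hzs fun i hi => ht (hst hi) hz fun h => hzs (h ▸ hi)

theorem unextendable_of_isMaximalClique {μ : ℝ} {n : ℕ} {ι : Type*} [Fintype ι]
    {f : ι → Fin n} (hf : Function.Injective f) {F : Finset (Sym2 ι)}
    (hF : ∀ e ∈ F, ¬ e.IsDiag) {ω : Sample n}
    (h : IsMaximalClique (graph μ ω) (Finset.univ.image f)) : ω ∈ unextendable μ f F := by
  rw [isMaximalClique_iff] at h
  refine ⟨fun e he => ?_, fun z hz hall => ?_⟩
  · have hd := hF e he
    induction e with
    | _ i i' =>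
      exact (h.1 (by simp) (by simp) fun hi => hd (hf hi)).2
  · refine h.2 z (by simpa using hz) fun v hv => ?_
    obtain ⟨i, -, rfl⟩ := Finset.mem_image.1 hv
    exact ⟨fun hi => hz ⟨i, hi⟩, hall i⟩

open Classical in
/-- All pairs of distinct indices. -/
noncomputable def allPairs (ι : Type*) [Fintype ι] : Finset (Sym2 ι) :=
  Finset.univ.filter fun e => ¬ e.IsDiag

theorem isMaximalClique_of_unextendable {μ : ℝ} {n : ℕ} {ι : Type*} [Fintype ι]
    {f : ι → Fin n} {ω : Sample n}
    (h : ω ∈ unextendable μ f (allPairs ι)) :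
    IsMaximalClique (graph μ ω) (Finset.univ.image f) := by
  rw [isMaximalClique_iff]
  refine ⟨?_, fun z hz hall => ?_⟩
  · intro u hu v hv huv
    simp only [Finset.coe_image, Finset.coe_univ, image_univ, mem_range] at hu hv
    obtain ⟨i, rfl⟩ := hu
    obtain ⟨i', rfl⟩ := hv
    refine ⟨huv, h.1 s(i, i') ?_⟩
    have : i ≠ i' := fun h => huv (h ▸ rfl)
    simpa [allPairs] using this
  · refine h.2 z (by simpa using hz) fun i => ?_
    exact (hall (f i) (Finset.mem_image_of_mem f (Finset.mem_univ i))).2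

/-- A set of `j + 2` vertices can be enumerated with two prescribed vertices first. -/
theorem exists_enumeration {V : Type*} [DecidableEq V] {j : ℕ} {s : Finset V}
    (hs : s.card = j + 2) {u v : V} (hu : u ∈ s) (hv : v ∈ s) (huv : u ≠ v) :
    ∃ f : CliqueIndex j → V, Function.Injective f ∧ Finset.univ.image f = s ∧ f (.inl 0) = u ∧
      f (.inl 1) = v ∧ ∀ l, f (.inr l) ∈ s ∧ f (.inr l) ≠ u ∧ f (.inr l) ≠ v := by
  have hv' : v ∈ s.erase u := Finset.mem_erase.2 ⟨huv.symm, hv⟩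
  have hcard : ((s.erase u).erase v).card = j := by
    rw [Finset.card_erase_of_mem hv', Finset.card_erase_of_mem hu, hs]; omega
  let e := ((s.erase u).erase v).equivFinOfCardEq hcard
  have he : ∀ l, (e.symm l : V) ∈ s ∧ (e.symm l : V) ≠ u ∧ (e.symm l : V) ≠ v := fun l => by
    have h := (e.symm l).2
    simp only [Finset.mem_erase] at h
    exact ⟨h.2.2, h.2.1, h.1⟩
  let f : CliqueIndex j → V := Sum.elim ![u, v] fun l => e.symm l
  have hinj : Function.Injective f := by
    refine Function.Injective.sumElim ?_ (Subtype.val_injective.comp e.symm.injective) ?_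
    · intro a b hab
      fin_cases a <;> fin_cases b <;> simp_all
    · intro a l
      fin_cases a
      · exact (he l).2.1.symm
      · exact (he l).2.2.symm
  refine ⟨f, hinj, ?_, rfl, rfl, he⟩
  refine Finset.eq_of_subset_of_card_le (fun x hx => ?_) ?_
  · obtain ⟨i, -, rfl⟩ := Finset.mem_image.1 hx
    rcases i with i | l
    · fin_cases i
      · exact hu
      · exact hv
    · exact (he l).1
  · rw [Finset.card_image_of_injective _ hinj, hs, Finset.card_univ]
    simp [add_comm]

/-- A set of `j + 2` vertices can be enumerated with the two lowest weights first. -/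
theorem exists_ordered_enumeration {V : Type*} [DecidableEq V] {j : ℕ} {s : Finset V}
    (hs : s.card = j + 2) (w : V → ℝ) :
    ∃ f : CliqueIndex j → V, Function.Injective f ∧ Finset.univ.image f = s ∧
      w (f (.inl 0)) ≤ w (f (.inl 1)) ∧ ∀ l, w (f (.inl 1)) ≤ w (f (.inr l)) := by
  obtain ⟨u, hu, hmin⟩ := s.exists_min_image w (Finset.card_pos.1 (by omega))
  obtain ⟨v, hv, hmin'⟩ := (s.erase u).exists_min_image w
    (Finset.card_pos.1 (by rw [Finset.card_erase_of_mem hu]; omega))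
  obtain ⟨hvu, hvs⟩ := Finset.mem_erase.1 hv
  obtain ⟨f, hf, himg, h0, h1, hl⟩ := exists_enumeration hs hu hvs hvu.symm
  refine ⟨f, hf, himg, ?_, fun l => ?_⟩
  · rw [h0, h1]; exact hmin v hvs
  · rw [h1]; exact hmin' _ (Finset.mem_erase.2 ⟨(hl l).2.1, (hl l).1⟩)

theorem mem_window_iff {ε m x : ℝ} (hm : 0 < m) : x ∈ window ε m ↔ x / m ∈ Icc ε (1 / ε) := by
  rw [window, mem_Icc, mem_Icc, le_div_iff₀ hm, div_le_iff₀ hm]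

theorem isTypical_of_forall_mem {τ μ ε : ℝ} {n j : ℕ} (hN : 0 < μ * n) {w : Fin n → ℝ}
    {f : CliqueIndex j → Fin n} (hf : Function.Injective f)
    (h : ∀ i, w (f i) / cliqueScale τ μ n j i ∈ Icc ε (1 / ε)) :
    IsTypical τ μ ε w (Finset.univ.image f) := by
  refine ⟨f (.inl 0), by simp, f (.inl 1), by simp, fun h => by simpa using hf h,
    (mem_window_iff (lowScale_pos hN)).2 (h (.inl 0)),
    (mem_window_iff (lowScale_pos hN)).2 (h (.inl 1)), fun x hx hx0 hx1 => ?_⟩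
  obtain ⟨i, -, rfl⟩ := Finset.mem_image.1 hx
  rcases i with i | l
  · fin_cases i
    · exact absurd rfl hx0
    · exact absurd rfl hx1
  · exact (mem_window_iff (highScale_pos hN)).2 (h (.inr l))

theorem exists_enumeration_of_isTypical {τ μ ε : ℝ} {n j : ℕ} (hN : 0 < μ * n) {w : Fin n → ℝ}
    {s : Finset (Fin n)} (hs : s.card = j + 2) (h : IsTypical τ μ ε w s) :
    ∃ f : CliqueIndex j → Fin n, Function.Injective f ∧ Finset.univ.image f = s ∧
      ∀ i, w (f i) / cliqueScale τ μ n j i ∈ Icc ε (1 / ε) := by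
  obtain ⟨u, hu, v, hv, huv, hwu, hwv, hw⟩ := h
  obtain ⟨f, hf, himg, h0, h1, hl⟩ := exists_enumeration hs hu hv huv
  refine ⟨f, hf, himg, ?_⟩
  rintro (i | l)
  · fin_cases i
    · exact (mem_window_iff (lowScale_pos hN)).1 (h0 ▸ hwu)
    · exact (mem_window_iff (lowScale_pos hN)).1 (h1 ▸ hwv)
  · exact (mem_window_iff (highScale_pos hN)).1 (hw _ (hl l).1 (hl l).2.1 (hl l).2.2)

/-! ### Counting tuples -/

open Classical in
/-- The injective tuples of vertices with weights in `D` that satisfy `unextendable`. -/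
noncomputable def tuples (μ : ℝ) {n : ℕ} {ι : Type*} [Fintype ι] (F : Finset (Sym2 ι))
    (D : Set (ι → ℝ)) (ω : Sample n) : Finset (ι → Fin n) :=
  Finset.univ.filter fun f => Function.Injective f ∧
    ω ∈ {ω : Sample n | ω.1 ∘ f ∈ D} ∩ unextendable μ f F

theorem measurable_comp_index {n : ℕ} {ι : Type*} (f : ι → Fin n) :
    Measurable fun ω : Sample n => ω.1 ∘ f := by
  rw [measurable_pi_iff]
  exact fun i => (measurable_pi_apply (f i)).comp measurable_fst

theorem lintegral_card_tuples_le {τ μ : ℝ} {n : ℕ} {ι : Type*} [Fintype ι]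
    (F : Finset (Sym2 ι)) {D : Set (ι → ℝ)} (hD : MeasurableSet D) {b : ℝ≥0∞}
    (hb : ∀ f : ι → Fin n, Function.Injective f →
      sampleLaw τ n ({ω | ω.1 ∘ f ∈ D} ∩ unextendable μ f F) ≤ b) :
    ∫⁻ ω, ((tuples μ F D ω).card : ℝ≥0∞) ∂(sampleLaw τ n) ≤ (n : ℝ≥0∞) ^ Fintype.card ι * b := by
  classical
  have hm : ∀ f : ι → Fin n, MeasurableSet ({ω : Sample n | ω.1 ∘ f ∈ D} ∩ unextendable μ f F) :=
    fun f => (measurable_comp_index f hD).inter (measurableSet_unextendable μ f F)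
  have h1 : ∀ ω : Sample n, ((tuples μ F D ω).card : ℝ≥0∞) =
      ∑ f ∈ Finset.univ.filter fun f : ι → Fin n => Function.Injective f,
        ({ω : Sample n | ω.1 ∘ f ∈ D} ∩ unextendable μ f F).indicator (fun _ => 1) ω := by
    intro ω
    rw [tuples, ← Finset.filter_filter, Finset.card_filter]
    push_cast
    exact Finset.sum_congr rfl fun f _ => by simp only [indicator_apply]
  simp_rw [h1]
  rw [lintegral_finsetSum _ fun f _ => measurable_const.indicator (hm f)]
  simp_rw [lintegral_indicator_const (hm _), one_mul]
  calc _ ≤ ∑ f ∈ Finset.univ.filter fun f : ι → Fin n => Function.Injective f, b :=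
        Finset.sum_le_sum fun f hf => hb f (Finset.mem_filter.1 hf).2
    _ ≤ ∑ f : ι → Fin n, b := Finset.sum_le_sum_of_subset (Finset.filter_subset _ _)
    _ = _ := by simp

theorem aemeasurable_card_tuples {τ μ : ℝ} {n : ℕ} {ι : Type*} [Fintype ι]
    (F : Finset (Sym2 ι)) {D : Set (ι → ℝ)} (hD : MeasurableSet D) :
    AEMeasurable (fun ω => ((tuples μ F D ω).card : ℝ≥0∞)) (sampleLaw τ n) := by
  classical
  have h1 : (fun ω : Sample n => ((tuples μ F D ω).card : ℝ≥0∞)) = fun ω =>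
      ∑ f ∈ Finset.univ.filter fun f : ι → Fin n => Function.Injective f,
        ({ω : Sample n | ω.1 ∘ f ∈ D} ∩ unextendable μ f F).indicator (fun _ => 1) ω := by
    ext ω
    rw [tuples, ← Finset.filter_filter, Finset.card_filter]
    push_cast
    exact Finset.sum_congr rfl fun f _ => by simp only [indicator_apply]
  rw [h1]
  exact (Finset.measurable_sum _ fun f _ => measurable_const.indicator
    ((measurable_comp_index f hD).inter (measurableSet_unextendable μ f F))).aemeasurable

/-- Every maximal clique is typical or comes from an ordered tuple of atypical weights. -/
theorem numMaxCliques_le {τ μ ε : ℝ} {n j : ℕ} (hN : 0 < μ * n) {ω : Sample n}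
    (hw : ∀ v, ω.1 v ≤ μ * n) :
    numMaxCliques μ (j + 2) ω ≤ numTypicalMaxCliques τ μ ε (j + 2) ω +
      (tuples μ (lowPairs j) (orderedOutside τ μ n ε j) ω).card := by
  classical
  have hsub : (Finset.univ.filter fun s : Finset (Fin n) =>
      s.card = j + 2 ∧ IsMaximalClique (graph μ ω) s) ⊆
      (Finset.univ.filter fun s : Finset (Fin n) =>
        s.card = j + 2 ∧ IsMaximalClique (graph μ ω) s ∧ IsTypical τ μ ε ω.1 s) ∪
      (tuples μ (lowPairs j) (orderedOutside τ μ n ε j) ω).image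
        fun f => Finset.univ.image f := by
    intro s hs
    simp only [Finset.mem_filter, Finset.mem_univ, true_and] at hs
    by_cases ht : IsTypical τ μ ε ω.1 s
    · exact Finset.mem_union_left _ (by simp [hs, ht])
    · obtain ⟨f, hf, himg, h01, h1⟩ := exists_ordered_enumeration hs.1 ω.1
      refine Finset.mem_union_right _ (Finset.mem_image.2 ⟨f, ?_, himg⟩)
      simp only [tuples, Finset.mem_filter, Finset.mem_univ, true_and]
      refine ⟨hf, ⟨h01, h1, hw _, ?_⟩, unextendable_of_isMaximalClique hf
        (fun e he => not_isDiag_of_mem_lowPairs he) (himg ▸ hs.2)⟩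
      by_contra! hall
      exact ht (himg ▸ isTypical_of_forall_mem hN hf hall)
  have h := (Finset.card_le_card hsub).trans (Finset.card_union_le _ _)
  refine (le_of_eq ?_).trans (h.trans (Nat.add_le_add (le_of_eq ?_) Finset.card_image_le))
  · unfold numMaxCliques; congr
  · unfold numTypicalMaxCliques; congr

/-- The expected number of atypical maximal cliques without vertices of weight more than `μ n`. -/
theorem lintegral_card_atypical_le {τ μ : ℝ} (hτ : 2 < τ) (hμ : 0 < μ) {n j : ℕ}
    (hn : 2 * (j + 2) ≤ n) (ε : ℝ) :
    ∫⁻ ω, ((tuples μ (lowPairs j) (orderedOutside τ μ n ε j) ω).card : ℝ≥0∞) ∂(sampleLaw τ n) ≤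
      ENNReal.ofReal (μ ^ ((3 - τ) * (2 * τ - 3) / (τ - 1) - (j + 2 : ℝ)) *
        (n : ℝ) ^ ((3 - τ) * (2 * τ - 3) / (τ - 1))) *
      ∫⁻ ξ in {ξ | ∃ i, ξ i ∉ Icc ε (1 / ε)}, cliqueDensity τ (1 / (2 * μ)) ξ
        ∂(Measure.pi fun _ : CliqueIndex j => scaleMeasure τ) := by
  have h := lintegral_card_tuples_le (τ := τ) (μ := μ) (n := n) (lowPairs j)
    (measurableSet_orderedOutside τ μ n ε j)
    fun f hf => sampleLaw_orderedOutside_le hτ hμ hn ε hf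
  refine h.trans (le_of_eq ?_)
  have hc : Fintype.card (CliqueIndex j) = j + 2 := by simp [add_comm]
  rw [hc, ← mul_assoc, ← scales_mul_eq hτ hμ (by omega) j,
    ENNReal.ofReal_mul (p := (n : ℝ) ^ (j + 2)) (by positivity),
    ENNReal.ofReal_pow (by positivity), ENNReal.ofReal_natCast]

/-! ### The expected number of typical maximal cliques -/

theorem measurableSet_isMaximalClique (μ : ℝ) {n : ℕ} (s : Finset (Fin n)) :
    MeasurableSet {ω : Sample n | IsMaximalClique (graph μ ω) s} := by
  have hadj : ∀ u v : Fin n, Measurable fun ω : Sample n => (graph μ ω).Adj u v := fun u v =>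
    (measurable_const (a := u ≠ v)).and
      (measurableSet_setOfPred.1 (measurableSet_label_le_edgeProb μ s(u, v)))
  simp only [isMaximalClique_iff, SimpleGraph.isClique_iff, Set.Pairwise]
  refine measurableSet_setOfPred.2 (Measurable.and ?_ ?_)
  · exact Measurable.forall fun u => measurable_const.imp (Measurable.forall fun v =>
      measurable_const.imp (measurable_const.imp (hadj u v)))
  · exact Measurable.forall fun z => measurable_const.imp (Measurable.not
      (Measurable.forall fun i => measurable_const.imp (hadj i z)))

theorem measurableSet_isTypical (τ μ ε : ℝ) {n : ℕ} (s : Finset (Fin n)) :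
    MeasurableSet {ω : Sample n | IsTypical τ μ ε ω.1 s} := by
  have hw : ∀ (v : Fin n) (m : ℝ), Measurable fun ω : Sample n => ω.1 v ∈ window ε m :=
    fun v m => measurableSet_setOfPred.1
      (measurableSet_Icc.preimage ((measurable_pi_apply v).comp measurable_fst))
  unfold IsTypical
  refine measurableSet_setOfPred.2 (Measurable.exists fun u => measurable_const.and
    (Measurable.exists fun v => measurable_const.and (measurable_const.and
    ((hw _ _).and ((hw _ _).and (Measurable.forall fun x => measurable_const.imp
      (measurable_const.imp (measurable_const.imp (hw _ _)))))))))

theorem numTypicalMaxCliques_eq_sum (τ μ ε : ℝ) (k : ℕ) {n : ℕ} (ω : Sample n) :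
    (numTypicalMaxCliques τ μ ε k ω : ℝ≥0∞) = ∑ s ∈ Finset.univ.powersetCard k,
      ({ω : Sample n | IsMaximalClique (graph μ ω) s} ∩
        {ω | IsTypical τ μ ε ω.1 s}).indicator (fun _ => 1) ω := by
  classical
  have h : numTypicalMaxCliques τ μ ε k ω = ((Finset.univ.powersetCard k).filter
      fun s : Finset (Fin n) => IsMaximalClique (graph μ ω) s ∧ IsTypical τ μ ε ω.1 s).card := by
    unfold numTypicalMaxCliques
    congr 1
    ext s
    simp [Finset.mem_powersetCard]
  rw [h, Finset.card_filter]
  push_cast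
  exact Finset.sum_congr rfl fun s _ => by simp [indicator_apply]

theorem measurable_numTypicalMaxCliques (τ μ ε : ℝ) (k : ℕ) {n : ℕ} :
    Measurable fun ω : Sample n => (numTypicalMaxCliques τ μ ε k ω : ℝ≥0∞) := by
  simp_rw [numTypicalMaxCliques_eq_sum]
  exact Finset.measurable_sum _ fun s _ => measurable_const.indicator
    ((measurableSet_isMaximalClique μ s).inter (measurableSet_isTypical τ μ ε s))

theorem integral_numTypicalMaxCliques (τ μ ε : ℝ) (k n : ℕ) :
    ∫ ω, (numTypicalMaxCliques τ μ ε k ω : ℝ) ∂(sampleLaw τ n) =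
      (∫⁻ ω, (numTypicalMaxCliques τ μ ε k ω : ℝ≥0∞) ∂(sampleLaw τ n)).toReal := by
  rw [← integral_toReal (measurable_numTypicalMaxCliques τ μ ε k).aemeasurable
    (Eventually.of_forall fun _ => ENNReal.natCast_lt_top _)]
  simp

theorem tendsto_mul_natCast_atTop {μ : ℝ} (hμ : 0 < μ) :
    Tendsto (fun n : ℕ => μ * (n : ℝ)) atTop atTop :=
  tendsto_natCast_atTop_atTop.const_mul_atTop hμ

theorem tendsto_lowScale {τ μ : ℝ} (hτ : 2 < τ) (hμ : 0 < μ) :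
    Tendsto (lowScale τ μ) atTop atTop :=
  (tendsto_rpow_atTop (div_pos (by linarith) (by linarith))).comp (tendsto_mul_natCast_atTop hμ)

theorem tendsto_highScale {τ μ : ℝ} (hτ : 2 < τ) (hμ : 0 < μ) :
    Tendsto (highScale τ μ) atTop atTop :=
  (tendsto_rpow_atTop (div_pos one_pos (by linarith))).comp (tendsto_mul_natCast_atTop hμ)

/-- The high scale is of smaller order than `μ n`. -/
theorem eventually_mul_highScale_le {τ μ : ℝ} (hτ : 2 < τ) (hμ : 0 < μ) (A : ℝ) :
    ∀ᶠ n : ℕ in atTop, A * highScale τ μ n ≤ μ * n := by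
  filter_upwards [(tendsto_lowScale hτ hμ).eventually_ge_atTop A, eventually_gt_atTop 0]
    with n hn h0
  have hN : 0 < μ * n := mul_pos hμ (Nat.cast_pos.2 h0)
  rw [← lowScale_mul_highScale hτ hN]
  exact mul_le_mul_of_nonneg_right hn (highScale_pos hN).le

theorem lowScale_le_highScale {τ μ : ℝ} (hτ : 2 < τ) (hτ3 : τ < 3) {n : ℕ} (hN : 1 ≤ μ * n) :
    lowScale τ μ n ≤ highScale τ μ n :=
  Real.rpow_le_rpow_of_exponent_le hN (div_le_div_of_nonneg_right (by linarith) (by linarith))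

/-- For `ε = 2` the box `[ε, 1 / ε]` is empty, so that `orderedOutside` holds all ordered weight
vectors whose second weight is at most `μ n`. -/
theorem numTypicalMaxCliques_le {τ μ ε : ℝ} {n j : ℕ} (hN : 0 < μ * n)
    (hL : 1 / ε * lowScale τ μ n ≤ μ * n) (hH : 1 / ε * highScale τ μ n ≤ μ * n) (ω : Sample n) :
    numTypicalMaxCliques τ μ ε (j + 2) ω ≤
      (tuples μ (lowPairs j) (orderedOutside τ μ n 2 j) ω).card := by
  classical
  have hsub : (Finset.univ.filter fun s : Finset (Fin n) =>
      s.card = j + 2 ∧ IsMaximalClique (graph μ ω) s ∧ IsTypical τ μ ε ω.1 s) ⊆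
      (tuples μ (lowPairs j) (orderedOutside τ μ n 2 j) ω).image
        fun f => Finset.univ.image f := by
    intro s hs
    simp only [Finset.mem_filter, Finset.mem_univ, true_and] at hs
    obtain ⟨hcard, hmax, htyp⟩ := hs
    obtain ⟨g, -, hgimg, hg⟩ := exists_enumeration_of_isTypical hN hcard htyp
    have hw : ∀ v ∈ s, ω.1 v ≤ μ * n := by
      intro v hv
      rw [← hgimg] at hv
      obtain ⟨i, -, rfl⟩ := Finset.mem_image.1 hv
      refine ((div_le_iff₀ (cliqueScale_pos hN i)).1 (hg i).2).trans ?_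
      rcases i with i | l
      · exact hL
      · exact hH
    obtain ⟨f, hf, himg, h01, h1⟩ := exists_ordered_enumeration hcard ω.1
    refine Finset.mem_image.2 ⟨f, ?_, himg⟩
    simp only [tuples, Finset.mem_filter, Finset.mem_univ, true_and]
    refine ⟨hf, ⟨h01, h1, hw _ ?_, ⟨.inl 0, fun h => ?_⟩⟩, unextendable_of_isMaximalClique hf
      (fun e he => not_isDiag_of_mem_lowPairs he) (himg ▸ hmax)⟩
    · rw [← himg]; exact Finset.mem_image_of_mem _ (Finset.mem_univ _)
    · have := h.1.trans h.2
      norm_num at this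
  refine (le_of_eq ?_).trans ((Finset.card_le_card hsub).trans Finset.card_image_le)
  unfold numTypicalMaxCliques; congr

theorem exists_lintegral_numTypicalMaxCliques_le {τ μ ε : ℝ} (hτ : 2 < τ) (hτ3 : τ < 3)
    (hμ : 0 < μ) (hε : 0 < ε) {j : ℕ} (hj : 1 ≤ j) :
    ∃ C : ℝ, ∀ᶠ n : ℕ in atTop,
      ∫⁻ ω, (numTypicalMaxCliques τ μ ε (j + 2) ω : ℝ≥0∞) ∂(sampleLaw τ n) ≤
        ENNReal.ofReal (C * (n : ℝ) ^ ((3 - τ) * (2 * τ - 3) / (τ - 1))) := by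
  have hfin := lintegral_cliqueDensity_lt_top (c := 1 / (2 * μ)) hτ hτ3 (by positivity) hj
  set I := ∫⁻ ξ, cliqueDensity τ (1 / (2 * μ)) ξ
    ∂(Measure.pi fun _ : CliqueIndex j => scaleMeasure τ) with hI
  refine ⟨μ ^ ((3 - τ) * (2 * τ - 3) / (τ - 1) - (j + 2 : ℝ)) * I.toReal, ?_⟩
  filter_upwards [eventually_mul_highScale_le hτ hμ (1 / ε), eventually_ge_atTop (2 * (j + 2)),
    (tendsto_mul_natCast_atTop hμ).eventually_ge_atTop 1] with n h1 h2 h3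
  have hN : 0 < μ * n := by linarith
  have h1' : 1 / ε * lowScale τ μ n ≤ μ * n := le_trans
    (mul_le_mul_of_nonneg_left (lowScale_le_highScale hτ hτ3 h3) (by positivity)) h1
  calc _ ≤ ∫⁻ ω, ((tuples μ (lowPairs j) (orderedOutside τ μ n 2 j) ω).card : ℝ≥0∞)
          ∂(sampleLaw τ n) := lintegral_mono fun ω => by
        exact Nat.cast_le.2 (numTypicalMaxCliques_le hN h1' h1 ω)
    _ ≤ _ := lintegral_card_atypical_le hτ hμ h2 2
    _ ≤ ENNReal.ofReal (μ ^ ((3 - τ) * (2 * τ - 3) / (τ - 1) - (j + 2 : ℝ)) *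
        (n : ℝ) ^ ((3 - τ) * (2 * τ - 3) / (τ - 1))) * I := by
        gcongr
        exact setLIntegral_le_lintegral _ _
    _ = _ := by
        rw [← ENNReal.ofReal_toReal hfin.ne, ← ENNReal.ofReal_mul (by positivity),
          ENNReal.ofReal_toReal hfin.ne]
        congr 1
        ring

/-- The weight vectors within a factor `ε` of the typical scales. -/
def typicalBox (τ μ : ℝ) (n : ℕ) (ε : ℝ) (j : ℕ) : Set (CliqueIndex j → ℝ) :=
  Set.pi univ fun i => Icc (ε * cliqueScale τ μ n j i) (1 / ε * cliqueScale τ μ n j i)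

theorem measurableSet_typicalBox (τ μ : ℝ) (n : ℕ) (ε : ℝ) (j : ℕ) :
    MeasurableSet (typicalBox τ μ n ε j) :=
  MeasurableSet.univ_pi fun _ => measurableSet_Icc

theorem le_pi_weightLaw_typicalBox {τ μ ε : ℝ} (hτ : 2 < τ) (hε : 0 < ε) (hε1 : ε < 1) {n j : ℕ}
    (hN : 0 < μ * n) (hL : 1 ≤ ε * lowScale τ μ n) (hH : 1 ≤ ε * highScale τ μ n) :
    ENNReal.ofReal ((ε ^ (1 - τ) - (1 / ε) ^ (1 - τ)) ^ (j + 2) *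
        ((lowScale τ μ n ^ (1 - τ)) ^ 2 * (highScale τ μ n ^ (1 - τ)) ^ j)) ≤
      Measure.pi (fun _ : CliqueIndex j => weightLaw τ) (typicalBox τ μ n ε j) := by
  have := isProbabilityMeasure_weightLaw hτ
  have hε1' : ε ≤ 1 / ε := by rw [le_div_iff₀ hε]; nlinarith
  have hc : 0 ≤ ε ^ (1 - τ) - (1 / ε) ^ (1 - τ) :=
    sub_nonneg.2 (Real.rpow_le_rpow_of_nonpos hε hε1' (by linarith))
  have h1 : ∀ i : CliqueIndex j, 1 ≤ ε * cliqueScale τ μ n j i := by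
    rintro (i | l)
    · exact hL
    · exact hH
  have hs := fun i => cliqueScale_pos (τ := τ) hN (j := j) i
  have h2 : ∀ i : CliqueIndex j, ENNReal.ofReal
      ((ε ^ (1 - τ) - (1 / ε) ^ (1 - τ)) * cliqueScale τ μ n j i ^ (1 - τ)) ≤
      weightLaw τ (Icc (ε * cliqueScale τ μ n j i) (1 / ε * cliqueScale τ μ n j i)) := fun i => by
    refine le_trans (le_of_eq ?_) (measure_mono Ico_subset_Icc_self)
    rw [weightLaw_Ico (by linarith) (h1 i) (mul_le_mul_of_nonneg_right hε1' (hs i).le),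
      Real.mul_rpow hε.le (hs i).le, Real.mul_rpow (by positivity) (hs i).le, sub_mul]
  rw [typicalBox, Measure.pi_pi]
  refine le_trans (le_of_eq ?_) (Finset.prod_le_prod' fun i _ => h2 i)
  rw [← ENNReal.ofReal_prod_of_nonneg fun i _ =>
    mul_nonneg hc (Real.rpow_nonneg (hs i).le _), Finset.prod_mul_distrib, Finset.prod_const,
    Finset.card_univ, show Fintype.card (CliqueIndex j) = j + 2 by simp [add_comm],
    Fintype.prod_sum_type]
  simp [cliqueScale]

theorem lintegral_weightLaw_min_sq_le {τ μ : ℝ} (hτ : 2 < τ) {n : ℕ} (hN : 0 < μ * n) (c : ℝ) :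
    ∫⁻ y, ENNReal.ofReal (min (c * ((highScale τ μ n)⁻¹ * y)) 1 *
        min (c * ((highScale τ μ n)⁻¹ * y)) 1) ∂(weightLaw τ) ≤
      ENNReal.ofReal (μ * n)⁻¹ * commonMass τ c c := by
  have hH := highScale_pos (τ := τ) hN
  calc _ ≤ ∫⁻ y, (fun z => ENNReal.ofReal (min (c * z) 1 * min (c * z) 1))
          ((highScale τ μ n)⁻¹ * y) ∂(scaleMeasure τ) :=
        lintegral_mono' (weightLaw_le τ) le_rfl
    _ = _ := by
        rw [lintegral_comp_mul_scaleMeasure (inv_pos.2 hH)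
          (f := fun z => ENNReal.ofReal (min (c * z) 1 * min (c * z) 1)) (by fun_prop), commonMass,
          Real.inv_rpow hH.le, ← Real.rpow_neg hH.le, neg_sub, highScale_rpow hτ hN]

/-- A vertex is adjacent to two vertices of low-scale weights with probability `O(1 / n)`. -/
theorem one_sub_le_avoidProb {τ μ ε : ℝ} (hτ : 2 < τ) (hε : 0 < ε) {n j : ℕ}
    (hN : 0 < μ * n) {x : CliqueIndex j → ℝ} (hx : x ∈ typicalBox τ μ n ε j) :
    1 - ENNReal.ofReal (μ * n)⁻¹ * commonMass τ (1 / ε) (1 / ε) ≤ avoidProb τ μ n x := by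
  have := isProbabilityMeasure_weightLaw hτ
  have hL := lowScale_pos (τ := τ) hN
  have hH := highScale_pos (τ := τ) hN
  have hxpos : ∀ i, 0 < x i := fun i =>
    (mul_pos hε (cliqueScale_pos hN i)).trans_le (hx i (mem_univ i)).1
  have hxi : ∀ i : Fin 2, x (.inl i) ≤ 1 / ε * lowScale τ μ n := fun i => (hx (.inl i) trivial).2
  have hc01 : ∀ y, 0 ≤ y → ∀ i, 0 ≤ connProb μ n (x i) y ∧ connProb μ n (x i) y ≤ 1 :=
    fun y hy i => ⟨le_min (by have := hxpos i; positivity) zero_le_one, min_le_right _ _⟩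
  have hlow : ∀ y, 0 ≤ y → ∀ i : Fin 2, connProb μ n (x (.inl i)) y ≤
      min (1 / ε * ((highScale τ μ n)⁻¹ * y)) 1 := fun y hy i => by
    refine min_le_min_right _ ?_
    rw [← lowScale_mul_highScale hτ hN, div_le_iff₀ (mul_pos hL hH)]
    calc _ ≤ 1 / ε * lowScale τ μ n * y := mul_le_mul_of_nonneg_right (hxi i) hy
      _ = _ := by field_simp
  have hprod : ∀ y, 0 ≤ y → ∏ i, connProb μ n (x i) y ≤
      min (1 / ε * ((highScale τ μ n)⁻¹ * y)) 1 * min (1 / ε * ((highScale τ μ n)⁻¹ * y)) 1 :=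
    fun y hy => by
    rw [Fintype.prod_sum_type, Fin.prod_univ_two]
    calc _ ≤ connProb μ n (x (.inl 0)) y * connProb μ n (x (.inl 1)) y * 1 :=
          mul_le_mul_of_nonneg_left (Finset.prod_le_one (fun l _ => (hc01 y hy _).1)
            fun l _ => (hc01 y hy _).2) (mul_nonneg (hc01 y hy _).1 (hc01 y hy _).1)
      _ ≤ _ := by
          rw [mul_one]
          exact mul_le_mul (hlow y hy 0) (hlow y hy 1) (hc01 y hy _).1
            (le_min (by positivity) zero_le_one)
  have hP : ∫⁻ y, ENNReal.ofReal (∏ i, connProb μ n (x i) y) ∂(weightLaw τ) ≤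
      ENNReal.ofReal (μ * n)⁻¹ * commonMass τ (1 / ε) (1 / ε) := by
    refine le_trans (lintegral_mono_ae ?_) (lintegral_weightLaw_min_sq_le hτ hN (1 / ε))
    filter_upwards [ae_one_le_weightLaw τ] with y hy
    exact ENNReal.ofReal_le_ofReal (hprod y (by linarith))
  have hm : Measurable fun y => ENNReal.ofReal (∏ i, connProb μ n (x i) y) := by fun_prop
  rw [tsub_le_iff_right]
  calc (1 : ℝ≥0∞) = ∫⁻ _, 1 ∂(weightLaw τ) := by simp
    _ ≤ ∫⁻ y, ENNReal.ofReal (1 - ∏ i, connProb μ n (x i) y) +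
          ENNReal.ofReal (∏ i, connProb μ n (x i) y) ∂(weightLaw τ) := by
        refine lintegral_mono fun y => ?_
        rw [← ENNReal.ofReal_one]
        refine le_trans (le_of_eq ?_) ENNReal.ofReal_add_le
        congr 1
        ring
    _ ≤ _ := by
        rw [lintegral_add_right _ hm]
        exact add_le_add le_rfl hP

/-- The probability that all pairs are edges, for typical weights, is of the order of the
connection probability of the two lowest vertices. -/
theorem le_prod_edgeProb {τ μ ε : ℝ} (hτ : 2 < τ) (hτ3 : τ < 3) (hε : 0 < ε) (hε1 : ε < 1)
    {n j : ℕ} (hN : 1 ≤ μ * n) {x : CliqueIndex j → ℝ} (hx : x ∈ typicalBox τ μ n ε j) :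
    (ε ^ 2) ^ ((allPairs (CliqueIndex j)).card + 1) * (lowScale τ μ n ^ 2 / (μ * n)) ≤
      ∏ e ∈ allPairs (CliqueIndex j), edgeProb μ n x e := by
  classical
  have hN0 : 0 < μ * n := by linarith
  have hL := lowScale_pos (τ := τ) hN0
  have hH := highScale_pos (τ := τ) hN0
  have hLH := lowScale_mul_highScale hτ hN0
  have hle := lowScale_le_highScale hτ hτ3 hN
  have hε2 : ε ^ 2 ≤ 1 := pow_le_one₀ hε.le hε1.le
  have hxpos : ∀ i, 0 < x i := fun i =>
    (mul_pos hε (cliqueScale_pos hN0 i)).trans_le (hx i (mem_univ i)).1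
  have hxlow : ∀ i, ε * lowScale τ μ n ≤ x (.inl i) := fun i => (hx (.inl i) trivial).1
  have hxhigh : ∀ l, ε * highScale τ μ n ≤ x (.inr l) := fun l => (hx (.inr l) trivial).1
  have hkey : ∀ {p q x y : ℝ}, 0 < p → 0 < q → μ * n ≤ p * q → ε * p ≤ x → ε * q ≤ y →
      ε ^ 2 ≤ connProb μ n x y := fun {p q x y} hp hq hpq hpx hqy => by
    refine le_min ?_ hε2
    rw [le_div_iff₀ hN0]
    have : ε * p * (ε * q) ≤ x * y := mul_le_mul hpx hqy (by positivity)
      ((by positivity : 0 ≤ ε * p).trans hpx)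
    nlinarith [sq_nonneg ε]
  have hLL : lowScale τ μ n ^ 2 / (μ * n) ≤ 1 := by
    rw [div_le_one hN0, ← hLH, pow_two]
    exact mul_le_mul_of_nonneg_left hle hL.le
  have hHH : μ * n ≤ highScale τ μ n * highScale τ μ n := by
    rw [← hLH]; exact mul_le_mul_of_nonneg_right hle hH.le
  have h01 : ε ^ 2 * (lowScale τ μ n ^ 2 / (μ * n)) ≤ edgeProb μ n x s(.inl 0, .inl 1) := by
    refine le_min ?_ (mul_le_one₀ hε2 (by positivity) hLL)
    rw [mul_div_assoc', div_le_div_iff_of_pos_right hN0]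
    calc ε ^ 2 * lowScale τ μ n ^ 2 = ε * lowScale τ μ n * (ε * lowScale τ μ n) := by ring
      _ ≤ _ := mul_le_mul (hxlow 0) (hxlow 1) (by positivity) (hxpos _).le
  have hother : ∀ e ∈ (allPairs (CliqueIndex j)).erase s(.inl 0, .inl 1),
      ε ^ 2 ≤ edgeProb μ n x e := by
    intro e he
    obtain ⟨hne, hmem⟩ := Finset.mem_erase.1 he
    have hd : ¬ e.IsDiag := by simpa [allPairs] using hmem
    induction e with
    | _ a b =>
      rcases a with a | a <;> rcases b with b | b
      · exfalso
        fin_cases a <;> fin_cases b <;> simp at hne hd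
      · exact hkey hL hH hLH.ge (hxlow a) (hxhigh b)
      · rw [Sym2.eq_swap]
        exact hkey hL hH hLH.ge (hxlow b) (hxhigh a)
      · exact hkey hH hH hHH (hxhigh a) (hxhigh b)
  have hmem : s(.inl 0, .inl 1) ∈ allPairs (CliqueIndex j) := by simp [allPairs]
  rw [← Finset.mul_prod_erase _ _ hmem]
  calc _ = ε ^ 2 * (lowScale τ μ n ^ 2 / (μ * n)) *
        (ε ^ 2) ^ (allPairs (CliqueIndex j)).card := by ring
    _ ≤ ε ^ 2 * (lowScale τ μ n ^ 2 / (μ * n)) *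
        ∏ e ∈ (allPairs (CliqueIndex j)).erase s(.inl 0, .inl 1), ε ^ 2 := by
        rw [Finset.prod_const]
        exact mul_le_mul_of_nonneg_left (pow_le_pow_of_le_one (by positivity) hε2
          (Finset.card_le_card (Finset.erase_subset _ _))) (by positivity)
    _ ≤ _ := mul_le_mul h01 (Finset.prod_le_prod (fun _ _ => by positivity) hother)
        (Finset.prod_nonneg fun _ _ => by positivity) (le_trans (by positivity) h01)

/-- A lower bound for the probability that given vertices form a typical maximal clique. -/
theorem exists_le_sampleLaw_typicalBox {τ μ ε : ℝ} (hτ : 2 < τ) (hτ3 : τ < 3) (hμ : 0 < μ)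
    (hε : 0 < ε) (hε1 : ε < 1) (j : ℕ) :
    ∃ c : ℝ, 0 < c ∧ ∀ᶠ n : ℕ in atTop, ∀ f : CliqueIndex j → Fin n, Function.Injective f →
      ENNReal.ofReal (c * ((lowScale τ μ n ^ (1 - τ)) ^ 2 * (highScale τ μ n ^ (1 - τ)) ^ j *
        (lowScale τ μ n ^ 2 / (μ * n)))) ≤
      sampleLaw τ n ({ω | ω.1 ∘ f ∈ typicalBox τ μ n ε j} ∩
        unextendable μ f (allPairs (CliqueIndex j))) := by
  have hMfin : commonMass τ (1 / ε) (1 / ε) < ∞ :=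
    (commonMass_le (by positivity) (by positivity)).trans_lt
      (ENNReal.mul_lt_top ENNReal.ofReal_lt_top (truncMoment_lt_top hτ hτ3))
  set M := (commonMass τ (1 / ε) (1 / ε)).toReal with hM
  have hM0 : 0 ≤ M := ENNReal.toReal_nonneg
  have hMeq : commonMass τ (1 / ε) (1 / ε) = ENNReal.ofReal M :=
    (ENNReal.ofReal_toReal hMfin.ne).symm
  have hε1' : ε < 1 / ε := by rw [lt_div_iff₀ hε]; nlinarith
  have hd : 0 < ε ^ (1 - τ) - (1 / ε) ^ (1 - τ) :=
    sub_pos.2 (Real.rpow_lt_rpow_of_neg hε hε1' (by linarith))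
  refine ⟨(ε ^ 2) ^ ((allPairs (CliqueIndex j)).card + 1) * (Real.exp (-(M / μ)) / 2) *
    (ε ^ (1 - τ) - (1 / ε) ^ (1 - τ)) ^ (j + 2), by positivity, ?_⟩
  have hexp : ∀ᶠ n : ℕ in atTop, Real.exp (-(M / μ)) / 2 ≤ (1 + -(M / μ) / n) ^ n :=
    (Real.tendsto_one_add_div_pow_exp (-(M / μ))).eventually_const_le
      (half_lt_self (Real.exp_pos _))
  filter_upwards [hexp, (tendsto_mul_natCast_atTop hμ).eventually_ge_atTop (max 1 M),
    (tendsto_lowScale hτ hμ).eventually_ge_atTop (1 / ε),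
    (tendsto_highScale hτ hμ).eventually_ge_atTop (1 / ε)] with n h1 h2 h3 h4 f hf
  have hN1 : 1 ≤ μ * n := (le_max_left _ _).trans h2
  have hNM : M ≤ μ * n := (le_max_right _ _).trans h2
  have hN : 0 < μ * n := by linarith
  have hL := lowScale_pos (τ := τ) hN
  have hH := highScale_pos (τ := τ) hN
  rw [div_le_iff₀' hε] at h3 h4
  rw [sampleLaw_unextendable hτ hμ hf _ (measurableSet_typicalBox τ μ n ε j)]
  have havoid : ∀ x ∈ typicalBox τ μ n ε j, ENNReal.ofReal (Real.exp (-(M / μ)) / 2) ≤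
      avoidProb τ μ n x ^ (n - Fintype.card (CliqueIndex j)) := fun x hx => by
    have h0 : 0 ≤ 1 + -(M / μ) / n := by
      have : M / (μ * n) ≤ 1 := by rw [div_le_one hN]; exact hNM
      rw [neg_div, div_div]; linarith
    calc _ ≤ ENNReal.ofReal ((1 + -(M / μ) / n) ^ n) := ENNReal.ofReal_le_ofReal h1
      _ = ENNReal.ofReal (1 + -(M / μ) / n) ^ n := ENNReal.ofReal_pow h0 n
      _ ≤ ENNReal.ofReal (1 + -(M / μ) / n) ^ (n - Fintype.card (CliqueIndex j)) := by
          refine pow_le_pow_right_of_le_one' (ENNReal.ofReal_le_one.2 ?_) (Nat.sub_le _ _)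
          have : 0 ≤ M / μ / n := by positivity
          rw [neg_div]; linarith
      _ ≤ _ := by
          gcongr
          refine le_trans (le_of_eq ?_) (one_sub_le_avoidProb hτ hε hN hx)
          rw [hMeq, ← ENNReal.ofReal_mul (by positivity), ← ENNReal.ofReal_one,
            ← ENNReal.ofReal_sub _ (by positivity)]
          congr 1
          field_simp
          ring
  calc _ = ENNReal.ofReal ((ε ^ 2) ^ ((allPairs (CliqueIndex j)).card + 1) *
          (lowScale τ μ n ^ 2 / (μ * n))) * ENNReal.ofReal (Real.exp (-(M / μ)) / 2) *
        ENNReal.ofReal ((ε ^ (1 - τ) - (1 / ε) ^ (1 - τ)) ^ (j + 2) *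
          ((lowScale τ μ n ^ (1 - τ)) ^ 2 * (highScale τ μ n ^ (1 - τ)) ^ j)) := by
        rw [← ENNReal.ofReal_mul (by positivity), ← ENNReal.ofReal_mul (by positivity)]
        congr 1
        ring
    _ ≤ ENNReal.ofReal ((ε ^ 2) ^ ((allPairs (CliqueIndex j)).card + 1) *
          (lowScale τ μ n ^ 2 / (μ * n))) * ENNReal.ofReal (Real.exp (-(M / μ)) / 2) *
        Measure.pi (fun _ : CliqueIndex j => weightLaw τ) (typicalBox τ μ n ε j) := by
        gcongr
        exact le_pi_weightLaw_typicalBox hτ hε hε1 hN h3 h4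
    _ = ∫⁻ x in typicalBox τ μ n ε j,
        ENNReal.ofReal ((ε ^ 2) ^ ((allPairs (CliqueIndex j)).card + 1) *
          (lowScale τ μ n ^ 2 / (μ * n))) * ENNReal.ofReal (Real.exp (-(M / μ)) / 2)
        ∂(Measure.pi fun _ : CliqueIndex j => weightLaw τ) := by
        rw [setLIntegral_const]
    _ ≤ _ := by
        refine setLIntegral_mono' (measurableSet_typicalBox τ μ n ε j) fun x hx => ?_
        exact mul_le_mul' (ENNReal.ofReal_le_ofReal (le_prod_edgeProb hτ hτ3 hε hε1 hN1 hx))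
          (havoid x hx)

theorem exists_le_lintegral_numTypicalMaxCliques {τ μ ε : ℝ} (hτ : 2 < τ) (hτ3 : τ < 3)
    (hμ : 0 < μ) (hε : 0 < ε) (hε1 : ε < 1) (j : ℕ) :
    ∃ c : ℝ, 0 < c ∧ ∀ᶠ n : ℕ in atTop,
      ENNReal.ofReal (c * (n : ℝ) ^ ((3 - τ) * (2 * τ - 3) / (τ - 1))) ≤
        ∫⁻ ω, (numTypicalMaxCliques τ μ ε (j + 2) ω : ℝ≥0∞) ∂(sampleLaw τ n) := by
  obtain ⟨c, hc, hev⟩ := exists_le_sampleLaw_typicalBox hτ hτ3 hμ hε hε1 j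
  refine ⟨1 / (2 ^ (j + 2) * (j + 2).factorial) * c *
    μ ^ ((3 - τ) * (2 * τ - 3) / (τ - 1) - (j + 2 : ℝ)), by positivity, ?_⟩
  filter_upwards [hev, eventually_ge_atTop (2 * (j + 2))] with n hn hn2
  have hn0 : 0 < n := by omega
  have hN : 0 < μ * n := mul_pos hμ (Nat.cast_pos.2 hn0)
  set q := (lowScale τ μ n ^ (1 - τ)) ^ 2 * (highScale τ μ n ^ (1 - τ)) ^ j *
        (lowScale τ μ n ^ 2 / (μ * n)) with hq
  have hq0 : 0 ≤ q := by
    have := lowScale_pos (τ := τ) hN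
    have := highScale_pos (τ := τ) hN
    positivity
  have hm : ∀ s : Finset (Fin n), MeasurableSet ({ω : Sample n | IsMaximalClique (graph μ ω) s} ∩
      {ω | IsTypical τ μ ε ω.1 s}) := fun s =>
    (measurableSet_isMaximalClique μ s).inter (measurableSet_isTypical τ μ ε s)
  simp_rw [numTypicalMaxCliques_eq_sum]
  rw [lintegral_finsetSum _ fun s _ => measurable_const.indicator (hm s)]
  simp_rw [lintegral_indicator_const (hm _), one_mul]
  have hs : ∀ s ∈ (Finset.univ : Finset (Fin n)).powersetCard (j + 2), ENNReal.ofReal (c * q) ≤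
      sampleLaw τ n ({ω : Sample n | IsMaximalClique (graph μ ω) s} ∩
        {ω | IsTypical τ μ ε ω.1 s}) := by
    intro s hs
    obtain ⟨f, hf, himg, -⟩ :=
      exists_ordered_enumeration (Finset.mem_powersetCard.1 hs).2 fun _ => 0
    refine (hn f hf).trans (measure_mono fun ω hω => ?_)
    rw [← himg]
    refine ⟨isMaximalClique_of_unextendable hω.2, isTypical_of_forall_mem hN hf fun i => ?_⟩
    have := hω.1 i (mem_univ i)
    exact (mem_window_iff (cliqueScale_pos hN i)).1 this
  refine le_trans ?_ (Finset.sum_le_sum hs)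
  rw [Finset.sum_const, Finset.card_powersetCard, Finset.card_univ, Fintype.card_fin,
    nsmul_eq_mul, ← ENNReal.ofReal_natCast, ← ENNReal.ofReal_mul (Nat.cast_nonneg _)]
  refine ENNReal.ofReal_le_ofReal ?_
  have hchoose : (n : ℝ) ^ (j + 2) / (2 ^ (j + 2) * (j + 2).factorial) ≤ n.choose (j + 2) := by
    refine le_trans ?_ (Nat.pow_le_choose (j + 2) n)
    rw [← div_div, ← div_pow]
    gcongr
    rw [Nat.cast_sub (by omega)]
    have : ((2 * (j + 2) : ℕ) : ℝ) ≤ n := by exact_mod_cast hn2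
    push_cast at this ⊢
    linarith
  calc _ = (n : ℝ) ^ (j + 2) / (2 ^ (j + 2) * (j + 2).factorial) * (c * q) := by
        rw [mul_assoc, ← scales_mul_eq hτ hμ hn0 j, ← hq]
        ring
    _ ≤ _ := mul_le_mul_of_nonneg_right hchoose (by positivity)

theorem isTheta_integral_numTypicalMaxCliques {τ μ ε : ℝ} (hτ : 2 < τ) (hτ3 : τ < 3)
    (hμ : 0 < μ) (hε : 0 < ε) (hε1 : ε < 1) {j : ℕ} (hj : 1 ≤ j) :
    (fun n : ℕ => ∫ ω, (numTypicalMaxCliques τ μ ε (j + 2) ω : ℝ) ∂(sampleLaw τ n))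
      =Θ[atTop] fun n : ℕ => (n : ℝ) ^ ((3 - τ) * (2 * τ - 3) / (τ - 1)) := by
  obtain ⟨C, hC⟩ := exists_lintegral_numTypicalMaxCliques_le hτ hτ3 hμ hε hj
  obtain ⟨c, hc, hc'⟩ := exists_le_lintegral_numTypicalMaxCliques hτ hτ3 hμ hε hε1 j
  constructor
  · refine IsBigO.of_bound |C| ?_
    filter_upwards [hC] with n hn
    rw [integral_numTypicalMaxCliques, Real.norm_of_nonneg ENNReal.toReal_nonneg]
    refine (ENNReal.toReal_mono ENNReal.ofReal_ne_top hn).trans ?_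
    rw [ENNReal.toReal_ofReal', ← Real.norm_eq_abs C, ← norm_mul, Real.norm_eq_abs]
    exact max_le (le_abs_self _) (abs_nonneg _)
  · refine IsBigO.of_bound c⁻¹ ?_
    filter_upwards [hC, hc'] with n hn hn'
    rw [integral_numTypicalMaxCliques, Real.norm_of_nonneg ENNReal.toReal_nonneg,
      Real.norm_of_nonneg (by positivity), le_inv_mul_iff₀ hc]
    exact (ENNReal.ofReal_le_iff_le_toReal (hn.trans_lt ENNReal.ofReal_lt_top).ne).1 hn'

/-! ### The second moment method -/

/-- Chebyshev's inequality for the number of events that occur. -/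
theorem measureReal_sum_indicator_le {Ω κ : Type*} [MeasurableSpace Ω] {P : Measure Ω}
    [IsProbabilityMeasure P] {T : Finset κ} {B : κ → Set Ω} (hB : ∀ p, MeasurableSet (B p)) {b : ℝ}
    {r : κ → κ → ℝ} (h1 : ∀ p ∈ T, P.real (B p) = b)
    (h2 : ∀ p ∈ T, ∀ p' ∈ T, P.real (B p ∩ B p') ≤ b ^ 2 + r p p') (hM : 0 < T.card * b) :
    P.real {ω | ∑ p ∈ T, (B p).indicator (fun _ => (1 : ℝ)) ω ≤ T.card * b / 2} ≤
      4 * (∑ p ∈ T, ∑ p' ∈ T, r p p') / (T.card * b) ^ 2 := by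
  set M := T.card * b with hMdef
  have hind : ∀ C : Set Ω, MeasurableSet C → Integrable (C.indicator fun _ => (1 : ℝ)) P :=
    fun C hC => (integrable_const 1).indicator hC
  have hY : Integrable (fun ω => ∑ p ∈ T, (B p).indicator (fun _ => (1 : ℝ)) ω) P :=
    integrable_finsetSum _ fun p _ => hind _ (hB p)
  have hsq : ∀ ω, (∑ p ∈ T, (B p).indicator (fun _ => (1 : ℝ)) ω) ^ 2 =
      ∑ p ∈ T, ∑ p' ∈ T, (B p ∩ B p').indicator (fun _ => (1 : ℝ)) ω := fun ω => by
    rw [pow_two, Finset.sum_mul_sum]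
    refine Finset.sum_congr rfl fun p _ => Finset.sum_congr rfl fun p' _ => ?_
    rw [Set.inter_indicator_mul (fun _ => (1 : ℝ)) (fun _ => (1 : ℝ)) ω |>.symm.trans]
    simp
  have hY2 : Integrable (fun ω => (∑ p ∈ T, (B p).indicator (fun _ => (1 : ℝ)) ω) ^ 2) P := by
    simp_rw [hsq]
    exact integrable_finsetSum _ fun p _ => integrable_finsetSum _ fun p' _ =>
      hind _ ((hB p).inter (hB p'))
  have e1 : ∫ ω, ∑ p ∈ T, (B p).indicator (fun _ => (1 : ℝ)) ω ∂P = M := by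
    rw [integral_finsetSum _ fun p _ => hind _ (hB p)]
    simp_rw [integral_indicator_const (1 : ℝ) (hB _), smul_eq_mul, mul_one]
    rw [Finset.sum_congr rfl h1, Finset.sum_const, nsmul_eq_mul]
  have e2 : ∫ ω, (∑ p ∈ T, (B p).indicator (fun _ => (1 : ℝ)) ω) ^ 2 ∂P ≤
      M ^ 2 + ∑ p ∈ T, ∑ p' ∈ T, r p p' := by
    simp_rw [hsq]
    rw [integral_finsetSum _ fun p _ => integrable_finsetSum _ fun p' _ =>
      hind _ ((hB p).inter (hB p'))]
    simp_rw [integral_finsetSum _ fun p' (_ : p' ∈ T) => hind _ ((hB _).inter (hB p')),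
      integral_indicator_const (1 : ℝ) ((hB _).inter (hB _)), smul_eq_mul, mul_one]
    calc _ ≤ ∑ p ∈ T, ∑ p' ∈ T, (b ^ 2 + r p p') :=
          Finset.sum_le_sum fun p hp => Finset.sum_le_sum fun p' hp' => h2 p hp p' hp'
      _ = _ := by
          simp_rw [Finset.sum_add_distrib, Finset.sum_const, nsmul_eq_mul]
          rw [hMdef]
          ring
  have hI1 : Integrable
      (fun ω => 2 * (∑ p ∈ T, (B p).indicator (fun _ => (1 : ℝ)) ω) * M) P :=
    (hY.const_mul 2).mul_const M
  have hI2 : Integrable (fun ω => (∑ p ∈ T, (B p).indicator (fun _ => (1 : ℝ)) ω) ^ 2 -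
      2 * (∑ p ∈ T, (B p).indicator (fun _ => (1 : ℝ)) ω) * M) P := hY2.sub hI1
  have hZ : Integrable
      (fun ω => ((∑ p ∈ T, (B p).indicator (fun _ => (1 : ℝ)) ω) - M) ^ 2) P := by
    simp_rw [sub_sq]
    exact hI2.add (integrable_const _)
  have e3 : ∫ ω, ((∑ p ∈ T, (B p).indicator (fun _ => (1 : ℝ)) ω) - M) ^ 2 ∂P ≤
      ∑ p ∈ T, ∑ p' ∈ T, r p p' := by
    simp_rw [sub_sq]
    rw [integral_add hI2 (integrable_const _), integral_sub hY2 hI1, integral_mul_const,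
      integral_const_mul, e1]
    simp only [integral_const, probReal_univ, smul_eq_mul, one_mul]
    linarith
  have hmarkov := mul_meas_ge_le_integral_of_nonneg
    (Eventually.of_forall fun ω => sq_nonneg
      ((∑ p ∈ T, (B p).indicator (fun _ => (1 : ℝ)) ω) - M)) hZ ((M / 2) ^ 2)
  have hsub : {ω | ∑ p ∈ T, (B p).indicator (fun _ => (1 : ℝ)) ω ≤ M / 2} ⊆
      {ω | (M / 2) ^ 2 ≤ ((∑ p ∈ T, (B p).indicator (fun _ => (1 : ℝ)) ω) - M) ^ 2} := by
    intro ω hω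
    simp only [mem_ofPred_eq] at hω ⊢
    nlinarith
  have hmono := measureReal_mono (μ := P) hsub
  rw [le_div_iff₀ (by positivity)]
  have hfin := hmarkov.trans e3
  nlinarith [sq_nonneg M]

/-- A lower tail bound for the number of weights in a set. -/
theorem pi_real_card_le {n : ℕ} (m : Measure ℝ) [IsProbabilityMeasure m] {A : Set ℝ}
    (hA : MeasurableSet A) (hp : 0 < n * m.real A) :
    (Measure.pi fun _ : Fin n => m).real
        {w | ∑ v : Fin n, A.indicator (fun _ => (1 : ℝ)) (w v) ≤ n * m.real A / 2} ≤
      4 / (n * m.real A) := by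
  classical
  have hB : ∀ v : Fin n, MeasurableSet {w : Fin n → ℝ | w v ∈ A} := fun v =>
    hA.preimage (measurable_pi_apply v)
  have hprob : ∀ F : Finset (Fin n), (Measure.pi fun _ : Fin n => m).real
      {w | ∀ v ∈ F, w v ∈ A} = m.real A ^ F.card := fun F => by
    have : {w : Fin n → ℝ | ∀ v ∈ F, w v ∈ A} = Set.pi (F : Set (Fin n)) fun _ => A := by
      ext w; simp [Set.mem_pi]
    rw [this, Measure.real, Measure.pi_pi_finset, Finset.prod_const, ENNReal.toReal_pow]
    rfl
  have h := measureReal_sum_indicator_le (P := Measure.pi fun _ : Fin n => m)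
    (T := Finset.univ) (B := fun v => {w : Fin n → ℝ | w v ∈ A}) hB (b := m.real A)
    (r := fun v v' => if v = v' then m.real A else 0) (fun v _ => ?_) (fun v _ v' _ => ?_)
    (by simpa using hp)
  · simp only [Finset.sum_ite_eq, Finset.mem_univ, if_true, Finset.sum_const, Finset.card_univ,
      Fintype.card_fin, nsmul_eq_mul] at h
    refine le_trans (le_of_eq ?_) (h.trans (le_of_eq ?_))
    · rfl
    · field_simp
  · simpa using hprob {v}
  · by_cases hv : v = v'
    · subst hv
      simp only [inter_self, if_true]
      have : (Measure.pi fun _ : Fin n => m).real {w | w v ∈ A} = m.real A := by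
        simpa using hprob {v}
      rw [this]
      nlinarith [sq_nonneg (m.real A)]
    · simp only [hv, if_false, add_zero]
      have := hprob {v, v'}
      rw [Finset.card_pair hv] at this
      refine le_of_eq (Eq.trans ?_ this)
      congr 1
      ext w
      simp

/-! ### Maximal cliques for given weights -/

section GivenWeights

variable {V : Type*} [DecidableEq V]

/-- The edges between `S` and the two vertices of `p`, and the edge between these two. -/
def crossEdges (S : Finset V) (p : V × V) : Finset (Sym2 V) :=
  insert s(p.1, p.2) (S.image (fun x => s(p.1, x)) ∪ S.image (fun x => s(p.2, x)))

theorem mem_crossEdges {S : Finset V} {p : V × V} {e : Sym2 V} :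
    e ∈ crossEdges S p ↔ e = s(p.1, p.2) ∨ (∃ x ∈ S, s(p.1, x) = e) ∨ ∃ x ∈ S, s(p.2, x) = e := by
  simp [crossEdges]

theorem prod_crossEdges {S : Finset V} {p : V × V} (h1 : p.1 ∉ S) (h2 : p.2 ∉ S)
    (h12 : p.1 ≠ p.2) (g : Sym2 V → ℝ) :
    ∏ e ∈ crossEdges S p, g e =
      g s(p.1, p.2) * ((∏ x ∈ S, g s(p.1, x)) * ∏ x ∈ S, g s(p.2, x)) := by
  have hinj : ∀ v : V, Function.Injective fun x => s(v, x) := fun v x y h =>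
    Sym2.congr_right.1 h
  rw [crossEdges, Finset.prod_insert, Finset.prod_union, Finset.prod_image (hinj _).injOn,
    Finset.prod_image (hinj _).injOn]
  · rw [Finset.disjoint_left]
    intro e he he'
    obtain ⟨x, hx, rfl⟩ := Finset.mem_image.1 he
    obtain ⟨y, hy, hxy⟩ := Finset.mem_image.1 he'
    rcases Sym2.eq_iff.1 hxy with h | h
    · exact h12 h.1.symm
    · exact h2 (h.1 ▸ hx)
  · intro he
    rcases Finset.mem_union.1 he with he | he
    · obtain ⟨x, hx, h⟩ := Finset.mem_image.1 he
      rcases Sym2.eq_iff.1 h with h | h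
      · exact h2 (h.2 ▸ hx)
      · exact h12 h.1
    · obtain ⟨x, hx, h⟩ := Finset.mem_image.1 he
      rcases Sym2.eq_iff.1 h with h | h
      · exact h12 h.1.symm
      · exact h1 (h.2 ▸ hx)

open Classical in
/-- The threshold `ρ` for edges that meet `S`, and `q` for the others. -/
noncomputable def threshold (S : Finset V) (ρ q : ℝ) (e : Sym2 V) : ℝ :=
  if ∃ x ∈ S, x ∈ e then ρ else q

theorem threshold_of_mem {S : Finset V} {ρ q : ℝ} {v x : V} (hx : x ∈ S) :
    threshold S ρ q s(v, x) = ρ := if_pos ⟨x, hx, Sym2.mem_mk_right _ _⟩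

theorem threshold_of_notMem {S : Finset V} {ρ q : ℝ} {u v : V} (hu : u ∉ S) (hv : v ∉ S) :
    threshold S ρ q s(u, v) = q := if_neg fun ⟨x, hx, hxe⟩ => by
  rcases Sym2.mem_iff.1 hxe with rfl | rfl
  · exact hu hx
  · exact hv hx

theorem threshold_mem_Icc {S : Finset V} {ρ q : ℝ} (hρ : ρ ∈ Icc (0 : ℝ) 1)
    (hq : q ∈ Icc (0 : ℝ) 1) (e : Sym2 V) : threshold S ρ q e ∈ Icc (0 : ℝ) 1 := by
  unfold threshold; split_ifs <;> assumption

/-- The labels of `crossEdges S p` are below the threshold. -/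
def crossEvent (S : Finset V) (ρ q : ℝ) (p : V × V) : Set (Sym2 V → unitInterval) :=
  {U | ∀ e ∈ crossEdges S p, (U e : ℝ) ≤ threshold S ρ q e}

theorem measurableSet_crossEvent [Fintype V] (S : Finset V) (ρ q : ℝ) (p : V × V) :
    MeasurableSet (crossEvent S ρ q p) := measurableSet_labels_le _ _

theorem prod_threshold_crossEdges {S : Finset V} {ρ q : ℝ} {p : V × V} (h1 : p.1 ∉ S)
    (h2 : p.2 ∉ S) (h12 : p.1 ≠ p.2) :
    ∏ e ∈ crossEdges S p, threshold S ρ q e = q * (ρ ^ S.card * ρ ^ S.card) := by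
  rw [prod_crossEdges h1 h2 h12, threshold_of_notMem h1 h2,
    Finset.prod_congr rfl fun x hx => threshold_of_mem hx,
    Finset.prod_congr rfl fun x hx => threshold_of_mem hx, Finset.prod_const]

theorem labelLaw_crossEvent [Fintype V] {S : Finset V} {ρ q : ℝ} (hρ : ρ ∈ Icc (0 : ℝ) 1)
    (hq : q ∈ Icc (0 : ℝ) 1) {p : V × V} (h1 : p.1 ∉ S) (h2 : p.2 ∉ S) (h12 : p.1 ≠ p.2) :
    (labelLaw (Sym2 V)).real (crossEvent S ρ q p) = q * (ρ ^ S.card * ρ ^ S.card) := by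
  rw [crossEvent, labelLaw_real_le _ (threshold_mem_Icc hρ hq),
    prod_threshold_crossEdges h1 h2 h12]

/-- A lower tail bound for the number of pairs of `L₁ × L₂` that are joined, and are joined to all
of `S`, by edges with labels below the threshold. The events of two pairs are independent unless the
pairs share a vertex, which leaves the term `m ^ 2 * q` for equal pairs and `2 * m ^ 3 * q ^ 2` for
pairs with one common vertex. -/
theorem labelLaw_card_crossEvent_le [Fintype V] {S L₁ L₂ : Finset V} {ρ q : ℝ}
    (hρ : ρ ∈ Ioc (0 : ℝ) 1) (hq : q ∈ Ioc (0 : ℝ) 1) (h1 : Disjoint L₁ S) (h2 : Disjoint L₂ S)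
    (h12 : Disjoint L₁ L₂)
    {m : ℕ} (hm : 0 < m) (hm1 : L₁.card = m) (hm2 : L₂.card = m) :
    (labelLaw (Sym2 V)).real {U | ∑ p ∈ L₁ ×ˢ L₂, (crossEvent S ρ q p).indicator
        (fun _ => (1 : ℝ)) U ≤ (m : ℝ) ^ 2 * (q * (ρ ^ S.card * ρ ^ S.card)) / 2} ≤
      4 * ((m : ℝ) ^ 2 * q + 2 * m ^ 3 * q ^ 2) /
        ((m : ℝ) ^ 2 * (q * (ρ ^ S.card * ρ ^ S.card))) ^ 2 := by
  have hρ' : ρ ∈ Icc (0 : ℝ) 1 := ⟨hρ.1.le, hρ.2⟩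
  have hq' : q ∈ Icc (0 : ℝ) 1 := ⟨hq.1.le, hq.2⟩
  have hρ0 := hρ.1
  have hq0 := hq.1
  have hmem : ∀ p ∈ L₁ ×ˢ L₂, p.1 ∉ S ∧ p.2 ∉ S ∧ p.1 ∈ L₁ ∧ p.2 ∈ L₂ := fun p hp => by
    obtain ⟨hp1, hp2⟩ := Finset.mem_product.1 hp
    exact ⟨Finset.disjoint_left.1 h1 hp1, Finset.disjoint_left.1 h2 hp2, hp1, hp2⟩
  have hne : ∀ u ∈ L₁, ∀ v ∈ L₂, u ≠ v := fun u hu v hv h =>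
    Finset.disjoint_left.1 h12 hu (h ▸ hv)
  have hP : ∀ p ∈ L₁ ×ˢ L₂, (labelLaw (Sym2 V)).real (crossEvent S ρ q p) =
      q * (ρ ^ S.card * ρ ^ S.card) := fun p hp => by
    obtain ⟨a, b, c, d⟩ := hmem p hp
    exact labelLaw_crossEvent hρ' hq' a b (hne _ c _ d)
  have hcard : ((L₁ ×ˢ L₂).card : ℝ) = (m : ℝ) ^ 2 := by
    rw [Finset.card_product, hm1, hm2]; push_cast; ring
  have hpow : ρ ^ S.card * ρ ^ S.card ≤ 1 :=
    mul_le_one₀ (pow_le_one₀ hρ0.le hρ.2) (by positivity) (pow_le_one₀ hρ0.le hρ.2)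
  have h := measureReal_sum_indicator_le (P := labelLaw (Sym2 V)) (T := L₁ ×ˢ L₂)
    (B := crossEvent S ρ q) (measurableSet_crossEvent S ρ q)
    (b := q * (ρ ^ S.card * ρ ^ S.card))
    (r := fun p p' => (if p = p' then q else 0) + ((if p.1 = p'.1 then q ^ 2 else 0) +
      (if p.2 = p'.2 then q ^ 2 else 0))) hP ?_ (by rw [hcard]; positivity)
  · rw [hcard] at h
    refine h.trans (le_of_eq ?_)
    congr 2
    have e1 : ∀ p ∈ L₁ ×ˢ L₂, ∑ p' ∈ L₁ ×ˢ L₂, ((if p = p' then q else 0) +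
        ((if p.1 = p'.1 then q ^ 2 else 0) + (if p.2 = p'.2 then q ^ 2 else 0))) =
        q + 2 * m * q ^ 2 := by
      intro p hp
      obtain ⟨-, -, c, d⟩ := hmem p hp
      have s1 : ∑ p' ∈ L₁ ×ˢ L₂, (if p.1 = p'.1 then q ^ 2 else 0) = m * q ^ 2 := by
        rw [Finset.sum_product]
        refine (Finset.sum_congr rfl fun x _ =>
          Finset.sum_const (if p.1 = x then q ^ 2 else 0)).trans ?_
        rw [← Finset.smul_sum, Finset.sum_ite_eq, if_pos c, hm2, nsmul_eq_mul]
      have s2 : ∑ p' ∈ L₁ ×ˢ L₂, (if p.2 = p'.2 then q ^ 2 else 0) = m * q ^ 2 := by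
        rw [Finset.sum_product]
        refine (Finset.sum_congr rfl fun x _ => Finset.sum_ite_eq L₂ p.2 fun _ => q ^ 2).trans ?_
        rw [if_pos d, Finset.sum_const, hm1, nsmul_eq_mul]
      rw [Finset.sum_add_distrib, Finset.sum_add_distrib, Finset.sum_ite_eq, if_pos hp, s1, s2]
      ring
    rw [Finset.sum_congr rfl e1, Finset.sum_const, nsmul_eq_mul, hcard]
    ring
  · intro p hp p' hp'
    obtain ⟨a, b, c, d⟩ := hmem p hp
    obtain ⟨a', b', c', d'⟩ := hmem p' hp'
    by_cases hpp : p = p'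
    · subst hpp
      rw [inter_self, hP p hp]
      simp only [if_true]
      nlinarith [sq_nonneg (q * (ρ ^ S.card * ρ ^ S.card)), sq_nonneg q]
    · by_cases hdisj : p.1 = p'.1 ∨ p.2 = p'.2
      · -- different pairs with a common vertex: only the edges of the pairs are used
        have hs : s(p.1, p.2) ≠ s(p'.1, p'.2) := fun h => by
          rcases Sym2.eq_iff.1 h with h | h
          · exact hpp (Prod.ext h.1 h.2)
          · exact hne _ c _ d' h.1
        have hle : (labelLaw (Sym2 V)).real (crossEvent S ρ q p ∩ crossEvent S ρ q p') ≤
            q ^ 2 := by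
          calc _ ≤ (labelLaw (Sym2 V)).real {U | ∀ e ∈ ({s(p.1, p.2), s(p'.1, p'.2)} :
                Finset (Sym2 V)), (U e : ℝ) ≤ threshold S ρ q e} := by
                refine measureReal_mono fun U hU e he => ?_
                rcases Finset.mem_insert.1 he with rfl | he
                · exact hU.1 _ (mem_crossEdges.2 (Or.inl rfl))
                · rw [Finset.mem_singleton.1 he]
                  exact hU.2 _ (mem_crossEdges.2 (Or.inl rfl))
            _ = _ := by
                rw [labelLaw_real_le _ (threshold_mem_Icc hρ' hq'), Finset.prod_pair hs,
                  threshold_of_notMem a b, threshold_of_notMem a' b', pow_two]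
        refine hle.trans ?_
        have hb2 := sq_nonneg (q * (ρ ^ S.card * ρ ^ S.card))
        have hq2 := sq_nonneg q
        simp only [hpp, if_false, zero_add]
        rcases hdisj with h | h
        · simp only [h, if_true]
          split_ifs <;> linarith
        · simp only [h, if_true]
          split_ifs <;> linarith
      · -- pairs without a common vertex are independent
        push Not at hdisj
        have hd : Disjoint (crossEdges S p) (crossEdges S p') := by
          have hnp : ∀ e ∈ crossEdges S p, p.1 ∈ e ∨ p.2 ∈ e := fun e he => by
            rcases mem_crossEdges.1 he with rfl | ⟨x, -, rfl⟩ | ⟨x, -, rfl⟩ <;> simp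
          have hn : ∀ e ∈ crossEdges S p', p.1 ∉ e ∧ p.2 ∉ e := fun e he => by
            have k1 := hne _ c _ d'
            have k2 := hne _ c' _ d
            have k3 : ∀ x ∈ S, p.1 ≠ x := fun x hx h => a (h ▸ hx)
            have k4 : ∀ x ∈ S, p.2 ≠ x := fun x hx h => b (h ▸ hx)
            rcases mem_crossEdges.1 he with rfl | ⟨x, hx, rfl⟩ | ⟨x, hx, rfl⟩
            · simp [hdisj.1, hdisj.2, k1, k2.symm]
            · simp [hdisj.1, k2.symm, k3 x hx, k4 x hx]
            · simp [hdisj.2, k1, k3 x hx, k4 x hx]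
          rw [Finset.disjoint_left]
          intro e he he'
          rcases hnp e he with h | h
          · exact (hn e he').1 h
          · exact (hn e he').2 h
        have hset : crossEvent S ρ q p ∩ crossEvent S ρ q p' =
            {U | ∀ e ∈ crossEdges S p ∪ crossEdges S p', (U e : ℝ) ≤ threshold S ρ q e} := by
          ext U
          simp only [crossEvent, mem_inter_iff, mem_ofPred_eq, Finset.forall_mem_union]
        rw [hset, labelLaw_real_le _ (threshold_mem_Icc hρ' hq'), Finset.prod_union hd,
          prod_threshold_crossEdges a b (hne _ c _ d),
          prod_threshold_crossEdges a' b' (hne _ c' _ d')]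
        have := sq_nonneg q
        split_ifs <;> nlinarith

theorem labelLaw_crossEvent_inter [Fintype V] {S : Finset V} {ρ q : ℝ} (hρ : ρ ∈ Icc (0 : ℝ) 1)
    (hq : q ∈ Icc (0 : ℝ) 1) {g : Sym2 V → ℝ} (hg : ∀ e, g e ∈ Icc (0 : ℝ) 1) {p : V × V}
    (h1 : p.1 ∉ S) (h2 : p.2 ∉ S) (h12 : p.1 ≠ p.2) {z : V} (hz : z ∉ S) (hz1 : z ≠ p.1)
    (hz2 : z ≠ p.2) :
    (labelLaw (Sym2 V)).real (crossEvent S ρ q p ∩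
        {U | (U s(p.1, z) : ℝ) ≤ g s(p.1, z) ∧ (U s(p.2, z) : ℝ) ≤ g s(p.2, z)}) =
      q * (ρ ^ S.card * ρ ^ S.card) * (g s(p.1, z) * g s(p.2, z)) := by
  classical
  have hnot : ∀ e ∈ crossEdges S p, z ∉ e := fun e he => by
    have hzx : ∀ x ∈ S, z ≠ x := fun x hx h => hz (h ▸ hx)
    rcases mem_crossEdges.1 he with rfl | ⟨x, hx, rfl⟩ | ⟨x, hx, rfl⟩
    · simp [hz1, hz2]
    · simp [hz1, hzx x hx]
    · simp [hz2, hzx x hx]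
  -- thresholds that depend on whether the edge contains `z`
  set t : Sym2 V → ℝ := fun e => if z ∈ e then g e else threshold S ρ q e with ht
  have ht01 : ∀ e, t e ∈ Icc (0 : ℝ) 1 := fun e => by
    simp only [ht]
    split_ifs
    · exact hg e
    · exact threshold_mem_Icc hρ hq e
  have htc : ∀ e ∈ crossEdges S p, t e = threshold S ρ q e := fun e he => if_neg (hnot e he)
  have htz : ∀ v, t s(v, z) = g s(v, z) := fun v => if_pos (Sym2.mem_mk_right _ _)
  have hne : s(p.1, z) ≠ s(p.2, z) := fun h => h12 (Sym2.congr_left.1 h)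
  have hd : Disjoint (crossEdges S p) {s(p.1, z), s(p.2, z)} := by
    rw [Finset.disjoint_left]
    intro e he he'
    rcases Finset.mem_insert.1 he' with rfl | he'
    · exact hnot _ he (Sym2.mem_mk_right _ _)
    · rw [Finset.mem_singleton.1 he'] at he
      exact hnot _ he (Sym2.mem_mk_right _ _)
  have hset : crossEvent S ρ q p ∩
      {U | (U s(p.1, z) : ℝ) ≤ g s(p.1, z) ∧ (U s(p.2, z) : ℝ) ≤ g s(p.2, z)} =
      {U | ∀ e ∈ crossEdges S p ∪ {s(p.1, z), s(p.2, z)}, (U e : ℝ) ≤ t e} := by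
    ext U
    simp only [crossEvent, mem_inter_iff, mem_ofPred_eq, Finset.forall_mem_union,
      Finset.forall_mem_insert, Finset.mem_singleton, forall_eq, htz]
    exact and_congr_left fun _ => forall₂_congr fun e he => by rw [htc e he]
  rw [hset, labelLaw_real_le _ ht01, Finset.prod_union hd, Finset.prod_pair hne, htz, htz,
    Finset.prod_congr rfl htc, prod_threshold_crossEdges h1 h2 h12]

/-- The event `crossEvent`, together with the existence of a further common neighbour of the two
vertices of `p`. -/
def extendableEvent (S : Finset V) (ρ q : ℝ) (g : Sym2 V → ℝ) (p : V × V) :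
    Set (Sym2 V → unitInterval) :=
  ⋃ z ∈ {z | z ∉ S ∧ z ≠ p.1 ∧ z ≠ p.2}, crossEvent S ρ q p ∩
    {U | (U s(p.1, z) : ℝ) ≤ g s(p.1, z) ∧ (U s(p.2, z) : ℝ) ≤ g s(p.2, z)}

theorem measurableSet_extendableEvent [Fintype V] (S : Finset V) (ρ q : ℝ) (g : Sym2 V → ℝ)
    (p : V × V) : MeasurableSet (extendableEvent S ρ q g p) := by
  refine MeasurableSet.biUnion (Set.to_countable _) fun z _ =>
    (measurableSet_crossEvent S ρ q p).inter ?_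
  have h : ∀ e : Sym2 V, MeasurableSet {U : Sym2 V → unitInterval | (U e : ℝ) ≤ g e} := fun e =>
    measurableSet_le (by fun_prop) measurable_const
  exact (h _).inter (h _)

theorem labelLaw_extendableEvent_le [Fintype V] {S : Finset V} {ρ q : ℝ}
    (hρ : ρ ∈ Icc (0 : ℝ) 1) (hq : q ∈ Icc (0 : ℝ) 1) {g : Sym2 V → ℝ}
    (hg : ∀ e, g e ∈ Icc (0 : ℝ) 1) {p : V × V} (h1 : p.1 ∉ S) (h2 : p.2 ∉ S) (h12 : p.1 ≠ p.2)
    {σ : ℝ} (hσ : ∑ z, g s(p.1, z) * g s(p.2, z) ≤ σ) :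
    (labelLaw (Sym2 V)).real (extendableEvent S ρ q g p) ≤
      q * (ρ ^ S.card * ρ ^ S.card) * σ := by
  classical
  have hb : 0 ≤ q * (ρ ^ S.card * ρ ^ S.card) :=
    mul_nonneg hq.1 (mul_nonneg (pow_nonneg hρ.1 _) (pow_nonneg hρ.1 _))
  have hset : extendableEvent S ρ q g p =
      ⋃ z ∈ Finset.univ.filter fun z => z ∉ S ∧ z ≠ p.1 ∧ z ≠ p.2, crossEvent S ρ q p ∩
        {U | (U s(p.1, z) : ℝ) ≤ g s(p.1, z) ∧ (U s(p.2, z) : ℝ) ≤ g s(p.2, z)} := by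
    ext U
    simp [extendableEvent]
  rw [hset]
  calc _ ≤ ∑ z ∈ Finset.univ.filter fun z => z ∉ S ∧ z ≠ p.1 ∧ z ≠ p.2,
        (labelLaw (Sym2 V)).real (crossEvent S ρ q p ∩
          {U | (U s(p.1, z) : ℝ) ≤ g s(p.1, z) ∧ (U s(p.2, z) : ℝ) ≤ g s(p.2, z)}) :=
        measureReal_biUnion_finset_le _ _
    _ = ∑ z ∈ Finset.univ.filter fun z => z ∉ S ∧ z ≠ p.1 ∧ z ≠ p.2,
        q * (ρ ^ S.card * ρ ^ S.card) * (g s(p.1, z) * g s(p.2, z)) := by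
        refine Finset.sum_congr rfl fun z hz => ?_
        obtain ⟨-, hzS, hz1, hz2⟩ := Finset.mem_filter.1 hz
        exact labelLaw_crossEvent_inter hρ hq hg h1 h2 h12 hzS hz1 hz2
    _ ≤ ∑ z, q * (ρ ^ S.card * ρ ^ S.card) * (g s(p.1, z) * g s(p.2, z)) :=
        Finset.sum_le_sum_of_subset_of_nonneg (Finset.filter_subset _ _) fun z _ _ =>
          mul_nonneg hb (mul_nonneg (hg _).1 (hg _).1)
    _ ≤ _ := by
        rw [← Finset.mul_sum]
        exact mul_le_mul_of_nonneg_left hσ hb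

theorem labelLaw_card_extendableEvent_le [Fintype V] {S : Finset V} {ρ q : ℝ}
    (hρ : ρ ∈ Ioc (0 : ℝ) 1) (hq : q ∈ Ioc (0 : ℝ) 1) {g : Sym2 V → ℝ}
    (hg : ∀ e, g e ∈ Icc (0 : ℝ) 1) {T : Finset (V × V)}
    (hT : ∀ p ∈ T, p.1 ∉ S ∧ p.2 ∉ S ∧ p.1 ≠ p.2) (hT0 : T.Nonempty) {σ : ℝ}
    (hσ : ∀ p ∈ T, ∑ z, g s(p.1, z) * g s(p.2, z) ≤ σ) :
    (labelLaw (Sym2 V)).real {U | T.card * (q * (ρ ^ S.card * ρ ^ S.card)) / 4 ≤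
      ∑ p ∈ T, (extendableEvent S ρ q g p).indicator (fun _ => (1 : ℝ)) U} ≤ 4 * σ := by
  have hq0 := hq.1
  have hρ0 := hρ.1
  have hTc : (0 : ℝ) < T.card := Nat.cast_pos.2 hT0.card_pos
  set b := q * (ρ ^ S.card * ρ ^ S.card) with hb
  have hb0 : 0 < b := by positivity
  have hint : ∀ p ∈ T, Integrable
      ((extendableEvent S ρ q g p).indicator fun _ => (1 : ℝ)) (labelLaw (Sym2 V)) := fun p _ =>
    (integrable_const 1).indicator (measurableSet_extendableEvent S ρ q g p)
  have h := mul_meas_ge_le_integral_of_nonneg (μ := labelLaw (Sym2 V))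
    (f := fun U => ∑ p ∈ T, (extendableEvent S ρ q g p).indicator (fun _ => (1 : ℝ)) U)
    (Eventually.of_forall fun U => Finset.sum_nonneg fun p _ =>
      indicator_nonneg (fun _ _ => zero_le_one) _) (integrable_finsetSum _ hint) (T.card * b / 4)
  rw [integral_finsetSum _ hint] at h
  simp_rw [integral_indicator_const (1 : ℝ) (measurableSet_extendableEvent S ρ q g _), smul_eq_mul,
    mul_one] at h
  have h' : ∑ p ∈ T, (labelLaw (Sym2 V)).real (extendableEvent S ρ q g p) ≤
      T.card * b / 4 * (4 * σ) := by
    calc _ ≤ ∑ p ∈ T, b * σ := Finset.sum_le_sum fun p hp =>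
          labelLaw_extendableEvent_le ⟨hρ.1.le, hρ.2⟩ ⟨hq.1.le, hq.2⟩ hg (hT p hp).1 (hT p hp).2.1
            (hT p hp).2.2 (hσ p hp)
      _ = _ := by rw [Finset.sum_const, nsmul_eq_mul]; ring
  exact le_of_mul_le_mul_left (h.trans h') (by positivity)

end GivenWeights

/-- If `S` is a clique and the two vertices of `p` are joined to each other and to `S`, but have no
other common neighbour, then they form a maximal clique with `S`. -/
theorem isMaximalClique_insert_pair {μ : ℝ} {n : ℕ} {w : Fin n → ℝ} {S : Finset (Fin n)} {ρ q : ℝ}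
    (hS : ∀ x ∈ S, ∀ y ∈ S, x ≠ y → connProb μ n (w x) (w y) = 1) {p : Fin n × Fin n}
    (h1 : p.1 ∉ S) (h2 : p.2 ∉ S) (h12 : p.1 ≠ p.2)
    (hρ1 : ∀ x ∈ S, ρ ≤ connProb μ n (w p.1) (w x))
    (hρ2 : ∀ x ∈ S, ρ ≤ connProb μ n (w p.2) (w x)) (hq : q ≤ connProb μ n (w p.1) (w p.2))
    {U : Sym2 (Fin n) → unitInterval} (hU : U ∈ crossEvent S ρ q p)
    (hU' : U ∉ extendableEvent S ρ q (edgeProb μ n w) p) :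
    IsMaximalClique (graph μ ((w, U) : Sample n)) (insert p.1 (insert p.2 S)) := by
  have hne1 : ∀ x ∈ S, p.1 ≠ x := fun x hx h => h1 (h ▸ hx)
  have hne2 : ∀ x ∈ S, p.2 ≠ x := fun x hx h => h2 (h ▸ hx)
  have hadj12 : (graph μ ((w, U) : Sample n)).Adj p.1 p.2 := by
    refine ⟨h12, (hU _ (mem_crossEdges.2 (Or.inl rfl))).trans ?_⟩
    rw [threshold_of_notMem h1 h2]
    exact hq
  have hadj1 : ∀ x ∈ S, (graph μ ((w, U) : Sample n)).Adj p.1 x := fun x hx => by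
    refine ⟨hne1 x hx, (hU _ (mem_crossEdges.2 (Or.inr (Or.inl ⟨x, hx, rfl⟩)))).trans ?_⟩
    rw [threshold_of_mem hx]
    exact hρ1 x hx
  have hadj2 : ∀ x ∈ S, (graph μ ((w, U) : Sample n)).Adj p.2 x := fun x hx => by
    refine ⟨hne2 x hx, (hU _ (mem_crossEdges.2 (Or.inr (Or.inr ⟨x, hx, rfl⟩)))).trans ?_⟩
    rw [threshold_of_mem hx]
    exact hρ2 x hx
  have hadjS : (graph μ ((w, U) : Sample n)).IsClique (S : Set (Fin n)) := fun x hx y hy hxy =>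
    ⟨hxy, (unitInterval.le_one _).trans (hS x hx y hy hxy).ge⟩
  rw [isMaximalClique_iff]
  refine ⟨?_, fun z hz hall => hU' ?_⟩
  · rw [Finset.coe_insert, Finset.coe_insert]
    refine SimpleGraph.IsClique.insert (hadjS.insert fun b hb _ => hadj2 b hb) fun b hb _ => ?_
    rcases hb with rfl | hb
    · exact hadj12
    · exact hadj1 b hb
  · simp only [Finset.mem_insert, not_or] at hz
    exact mem_biUnion (show z ∈ {z | z ∉ S ∧ z ≠ p.1 ∧ z ≠ p.2} from ⟨hz.2.2, hz.1, hz.2.1⟩)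
      ⟨hU, (hall p.1 (by simp)).2, (hall p.2 (by simp)).2⟩

/-- For given weights with enough vertices of high and of low weight, there are many maximal
cliques with high probability. -/
theorem labelLaw_numMaxCliques_lt_le {μ : ℝ} (hμ : 0 < μ) {n : ℕ} {w : Fin n → ℝ}
    (hw : ∀ v, 0 ≤ w v) {S L₁ L₂ : Finset (Fin n)} {ρ q σ : ℝ} (hρ : ρ ∈ Ioc (0 : ℝ) 1)
    (hq : q ∈ Ioc (0 : ℝ) 1) (h1 : Disjoint L₁ S) (h2 : Disjoint L₂ S) (h12 : Disjoint L₁ L₂)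
    {m : ℕ} (hm : 0 < m) (hm1 : L₁.card = m) (hm2 : L₂.card = m)
    (hS : ∀ x ∈ S, ∀ y ∈ S, x ≠ y → connProb μ n (w x) (w y) = 1)
    (hρ1 : ∀ u ∈ L₁, ∀ x ∈ S, ρ ≤ connProb μ n (w u) (w x))
    (hρ2 : ∀ v ∈ L₂, ∀ x ∈ S, ρ ≤ connProb μ n (w v) (w x))
    (hq12 : ∀ u ∈ L₁, ∀ v ∈ L₂, q ≤ connProb μ n (w u) (w v))
    (hσ : ∀ u ∈ L₁, ∀ v ∈ L₂,
      ∑ z, connProb μ n (w u) (w z) * connProb μ n (w v) (w z) ≤ σ) :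
    (labelLaw (Sym2 (Fin n))).real {U | (numMaxCliques μ (S.card + 2) ((w, U) : Sample n) : ℝ) <
        (m : ℝ) ^ 2 * (q * (ρ ^ S.card * ρ ^ S.card)) / 4} ≤
      4 * ((m : ℝ) ^ 2 * q + 2 * m ^ 3 * q ^ 2) /
        ((m : ℝ) ^ 2 * (q * (ρ ^ S.card * ρ ^ S.card))) ^ 2 + 4 * σ := by
  classical
  have hcard : ((L₁ ×ˢ L₂).card : ℝ) = (m : ℝ) ^ 2 := by
    rw [Finset.card_product, hm1, hm2]; push_cast; ring
  have hmem : ∀ p ∈ L₁ ×ˢ L₂, p.1 ∈ L₁ ∧ p.2 ∈ L₂ ∧ p.1 ∉ S ∧ p.2 ∉ S ∧ p.1 ≠ p.2 :=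
    fun p hp => by
    obtain ⟨hp1, hp2⟩ := Finset.mem_product.1 hp
    exact ⟨hp1, hp2, Finset.disjoint_left.1 h1 hp1, Finset.disjoint_left.1 h2 hp2,
      fun h => Finset.disjoint_left.1 h12 hp1 (h ▸ hp2)⟩
  have hg : ∀ e, edgeProb μ n w e ∈ Icc (0 : ℝ) 1 := edgeProb_mem_Icc hμ n hw
  have hne : (L₁ ×ˢ L₂).Nonempty := Finset.Nonempty.product
    (Finset.card_pos.1 (hm1 ▸ hm)) (Finset.card_pos.1 (hm2 ▸ hm))
  have hY := labelLaw_card_crossEvent_le hρ hq h1 h2 h12 hm hm1 hm2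
  have hZ := labelLaw_card_extendableEvent_le hρ hq hg
    (fun p hp => (hmem p hp).2.2) hne (σ := σ) fun p hp => hσ _ (hmem p hp).1 _ (hmem p hp).2.1
  rw [hcard] at hZ
  have hcount : ∀ U : Sym2 (Fin n) → unitInterval,
      ∑ p ∈ L₁ ×ˢ L₂, (crossEvent S ρ q p).indicator (fun _ => (1 : ℝ)) U -
        ∑ p ∈ L₁ ×ˢ L₂, (extendableEvent S ρ q (edgeProb μ n w) p).indicator
          (fun _ => (1 : ℝ)) U ≤ numMaxCliques μ (S.card + 2) ((w, U) : Sample n) := by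
    intro U
    set T := (L₁ ×ˢ L₂).filter fun p => U ∈ crossEvent S ρ q p ∧
      U ∉ extendableEvent S ρ q (edgeProb μ n w) p with hT
    have hTle : ∑ p ∈ L₁ ×ˢ L₂, (crossEvent S ρ q p).indicator (fun _ => (1 : ℝ)) U -
        ∑ p ∈ L₁ ×ˢ L₂, (extendableEvent S ρ q (edgeProb μ n w) p).indicator
          (fun _ => (1 : ℝ)) U ≤ T.card := by
      rw [← Finset.sum_sub_distrib, hT, Finset.card_filter]
      push_cast
      refine Finset.sum_le_sum fun p _ => ?_
      by_cases hc : U ∈ crossEvent S ρ q p <;>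
        by_cases he : U ∈ extendableEvent S ρ q (edgeProb μ n w) p <;> simp [hc, he]
    refine hTle.trans (Nat.cast_le.2 ?_)
    have hinj : Set.InjOn (fun p : Fin n × Fin n => insert p.1 (insert p.2 S)) T := by
      intro p hp p' hp' h
      obtain ⟨a, b, c, d, e⟩ := hmem p (Finset.mem_filter.1 hp).1
      replace h : insert p.1 (insert p.2 S) = insert p'.1 (insert p'.2 S) := h
      obtain ⟨a', b', c', d', e'⟩ := hmem p' (Finset.mem_filter.1 hp').1
      have k1 : p.1 ∈ insert p'.1 (insert p'.2 S) := h ▸ Finset.mem_insert_self _ _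
      have k2 : p.2 ∈ insert p'.1 (insert p'.2 S) :=
        h ▸ Finset.mem_insert_of_mem (Finset.mem_insert_self _ _)
      simp only [Finset.mem_insert, c, d, or_false] at k1 k2
      refine Prod.ext (k1.resolve_right fun h => ?_) (k2.resolve_left fun h => ?_)
      · exact Finset.disjoint_left.1 h12 a (h ▸ b')
      · exact Finset.disjoint_left.1 h12 a' (h ▸ b)
    rw [← Finset.card_image_of_injOn hinj]
    unfold numMaxCliques
    refine Finset.card_le_card fun s hs => ?_
    obtain ⟨p, hp, rfl⟩ := Finset.mem_image.1 hs
    obtain ⟨hpm, hpc, hpe⟩ := Finset.mem_filter.1 hp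
    obtain ⟨a, b, c, d, e⟩ := hmem p hpm
    refine Finset.mem_filter.2 ⟨Finset.mem_univ _, ?_, ?_⟩
    · rw [Finset.card_insert_of_notMem (by simp [e, c]), Finset.card_insert_of_notMem d]
    · convert isMaximalClique_insert_pair hS c d e (hρ1 _ a) (hρ2 _ b) (hq12 _ a _ b) hpc hpe
  refine le_trans (measureReal_mono fun U hU => ?_)
    ((measureReal_union_le _ _).trans (add_le_add hY hZ))
  simp only [mem_ofPred_eq, mem_union] at hU ⊢
  by_contra! hcon
  have := hcount U
  linarith [hcon.1, hcon.2]

/-! ### Typical weight configurations -/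

theorem pi_weightLaw_exists_le {τ : ℝ} (hτ : 2 < τ) {n : ℕ} {t : ℝ} (ht : 0 < t) :
    Measure.pi (fun _ : Fin n => weightLaw τ) {w | ∃ v, t ≤ w v} ≤
      ENNReal.ofReal (n * t ^ (1 - τ)) := by
  have := isProbabilityMeasure_weightLaw hτ
  have hset : {w : Fin n → ℝ | ∃ v, t ≤ w v} = ⋃ v, Function.eval v ⁻¹' Ici t := by
    ext w; simp
  rw [hset]
  calc _ ≤ ∑ v : Fin n, Measure.pi (fun _ : Fin n => weightLaw τ) (Function.eval v ⁻¹' Ici t) :=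
        measure_iUnion_fintype_le _ _
    _ ≤ ∑ v : Fin n, ENNReal.ofReal (t ^ (1 - τ)) := by
        refine Finset.sum_le_sum fun v _ => ?_
        rw [(measurePreserving_eval (fun _ : Fin n => weightLaw τ) v).measure_preimage
          measurableSet_Ici.nullMeasurableSet]
        exact weightLaw_Ici_le (by linarith) ht
    _ = _ := by
        rw [Finset.sum_const, Finset.card_univ, Fintype.card_fin, nsmul_eq_mul,
          ENNReal.ofReal_mul (Nat.cast_nonneg _), ENNReal.ofReal_natCast]

theorem pi_weightLaw_exists_highScale_le {τ μ : ℝ} (hτ : 2 < τ) (hμ : 0 < μ) {n : ℕ} (hn : 0 < n)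
    {A : ℝ} (hA : 0 < A) :
    Measure.pi (fun _ : Fin n => weightLaw τ) {w | ∃ v, A * highScale τ μ n ≤ w v} ≤
      ENNReal.ofReal (A ^ (1 - τ) / μ) := by
  have hn' : (0 : ℝ) < n := Nat.cast_pos.2 hn
  have hN : 0 < μ * n := mul_pos hμ hn'
  have hH := highScale_pos (τ := τ) hN
  refine (pi_weightLaw_exists_le hτ (mul_pos hA hH)).trans (le_of_eq ?_)
  rw [Real.mul_rpow hA.le hH.le, highScale_rpow hτ hN]
  congr 1
  field_simp

/-- Markov's inequality for the truncated sum of squares of the weights. -/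
theorem pi_weightLaw_sum_min_sq_le {τ μ : ℝ} (hτ : 2 < τ) (hτ3 : τ < 3) (hμ : 0 < μ) {n : ℕ}
    (hn : 0 < n) {c B : ℝ} (hc : 0 < c) (hB : 0 < B) :
    Measure.pi (fun _ : Fin n => weightLaw τ) {w | B ≤ ∑ v,
        min (c * ((highScale τ μ n)⁻¹ * w v)) 1 * min (c * ((highScale τ μ n)⁻¹ * w v)) 1} ≤
      ENNReal.ofReal ((commonMass τ c c).toReal / (μ * B)) := by
  have := isProbabilityMeasure_weightLaw hτ
  have hn' : (0 : ℝ) < n := Nat.cast_pos.2 hn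
  have hN : 0 < μ * n := mul_pos hμ hn'
  have hfin : commonMass τ c c < ∞ := (commonMass_le hc hc).trans_lt
    (ENNReal.mul_lt_top ENNReal.ofReal_lt_top (truncMoment_lt_top hτ hτ3))
  set g : ℝ → ℝ := fun y =>
    min (c * ((highScale τ μ n)⁻¹ * y)) 1 * min (c * ((highScale τ μ n)⁻¹ * y)) 1 with hg
  have hg0 : ∀ y, 0 ≤ g y := fun y => mul_self_nonneg _
  have hgm : Measurable g := by fun_prop
  have hsum : ∀ w : Fin n → ℝ, ENNReal.ofReal (∑ v, g (w v)) = ∑ v, ENNReal.ofReal (g (w v)) :=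
    fun w => ENNReal.ofReal_sum_of_nonneg fun v _ => hg0 _
  have hmarkov := mul_meas_ge_le_lintegral₀ (μ := Measure.pi fun _ : Fin n => weightLaw τ)
    (f := fun w => ENNReal.ofReal (∑ v, g (w v)))
    (Finset.measurable_sum _ fun v _ =>
      hgm.comp (measurable_pi_apply v)).ennreal_ofReal.aemeasurable
    (ENNReal.ofReal B)
  have hint : ∫⁻ w, ENNReal.ofReal (∑ v, g (w v)) ∂(Measure.pi fun _ : Fin n => weightLaw τ) ≤
      ENNReal.ofReal ((commonMass τ c c).toReal / μ) := by
    simp_rw [hsum]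
    have hm : ∀ v : Fin n, Measurable fun w : Fin n → ℝ => ENNReal.ofReal (g (w v)) := fun v =>
      (hgm.comp (measurable_pi_apply v)).ennreal_ofReal
    rw [lintegral_finsetSum _ fun v _ => hm v]
    calc _ ≤ ∑ v : Fin n, ENNReal.ofReal (μ * n)⁻¹ * commonMass τ c c := by
          refine Finset.sum_le_sum fun v _ => ?_
          rw [(measurePreserving_eval (fun _ : Fin n => weightLaw τ) v).lintegral_comp
            (f := fun y => ENNReal.ofReal (g y)) hgm.ennreal_ofReal]
          exact lintegral_weightLaw_min_sq_le hτ hN c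
      _ = _ := by
          rw [Finset.sum_const, Finset.card_univ, Fintype.card_fin, nsmul_eq_mul,
            ← ENNReal.ofReal_toReal hfin.ne, ← ENNReal.ofReal_mul (by positivity),
            ENNReal.ofReal_toReal hfin.ne, ← ENNReal.ofReal_natCast,
            ← ENNReal.ofReal_mul hn'.le]
          congr 1
          field_simp
  have hset : {w : Fin n → ℝ | B ≤ ∑ v, g (w v)} =
      {w | ENNReal.ofReal B ≤ ENNReal.ofReal (∑ v, g (w v))} := by
    ext w
    exact (ENNReal.ofReal_le_ofReal_iff (Finset.sum_nonneg fun v _ => hg0 _)).symm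
  have h := hmarkov.trans hint
  rw [hset]
  have hB' : ENNReal.ofReal B ≠ 0 := by simpa using hB
  rw [mul_comm, ← ENNReal.le_div_iff_mul_le (Or.inl hB') (Or.inl ENNReal.ofReal_ne_top)] at h
  refine h.trans (le_of_eq ?_)
  rw [← ENNReal.ofReal_div_of_pos hB, div_div]

/-- For weights that satisfy the conclusions of the preceding bounds, many maximal cliques exist
with high conditional probability. The constant `A` bounds the largest weight, `δ` is the least
weight of the `j` high vertices, and the pairs have low weights of scale `ε`. -/
theorem labelLaw_numMaxCliques_lt_le_of_weights {τ μ : ℝ} (hτ : 2 < τ) (hτ3 : τ < 3) (hμ : 0 < μ)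
    {n : ℕ} (hN : 1 ≤ μ * n) {A B δ ε : ℝ} (hA : 0 < A) (hδ : 0 < δ) (hδ1 : δ ≤ 1) (hε : 0 < ε)
    (hε1 : ε ≤ 1) {w : Fin n → ℝ} (hw : ∀ v, 1 ≤ w v) (hwA : ∀ v, w v ≤ A * highScale τ μ n)
    (hwB : ∑ v, min (A⁻¹ * ((highScale τ μ n)⁻¹ * w v)) 1 *
      min (A⁻¹ * ((highScale τ μ n)⁻¹ * w v)) 1 ≤ B) {j : ℕ}
    (hhigh : (j : ℝ) ≤ ∑ v, (Ici (δ * highScale τ μ n)).indicator (fun _ => (1 : ℝ)) (w v))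
    {m : ℕ} (hm : 0 < m)
    (hlow : ((2 * m : ℕ) : ℝ) ≤ ∑ v, (Ico (ε * lowScale τ μ n) (2 * ε * lowScale τ μ n)).indicator
      (fun _ => (1 : ℝ)) (w v))
    (hsep : 2 * ε * lowScale τ μ n ≤ δ * highScale τ μ n)
    (hclique : μ * n ≤ δ * highScale τ μ n * (δ * highScale τ μ n)) :
    (labelLaw (Sym2 (Fin n))).real {U | (numMaxCliques μ (j + 2) ((w, U) : Sample n) : ℝ) <
        (m : ℝ) ^ 2 * (ε ^ 2 * (lowScale τ μ n ^ 2 / (μ * n)) *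
          ((ε * δ) ^ j * (ε * δ) ^ j)) / 4} ≤
      4 * ((m : ℝ) ^ 2 * (ε ^ 2 * (lowScale τ μ n ^ 2 / (μ * n))) +
          2 * m ^ 3 * (ε ^ 2 * (lowScale τ μ n ^ 2 / (μ * n))) ^ 2) /
        ((m : ℝ) ^ 2 * (ε ^ 2 * (lowScale τ μ n ^ 2 / (μ * n)) *
          ((ε * δ) ^ j * (ε * δ) ^ j))) ^ 2 + 4 * (4 * ε ^ 2 * A ^ 2 * B) := by
  classical
  have hN0 : 0 < μ * n := by linarith
  have hL := lowScale_pos (τ := τ) hN0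
  have hH := highScale_pos (τ := τ) hN0
  have hLH := lowScale_mul_highScale hτ hN0
  have hle := lowScale_le_highScale hτ hτ3 hN
  set L := lowScale τ μ n with hLdef
  set H := highScale τ μ n with hHdef
  have hcount : ∀ I : Set ℝ, ∑ v, I.indicator (fun _ => (1 : ℝ)) (w v) =
      ((Finset.univ.filter fun v => w v ∈ I).card : ℝ) := fun I => by
    rw [Finset.card_filter]
    push_cast
    exact Finset.sum_congr rfl fun v _ => by simp [indicator_apply]
  rw [hcount, Nat.cast_le] at hhigh hlow
  obtain ⟨S, hSsub, hScard⟩ := Finset.exists_subset_card_eq hhigh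
  obtain ⟨L', hL'sub, hL'card⟩ := Finset.exists_subset_card_eq hlow
  obtain ⟨L₁, hL₁sub, hL₁card⟩ := Finset.exists_subset_card_eq (show m ≤ L'.card by omega)
  have hL₂card : (L' \ L₁).card = m := by
    rw [Finset.card_sdiff_of_subset hL₁sub, hL'card, hL₁card]; omega
  have hS : ∀ x ∈ S, δ * H ≤ w x := fun x hx => by
    simpa using hSsub hx
  have hlow' : ∀ u ∈ L', ε * L ≤ w u ∧ w u < 2 * ε * L := fun u hu => by
    simpa using hL'sub hu
  have hdisj : Disjoint L' S := by
    rw [Finset.disjoint_left]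
    intro u hu huS
    linarith [(hlow' u hu).2, hS u huS]
  have hq1 : ε ^ 2 * (L ^ 2 / (μ * n)) ≤ 1 := by
    refine mul_le_one₀ (pow_le_one₀ hε.le hε1) (by positivity) ?_
    rw [div_le_one hN0, ← hLH, pow_two]
    exact mul_le_mul_of_nonneg_left hle hL.le
  have hLS : ∀ u ∈ L', ∀ x ∈ S, ε * δ ≤ connProb μ n (w u) (w x) := fun u hu x hx => by
    refine le_min ?_ (mul_le_one₀ hε1 hδ.le hδ1)
    rw [le_div_iff₀ hN0, ← hLH]
    calc ε * δ * (L * H) = ε * L * (δ * H) := by ring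
      _ ≤ _ := mul_le_mul (hlow' u hu).1 (hS x hx) (by positivity) (by linarith [hw u])
  have hLL : ∀ u ∈ L', ∀ v ∈ L', ε ^ 2 * (L ^ 2 / (μ * n)) ≤ connProb μ n (w u) (w v) :=
    fun u hu v hv => by
    refine le_min ?_ hq1
    rw [mul_div_assoc', div_le_div_iff_of_pos_right hN0]
    calc ε ^ 2 * L ^ 2 = ε * L * (ε * L) := by ring
      _ ≤ _ := mul_le_mul (hlow' u hu).1 (hlow' v hv).1 (by positivity) (by linarith [hw u])
  have hσ : ∀ u ∈ L', ∀ v ∈ L', ∑ z, connProb μ n (w u) (w z) * connProb μ n (w v) (w z) ≤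
      4 * ε ^ 2 * A ^ 2 * B := fun u hu v hv => by
    have hz : ∀ u ∈ L', ∀ z, connProb μ n (w u) (w z) ≤
        2 * ε * A * min (A⁻¹ * (H⁻¹ * w z)) 1 := fun u hu z => by
      have h1 : A⁻¹ * (H⁻¹ * w z) ≤ 1 := by
        rw [← mul_assoc, ← mul_inv, ← div_eq_inv_mul, div_le_one (mul_pos hA hH)]
        exact hwA z
      rw [min_eq_left h1]
      refine (min_le_left _ _).trans ?_
      rw [← hLH, div_le_iff₀ (mul_pos hL hH)]
      have : 2 * ε * A * (A⁻¹ * (H⁻¹ * w z)) * (L * H) = 2 * ε * L * w z := by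
        field_simp
      rw [this]
      exact mul_le_mul_of_nonneg_right (hlow' u hu).2.le (by linarith [hw z])
    calc _ ≤ ∑ z, 2 * ε * A * min (A⁻¹ * (H⁻¹ * w z)) 1 *
          (2 * ε * A * min (A⁻¹ * (H⁻¹ * w z)) 1) := by
          refine Finset.sum_le_sum fun z _ => ?_
          have hc0 : ∀ u, 0 ≤ connProb μ n (w u) (w z) := fun u =>
            (connProb_mem_Icc hμ n (by linarith [hw u]) (by linarith [hw z])).1
          exact mul_le_mul (hz u hu z) (hz v hv z) (hc0 v) ((hc0 u).trans (hz u hu z))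
      _ = 4 * ε ^ 2 * A ^ 2 * ∑ z, min (A⁻¹ * (H⁻¹ * w z)) 1 * min (A⁻¹ * (H⁻¹ * w z)) 1 := by
          rw [Finset.mul_sum]
          exact Finset.sum_congr rfl fun z _ => by ring
      _ ≤ _ := mul_le_mul_of_nonneg_left hwB (by positivity)
  have hsub2 : L' \ L₁ ⊆ L' := Finset.sdiff_subset
  have h := labelLaw_numMaxCliques_lt_le hμ (fun v => by linarith [hw v])
    (S := S) (L₁ := L₁) (L₂ := L' \ L₁) (ρ := ε * δ) (q := ε ^ 2 * (L ^ 2 / (μ * n)))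
    (σ := 4 * ε ^ 2 * A ^ 2 * B) ⟨by positivity, mul_le_one₀ hε1 hδ.le hδ1⟩
    ⟨by positivity, hq1⟩ (hdisj.mono_left hL₁sub) (hdisj.mono_left hsub2)
    Finset.disjoint_sdiff hm hL₁card hL₂card
    (fun x hx y hy _ => min_eq_right (by
      rw [le_div_iff₀ hN0, one_mul]
      exact hclique.trans (mul_le_mul (hS x hx) (hS y hy) (by positivity) (by linarith [hw x]))))
    (fun u hu x hx => hLS u (hL₁sub hu) x hx) (fun v hv x hx => hLS v (hsub2 hv) x hx)
    (fun u hu v hv => hLL u (hL₁sub hu) v (hsub2 hv))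
    (fun u hu v hv => hσ u (hL₁sub hu) v (hsub2 hv))
  rw [hScard] at h
  exact h

/-! ### A lower bound for the number of maximal cliques -/

theorem numMaxCliques_eq_sum (μ : ℝ) (k : ℕ) {n : ℕ} (ω : Sample n) :
    (numMaxCliques μ k ω : ℝ) = ∑ s ∈ Finset.univ.powersetCard k,
      {ω : Sample n | IsMaximalClique (graph μ ω) s}.indicator (fun _ => 1) ω := by
  classical
  have h : numMaxCliques μ k ω = ((Finset.univ.powersetCard k).filter
      fun s : Finset (Fin n) => IsMaximalClique (graph μ ω) s).card := by
    unfold numMaxCliques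
    congr 1
    ext s
    simp [Finset.mem_powersetCard]
  rw [h, Finset.card_filter]
  push_cast
  exact Finset.sum_congr rfl fun s _ => by simp [indicator_apply]

theorem measurable_numMaxCliques (μ : ℝ) (k : ℕ) {n : ℕ} :
    Measurable fun ω : Sample n => (numMaxCliques μ k ω : ℝ) := by
  simp_rw [numMaxCliques_eq_sum]
  exact Finset.measurable_sum _ fun s _ => measurable_const.indicator
    (measurableSet_isMaximalClique μ s)

/-- A bound on the sections outside an exceptional set bounds the measure of the whole set. -/
theorem prod_le_add_of_sections {α β : Type*} [MeasurableSpace α] [MeasurableSpace β]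
    {P : Measure α} [IsProbabilityMeasure P] {Q : Measure β} [IsProbabilityMeasure Q]
    {s : Set (α × β)} (hs : MeasurableSet s) {bad : Set α} {e : ℝ≥0∞}
    (h : ∀ᵐ a ∂P, a ∉ bad → Q (Prod.mk a ⁻¹' s) ≤ e) : P.prod Q s ≤ P bad + e := by
  rw [Measure.prod_apply hs]
  calc ∫⁻ a, Q (Prod.mk a ⁻¹' s) ∂P
      ≤ ∫⁻ a, (toMeasurable P bad).indicator (fun _ => 1) a + e ∂P := by
        refine lintegral_mono_ae ?_
        filter_upwards [h] with a ha
        by_cases hb : a ∈ bad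
        · rw [indicator_of_mem (subset_toMeasurable P bad hb)]
          exact prob_le_one.trans le_self_add
        · exact (ha hb).trans le_add_self
    _ = P bad + e := by
        rw [lintegral_add_right _ measurable_const,
          lintegral_indicator_const (measurableSet_toMeasurable P bad), measure_toMeasurable]
        simp

theorem exists_one_le_le_rpow {s : ℝ} (hs : 0 < s) (K : ℝ) : ∃ R : ℝ, 1 ≤ R ∧ K ≤ R ^ s := by
  obtain ⟨R, h1, h2⟩ := ((eventually_ge_atTop (1 : ℝ)).and
    ((tendsto_rpow_atTop hs).eventually_ge_atTop K)).exists
  exact ⟨R, h1, h2⟩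

theorem exponent_pos {τ : ℝ} (hτ : 2 < τ) (hτ3 : τ < 3) : 0 < (3 - τ) * (2 * τ - 3) / (τ - 1) :=
  div_pos (mul_pos (by linarith) (by linarith)) (by linarith)

/-- The expected number of weights of the low scale. -/
theorem natCast_mul_weightLaw_low {τ μ ε : ℝ} (hτ : 2 < τ) {n : ℕ} (hN : 0 < μ * n) (hε : 0 < ε)
    (hL : 1 ≤ ε * lowScale τ μ n) :
    n * (weightLaw τ).real (Ico (ε * lowScale τ μ n) (2 * ε * lowScale τ μ n)) =
      (ε ^ (1 - τ) - (2 * ε) ^ (1 - τ)) * (n * lowScale τ μ n ^ (1 - τ)) := by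
  have hL0 := lowScale_pos (τ := τ) hN
  have h2 : ε * lowScale τ μ n ≤ 2 * ε * lowScale τ μ n := by nlinarith
  rw [Measure.real, weightLaw_Ico (by linarith) hL h2, ENNReal.toReal_ofReal
    (sub_nonneg.2 (Real.rpow_le_rpow_of_nonpos (by positivity) h2 (by linarith))),
    Real.mul_rpow hε.le hL0.le, Real.mul_rpow (by positivity) hL0.le]
  ring

theorem natCast_mul_weightLaw_high {τ μ δ : ℝ} (hτ : 2 < τ) (hμ : 0 < μ) {n : ℕ} (hn : 0 < n)
    (hδ : 0 < δ) (hH : 1 ≤ δ * highScale τ μ n) :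
    n * (weightLaw τ).real (Ici (δ * highScale τ μ n)) = δ ^ (1 - τ) / μ := by
  have hn' : (0 : ℝ) < n := Nat.cast_pos.2 hn
  have hN : 0 < μ * n := mul_pos hμ hn'
  rw [Measure.real, weightLaw_Ici (by linarith) hH, ENNReal.toReal_ofReal
    (Real.rpow_nonneg (by linarith) _), Real.mul_rpow hδ.le (highScale_pos hN).le,
    highScale_rpow hτ hN]
  field_simp

theorem tendsto_natCast_mul_lowScale_rpow {τ μ : ℝ} (hτ : 2 < τ) (hτ3 : τ < 3) (hμ : 0 < μ) :
    Tendsto (fun n : ℕ => (n : ℝ) * lowScale τ μ n ^ (1 - τ)) atTop atTop := by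
  have h : Tendsto (fun n : ℕ => μ⁻¹ * (μ * (n : ℝ)) ^ (3 - τ)) atTop atTop :=
    ((tendsto_rpow_atTop (by linarith)).comp (tendsto_mul_natCast_atTop hμ)).const_mul_atTop
      (inv_pos.2 hμ)
  refine h.congr' ?_
  filter_upwards [eventually_gt_atTop 0] with n hn
  have hn' : (0 : ℝ) < n := Nat.cast_pos.2 hn
  have hN : 0 < μ * n := mul_pos hμ hn'
  rw [lowScale_rpow hτ hN, show 3 - τ = 1 + (2 - τ) by ring, Real.rpow_add hN, Real.rpow_one]
  field_simp

/-- The low scale is of smaller order than the high scale. -/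
theorem eventually_mul_lowScale_le {τ μ : ℝ} (hτ : 2 < τ) (hτ3 : τ < 3) (hμ : 0 < μ) (A : ℝ) :
    ∀ᶠ n : ℕ in atTop, A * lowScale τ μ n ≤ highScale τ μ n := by
  have h : Tendsto (fun n : ℕ => (μ * (n : ℝ)) ^ ((3 - τ) / (τ - 1))) atTop atTop :=
    (tendsto_rpow_atTop (div_pos (by linarith) (by linarith))).comp (tendsto_mul_natCast_atTop hμ)
  filter_upwards [h.eventually_ge_atTop A, eventually_gt_atTop 0] with n hn h0
  have hN : 0 < μ * n := mul_pos hμ (Nat.cast_pos.2 h0)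
  calc _ ≤ (μ * (n : ℝ)) ^ ((3 - τ) / (τ - 1)) * lowScale τ μ n :=
        mul_le_mul_of_nonneg_right hn (lowScale_pos hN).le
    _ = _ := by
        rw [lowScale, highScale, ← Real.rpow_add hN]
        congr 1
        ring

/-- The bound of the second moment method is small once both the number of pairs, weighted with `q`,
and the number of vertices are large. -/
theorem variance_ratio_le {m q b θ : ℝ} (hm : 0 < m) (hq : 0 < q) (hb : 0 < b) (hθ : 0 < θ)
    (h1 : 8 / (b ^ 2 * θ) ≤ m ^ 2 * q) (h2 : 16 / (b ^ 2 * θ) ≤ m) :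
    4 * (m ^ 2 * q + 2 * m ^ 3 * q ^ 2) / (m ^ 2 * (q * b)) ^ 2 ≤ θ := by
  have e : 4 * (m ^ 2 * q + 2 * m ^ 3 * q ^ 2) / (m ^ 2 * (q * b)) ^ 2 =
      4 / b ^ 2 / (m ^ 2 * q) + 8 / b ^ 2 / m := by
    field_simp
    ring
  rw [e]
  have k1 : 4 / b ^ 2 / (m ^ 2 * q) ≤ θ / 2 := by
    rw [div_le_iff₀ (by positivity)]
    calc 4 / b ^ 2 = θ / 2 * (8 / (b ^ 2 * θ)) := by field_simp; norm_num
      _ ≤ _ := mul_le_mul_of_nonneg_left h1 (by positivity)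
  have k2 : 8 / b ^ 2 / m ≤ θ / 2 := by
    rw [div_le_iff₀ hm]
    calc 8 / b ^ 2 = θ / 2 * (16 / (b ^ 2 * θ)) := by field_simp; norm_num
      _ ≤ _ := mul_le_mul_of_nonneg_left h2 (by positivity)
  linarith

/-- The number of pairs of weights of the low scale, times their connection probability, is of the
order of the number of typical cliques. -/
theorem exists_le_sq_mul_connProb_low {τ μ ε : ℝ} (hτ : 2 < τ) (hτ3 : τ < 3) (hμ : 0 < μ)
    (hε : 0 < ε) : ∃ κ : ℝ, 0 < κ ∧ ∃ x : ℕ → ℝ, Tendsto x atTop atTop ∧ ∀ᶠ n : ℕ in atTop,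
      n * (weightLaw τ).real (Ico (ε * lowScale τ μ n) (2 * ε * lowScale τ μ n)) = x n ∧
      κ * (n : ℝ) ^ ((3 - τ) * (2 * τ - 3) / (τ - 1)) ≤
        (⌊x n / 4⌋₊ : ℝ) ^ 2 * (ε ^ 2 * (lowScale τ μ n ^ 2 / (μ * n))) := by
  have hc : 0 < ε ^ (1 - τ) - (2 * ε) ^ (1 - τ) :=
    sub_pos.2 (Real.rpow_lt_rpow_of_neg hε (by linarith) (by linarith))
  set c := ε ^ (1 - τ) - (2 * ε) ^ (1 - τ)
  have hx : Tendsto (fun n : ℕ => c * ((n : ℝ) * lowScale τ μ n ^ (1 - τ))) atTop atTop :=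
    (tendsto_natCast_mul_lowScale_rpow hτ hτ3 hμ).const_mul_atTop hc
  refine ⟨c ^ 2 / 64 * ε ^ 2 * μ ^ ((3 - τ) * (2 * τ - 3) / (τ - 1) - 2), by positivity, _, hx, ?_⟩
  filter_upwards [eventually_gt_atTop 0, (tendsto_lowScale hτ hμ).eventually_ge_atTop ε⁻¹,
    hx.eventually_ge_atTop 8] with n hn hL h8
  have hn' : (0 : ℝ) < n := Nat.cast_pos.2 hn
  have hN : 0 < μ * n := mul_pos hμ hn'
  have hL0 := lowScale_pos (τ := τ) hN
  have hL1 : 1 ≤ ε * lowScale τ μ n := by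
    rwa [inv_le_iff_one_le_mul₀' hε] at hL
  refine ⟨natCast_mul_weightLaw_low hτ hN hε hL1, ?_⟩
  have hs := scales_mul_eq hτ hμ hn 0
  simp only [pow_zero, mul_one, zero_add, Nat.cast_zero] at hs
  set x := c * ((n : ℝ) * lowScale τ μ n ^ (1 - τ)) with hxdef
  have hfloor : x / 8 ≤ (⌊x / 4⌋₊ : ℝ) := by
    have := Nat.lt_floor_add_one (x / 4)
    linarith
  calc _ = (x / 8) ^ 2 * (ε ^ 2 * (lowScale τ μ n ^ 2 / (μ * n))) := by
        rw [mul_assoc _ (μ ^ _), ← hs, hxdef]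
        ring
    _ ≤ _ := mul_le_mul_of_nonneg_right (pow_le_pow_left₀ (by linarith) hfloor 2) (by positivity)

/-- The weights satisfy, up to a small probability, the hypotheses of
`labelLaw_numMaxCliques_lt_le_of_weights`. -/
theorem pi_weightLaw_atypical_le {τ μ : ℝ} (hτ : 2 < τ) (hτ3 : τ < 3) (hμ : 0 < μ) {n : ℕ}
    (hn : 0 < n) {A B δ ε θ x : ℝ} (hA : 0 < A) (hB : 0 < B) (hδ : 0 < δ) (hθ : 0 < θ)
    (hAθ : A ^ (1 - τ) / μ ≤ θ) (hBθ : (commonMass τ A⁻¹ A⁻¹).toReal / (μ * B) ≤ θ)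
    (hH : 1 ≤ δ * highScale τ μ n) (hδθ : 4 / θ ≤ δ ^ (1 - τ) / μ)
    (hx : n * (weightLaw τ).real (Ico (ε * lowScale τ μ n) (2 * ε * lowScale τ μ n)) = x)
    (hxθ : 4 / θ ≤ x) :
    Measure.pi (fun _ : Fin n => weightLaw τ) (({w | ∃ v, A * highScale τ μ n ≤ w v} ∪
      {w | B ≤ ∑ v, min (A⁻¹ * ((highScale τ μ n)⁻¹ * w v)) 1 *
        min (A⁻¹ * ((highScale τ μ n)⁻¹ * w v)) 1}) ∪
      ({w | ∑ v, (Ici (δ * highScale τ μ n)).indicator (fun _ => (1 : ℝ)) (w v) ≤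
        δ ^ (1 - τ) / μ / 2} ∪
      {w | ∑ v, (Ico (ε * lowScale τ μ n) (2 * ε * lowScale τ μ n)).indicator
        (fun _ => (1 : ℝ)) (w v) ≤ x / 2})) ≤ ENNReal.ofReal (4 * θ) := by
  have := isProbabilityMeasure_weightLaw hτ
  have hcount : ∀ {I : Set ℝ}, MeasurableSet I → ∀ {y : ℝ}, n * (weightLaw τ).real I = y →
      4 / θ ≤ y → Measure.pi (fun _ : Fin n => weightLaw τ)
        {w | ∑ v, I.indicator (fun _ => (1 : ℝ)) (w v) ≤ y / 2} ≤ ENNReal.ofReal θ := by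
    rintro I hI y rfl hy
    have hy0 : 0 < n * (weightLaw τ).real I := (by positivity : 0 < 4 / θ).trans_le hy
    have h := pi_real_card_le (n := n) (weightLaw τ) hI hy0
    rw [← ofReal_measureReal]
    refine ENNReal.ofReal_le_ofReal (h.trans ?_)
    rwa [div_le_iff₀ hy0, mul_comm, ← div_le_iff₀ hθ]
  have h1 := (pi_weightLaw_exists_highScale_le hτ hμ hn hA).trans (ENNReal.ofReal_le_ofReal hAθ)
  have h2 := (pi_weightLaw_sum_min_sq_le hτ hτ3 hμ hn (inv_pos.2 hA) hB).trans
    (ENNReal.ofReal_le_ofReal hBθ)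
  have h3 := hcount measurableSet_Ici (natCast_mul_weightLaw_high hτ hμ hn hδ hH) hδθ
  have h4 := hcount measurableSet_Ico hx hxθ
  refine (measure_union_le _ _).trans ((add_le_add ((measure_union_le _ _).trans (add_le_add h1 h2))
    ((measure_union_le _ _).trans (add_le_add h3 h4))).trans (le_of_eq ?_))
  rw [← ENNReal.ofReal_add hθ.le hθ.le, ← ENNReal.ofReal_add (by positivity) (by positivity)]
  congr 1
  ring

/-- With high probability, the number of maximal cliques is at least of the order of its
expectation. -/
theorem exists_eventually_sampleLaw_numMaxCliques_lt_le {τ μ : ℝ} (hτ : 2 < τ) (hτ3 : τ < 3)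
    (hμ : 0 < μ) (j : ℕ) {η : ℝ} (hη : 0 < η) : ∃ c : ℝ, 0 < c ∧ ∀ᶠ n : ℕ in atTop,
      sampleLaw τ n {ω | (numMaxCliques μ (j + 2) ω : ℝ) <
        c * (n : ℝ) ^ ((3 - τ) * (2 * τ - 3) / (τ - 1))} ≤ ENNReal.ofReal η := by
  have := isProbabilityMeasure_weightLaw hτ
  obtain ⟨θ, hθ, hηθ⟩ : ∃ θ : ℝ, 0 < θ ∧ η = 6 * θ := ⟨η / 6, by positivity, by ring⟩
  -- `A` bounds the weights, in units of the high scale.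
  obtain ⟨A, hA1, hAK⟩ := exists_one_le_le_rpow (s := τ - 1) (by linarith) (1 / (μ * θ))
  have hA : 0 < A := by linarith
  have hAθ : A ^ (1 - τ) / μ ≤ θ := by
    rw [show 1 - τ = -(τ - 1) by ring, Real.rpow_neg hA.le, div_le_iff₀ hμ,
      inv_le_comm₀ (by positivity) (by positivity), ← one_div, mul_comm θ]
    exact hAK
  -- `B` bounds the number of common neighbours of two low vertices, up to a factor.
  set M := (commonMass τ A⁻¹ A⁻¹).toReal with hM
  have hM0 : 0 ≤ M := ENNReal.toReal_nonneg
  set B := (M + 1) / (μ * θ) with hBdef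
  have hB : 0 < B := by positivity
  have hBθ : M / (μ * B) ≤ θ := by
    rw [div_le_iff₀ (by positivity), hBdef]
    field_simp
    linarith
  -- `δ` makes vertices of high weight abundant.
  obtain ⟨R, hR1, hRK⟩ := exists_one_le_le_rpow (s := τ - 1) (by linarith)
    (μ * (4 / θ + 2 * j))
  obtain ⟨δ, hδ, hδ1, hδK⟩ : ∃ δ : ℝ, 0 < δ ∧ δ ≤ 1 ∧ 4 / θ + 2 * j ≤ δ ^ (1 - τ) / μ := by
    refine ⟨R⁻¹, by positivity, inv_le_one_of_one_le₀ hR1, ?_⟩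
    rw [Real.inv_rpow (by linarith), ← Real.rpow_neg (by linarith), neg_sub, le_div_iff₀ hμ,
      mul_comm]
    exact hRK
  -- `ε` makes common neighbours of two low vertices rare.
  obtain ⟨ε, hε, hε1, hεθ⟩ : ∃ ε : ℝ, 0 < ε ∧ ε ≤ 1 ∧ 4 * (4 * ε ^ 2 * A ^ 2 * B) ≤ θ := by
    refine ⟨min 1 (θ / (16 * A ^ 2 * B)), by positivity, min_le_left _ _, ?_⟩
    set e := min 1 (θ / (16 * A ^ 2 * B))
    have he0 : 0 < e := by positivity
    have he1 : e ≤ 1 := min_le_left _ _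
    have he2 : e * (16 * A ^ 2 * B) ≤ θ := (le_div_iff₀ (by positivity)).1 (min_le_right _ _)
    calc 4 * (4 * e ^ 2 * A ^ 2 * B) = e * (e * (16 * A ^ 2 * B)) := by ring
      _ ≤ 1 * (e * (16 * A ^ 2 * B)) := mul_le_mul_of_nonneg_right he1 (by positivity)
      _ ≤ θ := by rwa [one_mul]
  obtain ⟨κ, hκ, x, hx, hev⟩ := exists_le_sq_mul_connProb_low hτ hτ3 hμ hε
  set b := (ε * δ) ^ j * (ε * δ) ^ j with hb
  have hb0 : 0 < b := by positivity
  refine ⟨κ * b / 4, by positivity, ?_⟩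
  have hm : Tendsto (fun n => (⌊x n / 4⌋₊ : ℝ)) atTop atTop :=
    tendsto_natCast_atTop_atTop.comp
      (tendsto_nat_floor_atTop.comp (hx.atTop_div_const (by norm_num)))
  have hnE : Tendsto (fun n : ℕ => κ * (n : ℝ) ^ ((3 - τ) * (2 * τ - 3) / (τ - 1))) atTop atTop :=
    ((tendsto_rpow_atTop (exponent_pos hτ hτ3)).comp tendsto_natCast_atTop_atTop).const_mul_atTop hκ
  filter_upwards [hev, eventually_gt_atTop 0, hx.eventually_ge_atTop (4 / θ),
    hm.eventually_ge_atTop (16 / (b ^ 2 * θ)), hm.eventually_gt_atTop 0,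
    hnE.eventually_ge_atTop (8 / (b ^ 2 * θ)),
    (tendsto_mul_natCast_atTop hμ).eventually_ge_atTop 1,
    (tendsto_highScale hτ hμ).eventually_ge_atTop δ⁻¹,
    eventually_mul_lowScale_le hτ hτ3 hμ (2 * ε / δ),
    eventually_mul_lowScale_le hτ hτ3 hμ (1 / δ ^ 2)]
    with n hxn hn hx4 hm16 hm0 hE8 hN1 hHδ hsep hclq
  have hn' : (0 : ℝ) < n := Nat.cast_pos.2 hn
  have hN : 0 < μ * n := mul_pos hμ hn'
  have hL0 := lowScale_pos (τ := τ) hN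
  have hH0 := highScale_pos (τ := τ) hN
  have hLH := lowScale_mul_highScale hτ hN
  have hHδ1 : 1 ≤ δ * highScale τ μ n := by rwa [inv_le_iff_one_le_mul₀' hδ] at hHδ
  have hxpos : 0 < x n := (by positivity : 0 < 4 / θ).trans_le hx4
  have hsep' : 2 * ε * lowScale τ μ n ≤ δ * highScale τ μ n := by
    rwa [div_mul_eq_mul_div, div_le_iff₀ hδ, mul_comm (highScale τ μ n)] at hsep
  have hclq' : μ * n ≤ δ * highScale τ μ n * (δ * highScale τ μ n) := by
    rw [div_mul_eq_mul_div, one_mul, div_le_iff₀ (by positivity)] at hclq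
    rw [← hLH]
    calc _ ≤ highScale τ μ n * δ ^ 2 * highScale τ μ n := mul_le_mul_of_nonneg_right hclq hH0.le
      _ = _ := by ring
  set q := ε ^ 2 * (lowScale τ μ n ^ 2 / (μ * n)) with hq
  have hq0 : 0 < q := by positivity
  have hvar := variance_ratio_le hm0 hq0 hb0 hθ (hE8.trans hxn.2) hm16
  have hbad := pi_weightLaw_atypical_le hτ hτ3 hμ hn hA hB hδ hθ hAθ hBθ hHδ1
    (by have : (0 : ℝ) ≤ 2 * j := by positivity
        linarith) hxn.1 hx4
  have hmeas : MeasurableSet {ω : Sample n | (numMaxCliques μ (j + 2) ω : ℝ) <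
      κ * b / 4 * (n : ℝ) ^ ((3 - τ) * (2 * τ - 3) / (τ - 1))} :=
    measurableSet_lt (measurable_numMaxCliques μ (j + 2)) measurable_const
  have hone : ∀ᵐ w ∂(Measure.pi fun _ : Fin n => weightLaw τ), ∀ v, 1 ≤ w v :=
    ae_all_iff.2 fun v => (measurePreserving_eval (fun _ : Fin n => weightLaw τ)
      v).quasiMeasurePreserving.ae (ae_one_le_weightLaw τ)
  have hηsum : ENNReal.ofReal η = ENNReal.ofReal (4 * θ) + ENNReal.ofReal (2 * θ) := by
    rw [← ENNReal.ofReal_add (by positivity) (by positivity), hηθ]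
    congr 1
    ring
  rw [hηsum]
  refine (prod_le_add_of_sections hmeas ?_).trans (add_le_add hbad le_rfl)
  filter_upwards [hone] with w hw hwbad
  simp only [mem_union, mem_ofPred_eq, not_or, not_exists, not_le] at hwbad
  obtain ⟨⟨hwA, hwB⟩, hwH, hwL⟩ := hwbad
  have hmx : ((2 * ⌊x n / 4⌋₊ : ℕ) : ℝ) ≤ x n / 2 := by
    have := Nat.floor_le (show 0 ≤ x n / 4 by positivity)
    push_cast
    linarith
  have hj2 : (j : ℝ) ≤ δ ^ (1 - τ) / μ / 2 := by
    have : 0 < 4 / θ := by positivity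
    linarith
  have h := labelLaw_numMaxCliques_lt_le_of_weights hτ hτ3 hμ hN1 hA hδ hδ1 hε hε1 hw
    (fun v => (hwA v).le) hwB.le (hj2.trans hwH.le) (Nat.cast_pos.1 hm0) (hmx.trans hwL.le)
    hsep' hclq'
  rw [← hq, ← hb] at h
  rw [← ofReal_measureReal]
  refine ENNReal.ofReal_le_ofReal (le_trans (measureReal_mono fun U hU => ?_)
    (h.trans (by linarith)))
  simp only [mem_preimage, mem_ofPred_eq] at hU ⊢
  refine hU.trans_le ?_
  calc _ = κ * (n : ℝ) ^ ((3 - τ) * (2 * τ - 3) / (τ - 1)) * (b / 4) := by ring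
    _ ≤ (⌊x n / 4⌋₊ : ℝ) ^ 2 * q * (b / 4) := mul_le_mul_of_nonneg_right hxn.2 (by positivity)
    _ = _ := by ring

/-! ### Localization in probability -/

theorem numTypicalMaxCliques_le_numMaxCliques (τ μ ε : ℝ) (k : ℕ) {n : ℕ} (ω : Sample n) :
    numTypicalMaxCliques τ μ ε k ω ≤ numMaxCliques μ k ω :=
  Finset.card_le_card fun _ hs => by
    simp only [Finset.mem_filter] at hs ⊢
    exact ⟨hs.1, hs.2.1, hs.2.2.1⟩

/-- With high probability, all weights are at most `μ n`. -/
theorem tendsto_sampleLaw_exists_le {τ μ : ℝ} (hτ : 2 < τ) (hμ : 0 < μ) :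
    Tendsto (fun n : ℕ => sampleLaw τ n {ω | ∃ v, μ * n ≤ ω.1 v}) atTop (𝓝 0) := by
  have := isProbabilityMeasure_weightLaw hτ
  have hlim : Tendsto (fun n : ℕ => ENNReal.ofReal (μ⁻¹ * (μ * (n : ℝ)) ^ (-(τ - 2)))) atTop
      (𝓝 0) := by
    have h := (((tendsto_rpow_neg_atTop (show 0 < τ - 2 by linarith)).comp
      (tendsto_mul_natCast_atTop hμ)).const_mul μ⁻¹)
    rw [mul_zero] at h
    simpa using ENNReal.tendsto_ofReal h
  refine tendsto_of_tendsto_of_tendsto_of_le_of_le' tendsto_const_nhds hlim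
    (Eventually.of_forall fun _ => zero_le) ?_
  filter_upwards [eventually_gt_atTop 0] with n hn
  have hn' : (0 : ℝ) < n := Nat.cast_pos.2 hn
  have hN : 0 < μ * n := mul_pos hμ hn'
  have hset : {ω : Sample n | ∃ v, μ * n ≤ ω.1 v} =
      {w : Fin n → ℝ | ∃ v, μ * n ≤ w v} ×ˢ univ := by
    ext ω; simp
  rw [hset, sampleLaw, Measure.prod_prod, measure_univ, mul_one]
  refine (pi_weightLaw_exists_le hτ hN).trans (le_of_eq ?_)
  congr 1
  rw [show -(τ - 2) = 1 + (1 - τ) by ring, Real.rpow_add hN, Real.rpow_one]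
  field_simp

/-- The number of maximal cliques of atypical weights is of smaller order than the expected number
of maximal cliques. -/
theorem tendsto_sampleLaw_card_atypical {τ μ : ℝ} (hτ : 2 < τ) (hτ3 : τ < 3) (hμ : 0 < μ) {j : ℕ}
    (hj : 1 ≤ j) {ε : ℕ → ℝ} (hε : ∀ n, 0 < ε n) (hε0 : Tendsto ε atTop (𝓝 0)) {c : ℝ}
    (hc : 0 < c) :
    Tendsto (fun n : ℕ => sampleLaw τ n {ω | ENNReal.ofReal
        (c * (n : ℝ) ^ ((3 - τ) * (2 * τ - 3) / (τ - 1))) ≤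
      (tuples μ (lowPairs j) (orderedOutside τ μ n (ε n) j) ω).card}) atTop (𝓝 0) := by
  have hI := tendsto_setLIntegral_cliqueDensity (c := 1 / (2 * μ)) hτ hτ3 (by positivity) hj hε hε0
  have hlim := ENNReal.Tendsto.const_mul (a := ENNReal.ofReal
    (μ ^ ((3 - τ) * (2 * τ - 3) / (τ - 1) - (j + 2 : ℝ)) / c)) hI (Or.inr ENNReal.ofReal_ne_top)
  rw [mul_zero] at hlim
  refine tendsto_of_tendsto_of_tendsto_of_le_of_le' tendsto_const_nhds hlim
    (Eventually.of_forall fun _ => zero_le) ?_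
  filter_upwards [eventually_ge_atTop (2 * (j + 2))] with n hn
  have hn' : (0 : ℝ) < n := Nat.cast_pos.2 (by omega)
  have hnE : 0 < (n : ℝ) ^ ((3 - τ) * (2 * τ - 3) / (τ - 1)) := Real.rpow_pos_of_pos hn' _
  have hpos : 0 < c * (n : ℝ) ^ ((3 - τ) * (2 * τ - 3) / (τ - 1)) := by positivity
  refine (meas_ge_le_lintegral_div (aemeasurable_card_tuples (lowPairs j)
    (measurableSet_orderedOutside τ μ n (ε n) j)) (by simpa using hpos)
    ENNReal.ofReal_ne_top).trans ?_
  refine (ENNReal.div_le_div_right (lintegral_card_atypical_le hτ hμ hn (ε n)) _).trans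
    (le_of_eq ?_)
  rw [ENNReal.mul_div_right_comm, ← ENNReal.ofReal_div_of_pos hpos, mul_div_mul_right _ _ hnE.ne']

/-- Away from the exceptional events, the proportion of typical maximal cliques is close to `1`. -/
theorem abs_div_sub_one_lt {τ μ ε δ r : ℝ} {n j : ℕ} (hN : 0 < μ * n) (hδ : 0 < δ) (hr : 0 < r)
    {ω : Sample n} (hw : ∀ v, ω.1 v < μ * n) (hmax : r ≤ numMaxCliques μ (j + 2) ω)
    (hcard : ((tuples μ (lowPairs j) (orderedOutside τ μ n ε j) ω).card : ℝ) < δ * r) :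
    |(numTypicalMaxCliques τ μ ε (j + 2) ω : ℝ) / numMaxCliques μ (j + 2) ω - 1| < δ := by
  have h1 : (numMaxCliques μ (j + 2) ω : ℝ) ≤ numTypicalMaxCliques τ μ ε (j + 2) ω +
      (tuples μ (lowPairs j) (orderedOutside τ μ n ε j) ω).card := by
    exact_mod_cast numMaxCliques_le hN fun v => (hw v).le
  have h2 : (numTypicalMaxCliques τ μ ε (j + 2) ω : ℝ) ≤ numMaxCliques μ (j + 2) ω :=
    Nat.cast_le.2 (numTypicalMaxCliques_le_numMaxCliques τ μ ε (j + 2) ω)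
  have hpos : (0 : ℝ) < numMaxCliques μ (j + 2) ω := hr.trans_le hmax
  rw [div_sub_one hpos.ne', abs_div, abs_of_pos hpos, div_lt_iff₀ hpos, abs_of_nonpos (by linarith)]
  have := mul_le_mul_of_nonneg_left hmax hδ.le
  linarith

/-- Localization in probability, for cliques of size `j + 2`. -/
theorem tendsto_sampleLaw_ratio {τ μ : ℝ} (hτ : 2 < τ) (hτ3 : τ < 3) (hμ : 0 < μ) {j : ℕ}
    (hj : 1 ≤ j) {ε : ℕ → ℝ} (hε : ∀ n, 0 < ε n) (hε0 : Tendsto ε atTop (𝓝 0)) {δ : ℝ}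
    (hδ : 0 < δ) :
    Tendsto (fun n : ℕ => sampleLaw τ n
      {ω | δ ≤ |(numTypicalMaxCliques τ μ (ε n) (j + 2) ω : ℝ) /
        (numMaxCliques μ (j + 2) ω : ℝ) - 1|}) atTop (𝓝 0) := by
  rw [ENNReal.tendsto_nhds_zero]
  intro η hη
  obtain ⟨θ, hθ, hθη⟩ : ∃ θ : ℝ, 0 < θ ∧ ENNReal.ofReal (3 * θ) ≤ η := by
    rcases eq_or_ne η ∞ with rfl | hη'
    · exact ⟨1, one_pos, le_top⟩
    · refine ⟨η.toReal / 3, div_pos (ENNReal.toReal_pos hη.ne' hη') three_pos, ?_⟩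
      rw [mul_div_cancel₀ _ three_ne_zero, ENNReal.ofReal_toReal hη']
  obtain ⟨c, hc, hlow⟩ := exists_eventually_sampleLaw_numMaxCliques_lt_le hτ hτ3 hμ j hθ
  have hθ' : 0 < ENNReal.ofReal θ := ENNReal.ofReal_pos.2 hθ
  filter_upwards [hlow, ENNReal.tendsto_nhds_zero.1 (tendsto_sampleLaw_exists_le hτ hμ) _ hθ',
    ENNReal.tendsto_nhds_zero.1 (tendsto_sampleLaw_card_atypical hτ hτ3 hμ hj hε hε0
      (mul_pos hδ hc)) _ hθ', eventually_gt_atTop 0] with n h1 h2 h3 hn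
  have hn' : (0 : ℝ) < n := Nat.cast_pos.2 hn
  have hr : 0 < c * (n : ℝ) ^ ((3 - τ) * (2 * τ - 3) / (τ - 1)) := by positivity
  refine le_trans (measure_mono (t := {ω : Sample n | (numMaxCliques μ (j + 2) ω : ℝ) <
      c * (n : ℝ) ^ ((3 - τ) * (2 * τ - 3) / (τ - 1))} ∪ ({ω | ∃ v, μ * n ≤ ω.1 v} ∪
      {ω | ENNReal.ofReal (δ * c * (n : ℝ) ^ ((3 - τ) * (2 * τ - 3) / (τ - 1))) ≤
        (tuples μ (lowPairs j) (orderedOutside τ μ n (ε n) j) ω).card})) fun ω hω => ?_) ?_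
  · by_contra hcon
    simp only [mem_union, mem_ofPred_eq, not_or, not_exists, not_lt, not_le] at hcon hω
    obtain ⟨k1, k2, k3⟩ := hcon
    refine absurd hω (not_le.2 (abs_div_sub_one_lt (mul_pos hμ hn') hδ hr k2 k1 ?_))
    rw [← ENNReal.ofReal_natCast, ENNReal.ofReal_lt_ofReal_iff (by positivity)] at k3
    rwa [← mul_assoc]
  · refine (measure_union_le _ _).trans ((add_le_add h1 ((measure_union_le _ _).trans
      (add_le_add h2 h3))).trans (le_trans (le_of_eq ?_) hθη))
    rw [← ENNReal.ofReal_add hθ.le hθ.le, ← ENNReal.ofReal_add (by positivity) (by positivity)]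
    congr 1
    ring

end IRG

/-- Maximal clique localization in the inhomogeneous random graph. The measures in the first part
live on different spaces, so convergence in probability to `1` is written out. -/
theorem mainTheorem3 (τ : ℝ) (hτ : τ ∈ Ioo (2 : ℝ) 3) (μ : ℝ) (hμ : 0 < μ)
    (k : ℕ) (hk : 3 ≤ k) :
    (∀ ε : ℕ → ℝ, (∀ n, 0 < ε n) → Tendsto ε atTop (𝓝 0) →
      ∀ δ : ℝ, 0 < δ →
        Tendsto (fun n : ℕ => IRG.sampleLaw τ n
            {ω | δ ≤ |(IRG.numTypicalMaxCliques τ μ (ε n) k ω : ℝ) /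
              (IRG.numMaxCliques μ k ω : ℝ) - 1|})
          atTop (𝓝 0)) ∧
    (∀ ε : ℝ, 0 < ε → ε < 1 →
      (fun n : ℕ => ∫ ω, (IRG.numTypicalMaxCliques τ μ ε k ω : ℝ) ∂(IRG.sampleLaw τ n))
        =Θ[atTop] fun n : ℕ => (n : ℝ) ^ ((3 - τ) * (2 * τ - 3) / (τ - 1))) := by
  obtain ⟨j, rfl⟩ : ∃ j, k = j + 2 := ⟨k - 2, by omega⟩
  exact ⟨fun ε hε hε0 δ hδ =>
      IRG.tendsto_sampleLaw_ratio hτ.1 hτ.2 hμ (by omega) hε hε0 hδ,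
    fun ε hε hε1 =>
      IRG.isTheta_integral_numTypicalMaxCliques hτ.1 hτ.2 hμ hε hε1 (by omega)⟩
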